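/- Let $\mathfrak g$ and $\mathfrak g^\vee$ be finite-dimensional complex simple Lie algebras (the complexified Lie algebras of a compact simple gauge group $G$ and of its Langlands dual $G^\vee$), with Cartan subalgebras $\mathfrak h\subset\mathfrak g$ and $\mathfrak h^\vee\subset\mathfrak g^\vee$. Fix an isomorphism $e$ from the dual of the root system of $(\mathfrak g,\mathfrak h)$ (roots and coroots interchanged) to the root system of $(\mathfrak g^\vee,\mathfrak h^\vee)$; for a root $\alpha$ of $\mathfrak g$ let $e(\alpha)$ be the root of $\mathfrak g^\vee$ that corresponds to the coroot of $\alpha$. Definitions. The adjoint group is the group of automorphisms of $\mathfrak g$ generated by the $\exp(\operatorname{ad}x)$ with $\operatorname{ad}x$ nilpotent; orbits and conjugacy refer to it. A Levi subalgebra is the centralizer of a semisimple element. A sheet is an irreducible component (in the Zariski topology) of the set of elements whose adjoint orbit has a given dimension; a Dixmier sheet is a sheet that contains a semisimple element. An aligned vacuum (of $\mathcal N=4$ SYM) is a triple $(O_1,O_2,O_3)$ of semisimple adjoint orbits that all lie in one sheet. For a Levi subalgebra $\mathfrak m$, the stratum $\mathcal V_{\mathfrak m}$ with unbroken gauge algebra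 $\mathfrak m$ is the set of aligned vacua such that each $O_i$ contains an element with centralizer $\mathfrak m$. The strata are the sets $\mathcal V_{\mathfrak m}$. We write $X_1\preceq X_2$ ($X_1$ can be reached from $X_2$ by symmetry breaking) if $X_i=\mathcal V_{\mathfrak m_i}$ for some Levi subalgebras $\mathfrak m_1\subseteq\mathfrak m_2$. The same definitions apply to $\mathfrak g^\vee$. For Levi subalgebras $\mathfrak m\supseteq\mathfrak h$ of $\mathfrak g$ and $\mathfrak m^\vee\supseteq\mathfrak h^\vee$ of $\mathfrak g^\vee$, we say that $\mathfrak m^\vee$ is dual to $\mathfrak m$ if the roots of $\mathfrak m^\vee$ are exactly the $e(\alpha)$ with $\alpha$ a root of $\mathfrak m$. For a set $J$ of roots, $\mathfrak m_J$ is the subalgebra generated by the Cartan subalgebra and the root spaces of $\pm\alpha$, $\alpha\in J$. Then: (1) The strata form a partition of the set of aligned vacua, and $\mathcal V_{\mathfrak m_1}=\mathcal V_{\mathfrak m_2}$ if and only if $\mathfrak m_1$ and $\mathfrak m_2$ are conjugate. Sending a Dixmier sheet $S$ to the set of aligned vacua all of whose orbits lie in $S$ is a bijection from Dixmier sheets to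 strata, and this set is $\mathcal V_{\mathfrak m}$ if and only if $\mathfrak m$ is the centralizer of a semisimple element of $S$. (2) Every Levi subalgebra $\mathfrak m\supseteq\mathfrak h$ of $\mathfrak g$ has exactly one dual $\mathfrak m^\vee\supseteq\mathfrak h^\vee$, and every Levi subalgebra of $\mathfrak g^\vee$ that contains $\mathfrak h^\vee$ is dual to exactly one $\mathfrak m$. (3) For every base $\Sigma$ of simple roots of $(\mathfrak g,\mathfrak h)$, the set $e(\Sigma)$ is a base for $(\mathfrak g^\vee,\mathfrak h^\vee)$. For every $J\subseteq\Sigma$, $\mathfrak m_J$ and $\mathfrak m_{e(J)}$ are Levi subalgebras of $\mathfrak g$ and $\mathfrak g^\vee$, and they are dual to each other. Every Levi subalgebra of $\mathfrak g$ is conjugate to $\mathfrak m_J$ for some $J\subseteq\Sigma$. (4) There is exactly one bijection $D$ from the strata for $\mathfrak g$ to the strata for $\mathfrak g^\vee$ such that $D(\mathcal V_{\mathfrak m})=\mathcal V_{\mathfrak m^\vee}$ whenever $\mathfrak m^\vee$ is dual to $\mathfrak m$. It is compatible with symmetry breaking: $X_1\preceq X_2$ if and only if $D(X_1)\preceq D(X_2)$.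 -/

import Mathlib

namespace StrataDuality

open LieAlgebra

noncomputable section

section Zariski

variable (V : Type*) [AddCommGroup V] [Module ℂ V]

/-- The algebra of polynomial functions on a complex vector space. -/
def polynomialFunctions : Subalgebra ℂ (V → ℂ) :=
  Algebra.adjoin ℂ (Set.range fun φ : Module.Dual ℂ V => (φ : V → ℂ))

/-- The Zariski topology: its basic open sets are the non-vanishing loci of polynomial functions. -/
abbrev zariskiTopology : TopologicalSpace V :=
  TopologicalSpace.generateFrom
    {U | ∃ f ∈ polynomialFunctions V, U = {x | f x ≠ 0}}

end Zariski

variable (g : Type*) [LieRing g] [LieAlgebra ℂ g]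

/-- The group of inner automorphisms of `g`, generated by the `exp (ad x)` with `ad x` nilpotent
(for semisimple `g`, this is the adjoint group of `g`). -/
def innerGroup : Subgroup (g ≃ₗ[ℂ] g) :=
  Subgroup.closure {a | ∃ (x : g) (n : ℕ), (ad ℂ g x) ^ n = 0 ∧
    ∀ y, a y = ∑ k ∈ Finset.range n, ((k.factorial : ℂ)⁻¹) • ((ad ℂ g x) ^ k) y}

variable {g}

/-- An element is semisimple if its adjoint action is. -/
def IsSemisimpleElt (x : g) : Prop := (ad ℂ g x).IsSemisimple

/-- The adjoint orbit of an element. -/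
def adjointOrbit (x : g) : Set g := {y | ∃ a ∈ innerGroup g, a x = y}

/-- The centralizer of an element. -/
def centralizer (x : g) : LieSubalgebra ℂ g where
  __ := LinearMap.ker (ad ℂ g x)
  lie_mem' := by
    intro y z hy hz
    have hy' : ⁅x, y⁆ = 0 := hy
    have hz' : ⁅x, z⁆ = 0 := hz
    change ⁅x, ⁅y, z⁆⁆ = 0
    rw [leibniz_lie, hy', hz', zero_lie, lie_zero, add_zero]

/-- A Levi subalgebra is the centralizer of a semisimple element. -/
def IsLevi (m : LieSubalgebra ℂ g) : Prop := ∃ x : g, IsSemisimpleElt x ∧ m = centralizer x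

/-- Conjugacy of subalgebras under inner automorphisms. -/
def IsInnerConj (m₁ m₂ : LieSubalgebra ℂ g) : Prop :=
  ∃ a ∈ innerGroup g, m₁.toSubmodule.map (a : g →ₗ[ℂ] g) = m₂.toSubmodule

variable (g) in
/-- The elements whose adjoint orbit has (complex) dimension `d`; the tangent space at `x` of its
orbit is `[g, x]`. -/
def orbitDimLocus (d : ℕ) : Set g := {x | Module.finrank ℂ (LinearMap.range (ad ℂ g x)) = d}

/-- A sheet is an irreducible component of one of the loci of elements with adjoint orbits of a
fixed dimension. -/
def IsSheet (S : Set g) : Prop :=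
  ∃ d : ℕ, Maximal
    (fun T : Set g => @IsIrreducible g (zariskiTopology g) T ∧ T ⊆ orbitDimLocus g d) S

/-- A Dixmier sheet is a sheet that contains a semisimple element. -/
def IsDixmierSheet (S : Set g) : Prop := IsSheet S ∧ ∃ x ∈ S, IsSemisimpleElt x

variable (g) in
/-- The Levi subalgebras of `g`. -/
def Levi : Type _ := {m : LieSubalgebra ℂ g // IsLevi m}

variable (g) in
/-- The semisimple adjoint orbits of `g`. -/
def SemisimpleOrbit : Type _ := {O : Set g // ∃ x : g, IsSemisimpleElt x ∧ O = adjointOrbit x}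

variable (g) in
/-- The aligned vacua: triples of semisimple adjoint orbits (the vacuum expectation values of the
three complex adjoint scalars, up to gauge equivalence) that all lie in one and the same sheet. -/
def AlignedVacuum : Type _ :=
  {v : Fin 3 → SemisimpleOrbit g // ∃ S : Set g, IsSheet S ∧ ∀ i, (v i).1 ⊆ S}

/-- The aligned vacua with unbroken gauge algebra `m`: up to gauge equivalence, the centralizer of
each of the three vacuum expectation values is `m`. -/
def vacuaWithUnbroken (m : LieSubalgebra ℂ g) : Set (AlignedVacuum g) :=
  {v | ∀ i, ∃ x ∈ (v.1 i).1, centralizer x = m}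

/-- The aligned vacua with values in a given sheet. -/
def vacuaInSheet (S : Set g) : Set (AlignedVacuum g) := {v | ∀ i, (v.1 i).1 ⊆ S}

variable (g) in
/-- The strata of the space of aligned vacua, by unbroken gauge algebra. -/
def strata : Set (Set (AlignedVacuum g)) := {X | ∃ m, IsLevi m ∧ X = vacuaWithUnbroken m}

/-- The stratum with unbroken gauge algebra the Levi subalgebra `m`. -/
def stratum (m : Levi g) : strata g := ⟨vacuaWithUnbroken m.1, m.1, m.2, rfl⟩

/-- `X₁` can be reached by symmetry breaking from `X₂`: an unbroken gauge algebra on `X₂` contains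
an unbroken gauge algebra on `X₁`. -/
def HiggsLE (X₁ X₂ : strata g) : Prop :=
  ∃ m₁ m₂ : Levi g, m₁.1 ≤ m₂.1 ∧ stratum m₁ = X₁ ∧ stratum m₂ = X₂

section Roots

variable [FiniteDimensional ℂ g] (H : LieSubalgebra ℂ g) [H.IsCartanSubalgebra]

/-- The roots, relative to `H`, of a subalgebra `m` (containing `H`). -/
def leviRoots (m : LieSubalgebra ℂ g) : Set H.root :=
  {α | (rootSpace H (α.1 : H → ℂ)).toSubmodule ≤ m.toSubmodule}

/-- The subalgebra generated by `H` and the root spaces of `α` and `-α`, for `α ∈ J`. -/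
def standardLevi (J : Set H.root) : LieSubalgebra ℂ g :=
  LieSubalgebra.lieSpan ℂ g
    ((H : Set g) ∪ ⋃ α ∈ J,
      ((rootSpace H (α.1 : H → ℂ) : Set g) ∪ (rootSpace H (-(α.1 : H → ℂ)) : Set g)))

end Roots

section Dual

variable [FiniteDimensional ℂ g] [IsSimple ℂ g] (H : LieSubalgebra ℂ g) [H.IsCartanSubalgebra]
variable {g' : Type*} [LieRing g'] [LieAlgebra ℂ g'] [FiniteDimensional ℂ g'] [IsSimple ℂ g']
  (H' : LieSubalgebra ℂ g') [H'.IsCartanSubalgebra]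

/-- A Langlands duality between `(g, H)` and `(g', H')`: an isomorphism of the dual of the root
system of the first (with roots and coroots interchanged) with the root system of the second. -/
abbrev LanglandsDuality : Type _ :=
  RootPairing.Equiv (IsKilling.rootSystem H).flip (IsKilling.rootSystem H')

variable {H H'}

/-- The Levi subalgebras `m ⊇ H` and `m' ⊇ H'` are dual to each other: the roots of `m'` are those
that correspond to the coroots of the roots of `m`. -/
def IsDualLevi (e : LanglandsDuality H H') (m : Levi g) (m' : Levi g') : Prop :=
  H ≤ m.1 ∧ H' ≤ m'.1 ∧ leviRoots H' m'.1 = e.indexEquiv '' leviRoots H m.1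

end Dual

end

end StrataDuality

/-! ### Openness of polynomial maps at points with invertible Jacobian -/

namespace StrataDuality

open LieAlgebra

/-! Three facts carry the theorem.

Slices. Near a semisimple element `x`, every element is conjugate to one that commutes with `x`
(`exists_slice`): moving `x + n`, with `n` in the centralizer, by exponentials of the remaining
eigenvectors of `ad x` is a polynomial map with invertible differential, and such a map is
Zariski-open there. Hence the elements near `x` whose orbits have the same dimension have
centralizers conjugate to that of `x` (`IsSemisimpleElt.exists_open_centralizerClass`). The elements
whose centralizer is conjugate to a Levi subalgebra `m` form an irreducible set, and its closure in
the dimension locus (`sheetOf m`) is the only sheet that contains any of them. So Dixmier sheets,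
Levi classes and strata correspond. As nonempty open sets meet, slices also conjugate every
semisimple element into `H`.

Linear conditions. The Levi subalgebras containing `H` are the centralizers of elements `y` of `H`,
and they are determined by the roots vanishing at `y`. A coroot is a nonzero multiple of its root
under the Killing form, so `α` vanishes at `y` exactly when its coroot is orthogonal to `y`. The
isomorphism `e` carries this linear condition to `H'` and back (`exists_dual_element`,
`exists_predual_element`). Duals therefore exist, are unique, and respect inclusion.

Weyl conjugacy. Two Levi subalgebras containing `H` are conjugate exactly when the Weyl group
conjugates their sets of roots (`isInnerConj_iff_exists_weylPerm`), and `e` intertwines the two Weyl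
groups; so the duality descends to strata. The hard point is that an inner automorphism preserving
`H` acts on it through the Weyl group. After a Weyl correction the image of the height element is
dominant; joining the automorphism to the identity by a polynomial curve and eliminating the
positive part confines the root values to a finite list, so they cannot change along the curve
(`apply_eq_self_of_dominant`).

For simple roots, the centralizer of a dominant element is shown to be a standard Levi subalgebra by
induction on height (`standardLevi_eq_centralizer`). Dominance of complex values refers to the
lexicographic order on `ℂ`, an additive linear order. -/

theorem smooth_localization_jacobian {R B ι : Type*} [CommRing R] [CommRing B] [Algebra R B]
    [Finite ι] (P : Algebra.PreSubmersivePresentation R B ι ι) (g : B) :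
    Algebra.Smooth R (Localization.Away (P.jacobian * g)) := by
  have hf : IsUnit (algebraMap B (Localization.Away (P.jacobian * g)) (P.jacobian * g)) :=
    IsLocalization.Away.algebraMap_isUnit _
  have hJ : IsUnit (algebraMap B (Localization.Away (P.jacobian * g)) P.jacobian) := by
    rw [map_mul, IsUnit.mul_iff] at hf
    exact hf.1
  -- Adding a variable inverse to the chosen element multiplies the Jacobian by that element, so the
  -- new Jacobian is a unit.
  let Q : Algebra.SubmersivePresentation R (Localization.Away (P.jacobian * g)) _ _ :=
    { toPreSubmersivePresentation :=
        .comp (.localizationAway (Localization.Away (P.jacobian * g)) (P.jacobian * g)) P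
      jacobian_isUnit := by
        rw [Algebra.PreSubmersivePresentation.comp_jacobian_eq_jacobian_smul_jacobian,
          Algebra.PreSubmersivePresentation.localizationAway_jacobian, Algebra.smul_def]
        exact hJ.mul hf }
  have : Algebra.IsStandardSmooth R (Localization.Away (P.jacobian * g)) := Q.isStandardSmooth
  infer_instance

open MvPolynomial in
/-- The coordinate ring of the graph of a polynomial map, as an algebra over the target. -/
def GraphRing {σ : Type*} (F : σ → MvPolynomial σ ℂ) : Type _ :=
  MvPolynomial σ (MvPolynomial σ ℂ) ⧸
    Ideal.span (Set.range fun i => (map C (F i) - C (X i) : MvPolynomial σ (MvPolynomial σ ℂ)))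

noncomputable instance {σ : Type*} (F : σ → MvPolynomial σ ℂ) : CommRing (GraphRing F) :=
  inferInstanceAs (CommRing (_ ⧸ _))

noncomputable instance {σ : Type*} (F : σ → MvPolynomial σ ℂ) :
    Algebra (MvPolynomial σ ℂ) (GraphRing F) :=
  inferInstanceAs (Algebra (MvPolynomial σ ℂ) (_ ⧸ _))

open MvPolynomial in
/-- A polynomial self-map of affine space is open at each point with invertible Jacobian. -/
theorem exists_open_subset_image_of_jacobian {σ : Type*} [Fintype σ] [DecidableEq σ]
    (F : σ → MvPolynomial σ ℂ) (p : MvPolynomial σ ℂ) (a : σ → ℂ)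
    (hJ : (Matrix.of fun i j => eval a (pderiv i (F j))).det ≠ 0) (hp : eval a p ≠ 0) :
    ∃ q : MvPolynomial σ ℂ, eval (fun i => eval a (F i)) q ≠ 0 ∧
      ∀ y, eval y q ≠ 0 → ∃ x, eval x p ≠ 0 ∧ ∀ i, eval x (F i) = y i := by
  classical
  let v : σ → MvPolynomial σ (MvPolynomial σ ℂ) := fun i => map C (F i) - C (X i)
  let P : Algebra.PreSubmersivePresentation (MvPolynomial σ ℂ) (GraphRing F) σ σ :=
    .naive id Function.injective_id
  let mk : MvPolynomial σ (MvPolynomial σ ℂ) →ₐ[MvPolynomial σ ℂ] GraphRing F :=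
    Ideal.Quotient.mkₐ _ _
  let f : GraphRing F := P.jacobian * mk (map C p)
  have hf : IsUnit (algebraMap (GraphRing F) (Localization.Away f) f) :=
    IsLocalization.Away.algebraMap_isUnit f
  have hfp : IsUnit (algebraMap (GraphRing F) (Localization.Away f) (mk (map C p))) := by
    have h := hf
    simp only [f] at h
    rw [map_mul, IsUnit.mul_iff] at h
    exact h.2
  have : Algebra.Smooth (MvPolynomial σ ℂ) (Localization.Away f) :=
    smooth_localization_jacobian P _
  -- Smooth algebras are flat and finitely presented, so going down makes the map of spectra open.
  have hopen : IsOpenMap (PrimeSpectrum.comap (algebraMap (MvPolynomial σ ℂ) (Localization.Away f))) :=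
    PrimeSpectrum.isOpenMap_comap_of_hasGoingDown_of_finitePresentation
  -- points of the spectrum
  let pt (y : σ → ℂ) : PrimeSpectrum (MvPolynomial σ ℂ) := ⟨RingHom.ker (eval y), RingHom.ker_isPrime _⟩
  have hjac : ∀ (ψ : GraphRing F →+* ℂ) (x : σ → ℂ), (∀ r : MvPolynomial σ ℂ, ψ (mk (map C r)) = eval x r) →
      ψ P.jacobian = (Matrix.of fun i j => eval x (pderiv i (F j))).det := by
    intro ψ x hψ
    rw [Algebra.PreSubmersivePresentation.jacobian_eq_jacobiMatrix_det, RingHom.map_det,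
      RingHom.map_det]
    congr 1
    ext i j
    have h1 : P.jacobiMatrix i j = map C (pderiv i (F j)) := by
      rw [Algebra.PreSubmersivePresentation.jacobiMatrix_apply]
      change pderiv i (map C (F j) - C (X j)) = _
      rw [map_sub, pderiv_C, sub_zero, pderiv_map]
    simp only [RingHom.mapMatrix_apply, Matrix.map_apply, Matrix.of_apply, h1]
    exact hψ _
  -- Evaluation at the point of the graph over `a` extends to the localization, because the Jacobian
  -- and `p` do not vanish there.
  have hmem : pt (fun i => eval a (F i)) ∈ Set.range (PrimeSpectrum.comap (algebraMap (MvPolynomial σ ℂ) (Localization.Away f))) := by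
    let φ0 : MvPolynomial σ (MvPolynomial σ ℂ) →+* ℂ := eval₂Hom (eval fun i => eval a (F i)) a
    have hφ0 : ∀ r : MvPolynomial σ ℂ, φ0 (map C r) = eval a r := by
      intro r
      simp only [φ0, coe_eval₂Hom, eval₂_map]
      have : (eval fun i => eval a (F i)).comp C = RingHom.id ℂ := by ext; simp
      rw [this]; rfl
    let φ : GraphRing F →+* ℂ := Ideal.Quotient.lift _ φ0 (by
      intro z hz
      have : Ideal.span (Set.range v) ≤ RingHom.ker φ0 := by
        rw [Ideal.span_le]
        rintro _ ⟨i, rfl⟩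
        simp only [SetLike.mem_coe, RingHom.mem_ker, v, map_sub, hφ0]
        simp [φ0]
      exact this hz)
    have hφ : ∀ r : MvPolynomial σ (MvPolynomial σ ℂ), φ (mk r) = φ0 r := fun r => rfl
    have hφf : IsUnit (φ f) := by
      simp only [f, map_mul]
      rw [hjac φ a (fun r => by rw [hφ, hφ0]), hφ, hφ0]
      exact (mul_ne_zero hJ hp).isUnit
    let ψ : (Localization.Away f) →+* ℂ := IsLocalization.Away.lift f hφf
    refine ⟨⟨RingHom.ker ψ, RingHom.ker_isPrime _⟩, ?_⟩
    apply PrimeSpectrum.ext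
    ext r
    simp only [PrimeSpectrum.comap_asIdeal, Ideal.mem_comap, RingHom.mem_ker, pt]
    have : ψ (algebraMap (MvPolynomial σ ℂ) (Localization.Away f) r) = eval (fun i => eval a (F i)) r := by
      rw [IsScalarTower.algebraMap_apply (MvPolynomial σ ℂ) (GraphRing F) (Localization.Away f)]
      simp only [ψ, IsLocalization.Away.lift_eq]
      change φ0 (C r) = _
      simp [φ0]
    rw [this]
  have hO := hopen.isOpen_range
  obtain ⟨_, ⟨q, rfl⟩, hq, hqs⟩ :=
    PrimeSpectrum.isTopologicalBasis_basic_opens.exists_subset_of_mem_open hmem hO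
  refine ⟨q, fun h => hq h, fun y hy => ?_⟩
  obtain ⟨T, hT⟩ := hqs (show pt y ∈ PrimeSpectrum.basicOpen q from hy)
  -- By the Nullstellensatz the nonempty fibre over `y` has a complex point: a maximal ideal above
  -- `T` has a residue field finite over `ℂ`.
  obtain ⟨N, hN, hTN⟩ := Ideal.exists_le_maximal T.asIdeal T.2.ne_top
  have hTy : T.asIdeal.comap (algebraMap (MvPolynomial σ ℂ) (Localization.Away f)) = RingHom.ker (eval y) :=
    congrArg PrimeSpectrum.asIdeal hT
  let _ := Ideal.Quotient.field N
  let _ : Algebra ℂ (Localization.Away f) := ((algebraMap (MvPolynomial σ ℂ) (Localization.Away f)).comp C).toAlgebra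
  have : IsScalarTower ℂ (MvPolynomial σ ℂ) (Localization.Away f) := IsScalarTower.of_algebraMap_eq fun _ => rfl
  have : Algebra.FiniteType ℂ (Localization.Away f) := Algebra.FiniteType.trans (S := (MvPolynomial σ ℂ)) inferInstance inferInstance
  have : Module.Finite ℂ ((Localization.Away f) ⧸ N) := finite_of_finite_type_of_isJacobsonRing ℂ ((Localization.Away f) ⧸ N)
  let θ : ((Localization.Away f) ⧸ N) →ₐ[ℂ] ℂ := IsAlgClosed.lift
  let χ : (Localization.Away f) →ₐ[ℂ] ℂ := θ.comp (Ideal.Quotient.mkₐ ℂ N)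
  have hχR : ∀ r : (MvPolynomial σ ℂ), χ (algebraMap (MvPolynomial σ ℂ) (Localization.Away f) r) = eval y r := by
    intro r
    have h1 : r - C (eval y r) ∈ RingHom.ker (eval y) := by simp [RingHom.mem_ker]
    rw [← hTy] at h1
    have h2 : χ (algebraMap (MvPolynomial σ ℂ) (Localization.Away f) (r - C (eval y r))) = 0 := by
      have : Ideal.Quotient.mkₐ ℂ N (algebraMap (MvPolynomial σ ℂ) (Localization.Away f) (r - C (eval y r))) = 0 :=
        Ideal.Quotient.eq_zero_iff_mem.mpr (hTN h1)
      simp only [χ, AlgHom.comp_apply, this, map_zero]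
    rw [map_sub, map_sub, sub_eq_zero] at h2
    rw [h2]
    exact χ.commutes (eval y r)
  let ξ : MvPolynomial σ (MvPolynomial σ ℂ) →+* ℂ := (χ : (Localization.Away f) →+* ℂ).comp ((algebraMap (GraphRing F) (Localization.Away f)).comp (mk : _ →+* GraphRing F))
  let x : σ → ℂ := fun i => ξ (X i)
  have hξC : ∀ r : (MvPolynomial σ ℂ), ξ (C r) = eval y r := by
    intro r
    rw [← hχR]
    change χ (algebraMap (GraphRing F) (Localization.Away f) (mk (C r))) = _
    rw [IsScalarTower.algebraMap_apply (MvPolynomial σ ℂ) (GraphRing F) (Localization.Away f)]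
    rfl
  have hξ : ∀ r : MvPolynomial σ ℂ, ξ (map C r) = eval x r := by
    intro r
    have : ξ.comp (map C) = eval x := by
      apply MvPolynomial.ringHom_ext
      · intro c; simp [hξC]
      · intro i; simp [x]
    exact congrArg (fun g => g r) this
  refine ⟨x, ?_, fun i => ?_⟩
  · rw [← hξ]
    exact (hfp.map χ).ne_zero
  · rw [← hξ]
    have : mk (v i) = 0 := Ideal.Quotient.eq_zero_iff_mem.mpr (Ideal.subset_span ⟨i, rfl⟩)
    have h3 : ξ (v i) = 0 := by
      change χ (algebraMap (GraphRing F) (Localization.Away f) (mk (v i))) = 0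
      rw [this, map_zero, map_zero]
    simp only [v, map_sub, sub_eq_zero] at h3
    rw [h3, hξC, eval_X]

end StrataDuality

/-! ### Polynomial maps and irreducibility in the Zariski topology -/

namespace StrataDuality

open LieAlgebra

section PolynomialMaps

variable {U V W : Type*} [AddCommGroup U] [Module ℂ U] [AddCommGroup V] [Module ℂ V]
  [AddCommGroup W] [Module ℂ W]

theorem dual_mem_polynomialFunctions (φ : Module.Dual ℂ V) :
    (fun v => φ v) ∈ polynomialFunctions V :=
  Algebra.subset_adjoin ⟨φ, rfl⟩

theorem const_mem_polynomialFunctions (c : ℂ) : (fun _ => c) ∈ polynomialFunctions V :=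
  (polynomialFunctions V).algebraMap_mem c

/-- A map of complex vector spaces is polynomial if its coordinates are. -/
def IsPolyMap (Φ : W → V) : Prop :=
  ∀ φ : Module.Dual ℂ V, (fun w => φ (Φ w)) ∈ polynomialFunctions W

theorem IsPolyMap.comp_mem {Φ : W → V} (hΦ : IsPolyMap Φ) {f : V → ℂ}
    (hf : f ∈ polynomialFunctions V) : (fun w => f (Φ w)) ∈ polynomialFunctions W := by
  induction hf using Algebra.adjoin_induction with
  | mem f hf =>
    obtain ⟨φ, rfl⟩ := hf
    exact hΦ φ
  | algebraMap r => exact const_mem_polynomialFunctions r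
  | add f g _ _ hf hg => exact add_mem hf hg
  | mul f g _ _ hf hg => exact mul_mem hf hg

theorem IsPolyMap.comp {Φ : W → V} {Ψ : U → W} (hΦ : IsPolyMap Φ) (hΨ : IsPolyMap Ψ) :
    IsPolyMap fun u => Φ (Ψ u) :=
  fun φ => hΨ.comp_mem (hΦ φ)

theorem isPolyMap_linear (L : W →ₗ[ℂ] V) : IsPolyMap fun w => L w :=
  fun φ => dual_mem_polynomialFunctions (φ ∘ₗ L)

theorem isPolyMap_const (v : V) : IsPolyMap fun _ : W => v :=
  fun φ => const_mem_polynomialFunctions (φ v)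

theorem IsPolyMap.linear_comp {Φ : W → V} (hΦ : IsPolyMap Φ) (L : V →ₗ[ℂ] U) :
    IsPolyMap fun w => L (Φ w) :=
  (isPolyMap_linear L).comp hΦ

theorem IsPolyMap.add {Φ Ψ : W → V} (hΦ : IsPolyMap Φ) (hΨ : IsPolyMap Ψ) :
    IsPolyMap fun w => Φ w + Ψ w := by
  intro φ
  simp only [map_add]
  exact add_mem (hΦ φ) (hΨ φ)

theorem IsPolyMap.smul {f : W → ℂ} (hf : f ∈ polynomialFunctions W) {Φ : W → V}
    (hΦ : IsPolyMap Φ) : IsPolyMap fun w => f w • Φ w := by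
  intro φ
  simp only [map_smul, smul_eq_mul]
  exact mul_mem hf (hΦ φ)

theorem IsPolyMap.sub {Φ Ψ : W → V} (hΦ : IsPolyMap Φ) (hΨ : IsPolyMap Ψ) :
    IsPolyMap fun w => Φ w - Ψ w := by
  intro φ
  simp only [map_sub]
  exact sub_mem (hΦ φ) (hΨ φ)

theorem IsPolyMap.sum {ι : Type*} (s : Finset ι) {Φ : ι → W → V} (hΦ : ∀ i ∈ s, IsPolyMap (Φ i)) :
    IsPolyMap fun w => ∑ i ∈ s, Φ i w := by
  intro φ
  have : (fun w => φ (∑ i ∈ s, Φ i w)) = ∑ i ∈ s, fun w => φ (Φ i w) := by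
    ext w; simp
  rw [this]
  exact sum_mem fun i hi => hΦ i hi φ

theorem id_mem_polynomialFunctions : (fun t : ℂ => t) ∈ polynomialFunctions ℂ :=
  dual_mem_polynomialFunctions (LinearMap.id : ℂ →ₗ[ℂ] ℂ)

theorem pow_mem_polynomialFunctions {f : W → ℂ} (hf : f ∈ polynomialFunctions W) (n : ℕ) :
    (fun w => f w ^ n) ∈ polynomialFunctions W :=
  pow_mem hf n

/-- Evaluation of polynomial functions at a point. -/
noncomputable def evalPolynomialFunctions (w : W) : polynomialFunctions W →+* ℂ :=
  (Pi.evalRingHom (fun _ : W => ℂ) w).comp (polynomialFunctions W).subtype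

/-- The matrices of all `T w` are evaluations of a single matrix over the ring of polynomial
functions, and characteristic polynomials commute with ring homomorphisms. -/
theorem IsPolyMap.charpoly_coeff_mem [FiniteDimensional ℂ V] {T : W → Module.End ℂ V}
    (hT : IsPolyMap T) (k : ℕ) : (fun w => (T w).charpoly.coeff k) ∈ polynomialFunctions W := by
  let b := Module.finBasis ℂ V
  let N : Matrix _ _ (polynomialFunctions W) := Matrix.of fun i j =>
    ⟨fun w => LinearMap.toMatrix b b (T w) i j,
      hT ((LinearMap.proj j ∘ₗ LinearMap.proj i) ∘ₗ (LinearMap.toMatrix b b).toLinearMap)⟩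
  have h : (fun w => (T w).charpoly.coeff k) = (N.charpoly.coeff k : polynomialFunctions W).1 := by
    ext w
    rw [← LinearMap.charpoly_toMatrix (T w) b]
    have : LinearMap.toMatrix b b (T w) = N.map (evalPolynomialFunctions w) := rfl
    rw [this, Matrix.charpoly_map, Polynomial.coeff_map]
    rfl
  rw [h]
  exact Subtype.property _

theorem exists_polynomial_of_mem {f : ℂ → ℂ} (hf : f ∈ polynomialFunctions ℂ) :
    ∃ p : Polynomial ℂ, ∀ t, f t = p.eval t := by
  induction hf using Algebra.adjoin_induction with
  | mem f hf =>
    obtain ⟨φ, rfl⟩ := hf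
    refine ⟨Polynomial.C (φ 1) * Polynomial.X, fun t => ?_⟩
    have : φ (t • 1) = t • φ 1 := map_smul _ _ _
    simp only [smul_eq_mul, mul_one] at this
    exact this.trans (by rw [Polynomial.eval_mul, Polynomial.eval_C, Polynomial.eval_X, mul_comm])
  | algebraMap r => exact ⟨Polynomial.C r, fun t => by simp⟩
  | add f g _ _ hf hg =>
    obtain ⟨p, hp⟩ := hf
    obtain ⟨q, hq⟩ := hg
    exact ⟨p + q, fun t => by simp [hp, hq]⟩
  | mul f g _ _ hf hg =>
    obtain ⟨p, hp⟩ := hf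
    obtain ⟨q, hq⟩ := hg
    exact ⟨p * q, fun t => by simp [hp, hq]⟩

open MvPolynomial in
theorem exists_mvPolynomial_of_mem {σ : Type*} [Fintype σ] {f : (σ → ℂ) → ℂ}
    (hf : f ∈ polynomialFunctions (σ → ℂ)) : ∃ p : MvPolynomial σ ℂ, ∀ x, f x = eval x p := by
  classical
  induction hf using Algebra.adjoin_induction with
  | mem f hf =>
    obtain ⟨φ, rfl⟩ := hf
    refine ⟨∑ i, C (φ (Pi.single i 1)) * X i, fun x => ?_⟩
    conv_lhs => rw [← LinearMap.sum_single_apply _ x]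
    simp only [map_sum, map_mul, eval_C, eval_X]
    refine Finset.sum_congr rfl fun i _ => ?_
    have : (Pi.single i (x i) : σ → ℂ) = x i • Pi.single i 1 := by
      rw [← Pi.single_smul, smul_eq_mul, mul_one]
    rw [this, map_smul, smul_eq_mul, mul_comm]
  | algebraMap r => exact ⟨C r, fun t => by simp⟩
  | add f g _ _ hf hg =>
    obtain ⟨p, hp⟩ := hf
    obtain ⟨q, hq⟩ := hg
    exact ⟨p + q, fun t => by simp [hp, hq]⟩
  | mul f g _ _ hf hg =>
    obtain ⟨p, hp⟩ := hf
    obtain ⟨q, hq⟩ := hg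
    exact ⟨p * q, fun t => by simp [hp, hq]⟩

open MvPolynomial in
theorem eval_mem_polynomialFunctions {σ : Type*} (p : MvPolynomial σ ℂ) :
    (fun x : σ → ℂ => eval x p) ∈ polynomialFunctions (σ → ℂ) := by
  induction p using MvPolynomial.induction_on with
  | C a => simpa using const_mem_polynomialFunctions a
  | add p q hp hq => 
    simp only [map_add]
    exact add_mem hp hq
  | mul_X p i hp =>
    simp only [map_mul, eval_X]
    exact mul_mem hp
      (dual_mem_polynomialFunctions (LinearMap.proj i : (σ → ℂ) →ₗ[ℂ] ℂ))

theorem exists_ne_zero_mul {f g : ℂ → ℂ} (hf : f ∈ polynomialFunctions ℂ)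
    (hg : g ∈ polynomialFunctions ℂ) (hf0 : ∃ t, f t ≠ 0) (hg0 : ∃ t, g t ≠ 0) :
    ∃ t, f t ≠ 0 ∧ g t ≠ 0 := by
  obtain ⟨p, hp⟩ := exists_polynomial_of_mem hf
  obtain ⟨q, hq⟩ := exists_polynomial_of_mem hg
  have hpq : p * q ≠ 0 := by
    refine mul_ne_zero ?_ ?_
    · rintro rfl
      obtain ⟨t, ht⟩ := hf0
      simp [hp] at ht
    · rintro rfl
      obtain ⟨t, ht⟩ := hg0
      simp [hq] at ht
  by_contra! h
  refine hpq (Polynomial.funext fun t => ?_)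
  by_cases h0 : f t = 0
  · simp [← hp, h0]
  · simp [← hq, h t h0]

/-- On the line through `x` and `y` this is the fact that one-variable polynomials form a domain. It
is used to make two nonempty open sets meet. -/
theorem exists_ne_zero_and_ne_zero {f g : V → ℂ} (hf : f ∈ polynomialFunctions V)
    (hg : g ∈ polynomialFunctions V) {x y : V} (hx : f x ≠ 0) (hy : g y ≠ 0) :
    ∃ z, f z ≠ 0 ∧ g z ≠ 0 := by
  have hc : IsPolyMap fun t : ℂ => x + t • (y - x) :=
    (isPolyMap_const x).add (IsPolyMap.smul id_mem_polynomialFunctions (isPolyMap_const _))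
  obtain ⟨t, h1, h2⟩ := exists_ne_zero_mul (hc.comp_mem hf) (hc.comp_mem hg)
    ⟨0, by simpa using hx⟩ ⟨1, by simpa using hy⟩
  exact ⟨_, h1, h2⟩

section Zariski

theorem isOpen_ne_zero {f : V → ℂ} (hf : f ∈ polynomialFunctions V) :
    @IsOpen V (zariskiTopology V) {x | f x ≠ 0} :=
  TopologicalSpace.isOpen_generateFrom_of_mem ⟨f, hf, rfl⟩

theorem exists_ne_zero_subset_of_isOpen {O : Set V} (hO : @IsOpen V (zariskiTopology V) O) {x : V}
    (hx : x ∈ O) : ∃ f ∈ polynomialFunctions V, f x ≠ 0 ∧ ∀ y, f y ≠ 0 → y ∈ O := by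
  induction hO with
  | basic s hs =>
    obtain ⟨f, hf, rfl⟩ := hs
    exact ⟨f, hf, hx, fun y hy => hy⟩
  | univ => exact ⟨fun _ => 1, const_mem_polynomialFunctions 1, one_ne_zero, fun _ _ => trivial⟩
  | inter s t _ _ hs ht =>
    obtain ⟨f, hf, hfx, hfs⟩ := hs hx.1
    obtain ⟨g, hg, hgx, hgt⟩ := ht hx.2
    exact ⟨f * g, mul_mem hf hg, mul_ne_zero hfx hgx, fun y hy =>
      ⟨hfs y (left_ne_zero_of_mul hy), hgt y (right_ne_zero_of_mul hy)⟩⟩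
  | sUnion S _ ih =>
    obtain ⟨s, hs, hxs⟩ := hx
    obtain ⟨f, hf, hfx, hfs⟩ := ih s hs hxs
    exact ⟨f, hf, hfx, fun y hy => ⟨s, hs, hfs y hy⟩⟩

theorem isIrreducible_zariski_iff {S : Set V} :
    @IsIrreducible V (zariskiTopology V) S ↔ S.Nonempty ∧
      ∀ f ∈ polynomialFunctions V, ∀ g ∈ polynomialFunctions V, (∃ x ∈ S, f x ≠ 0) →
        (∃ x ∈ S, g x ≠ 0) → ∃ x ∈ S, f x ≠ 0 ∧ g x ≠ 0 := by
  constructor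
  · rintro ⟨hne, h⟩
    refine ⟨hne, fun f hf g hg hx hy => ?_⟩
    obtain ⟨z, hz, h1, h2⟩ := h _ _ (isOpen_ne_zero hf) (isOpen_ne_zero hg) hx hy
    exact ⟨z, hz, h1, h2⟩
  · rintro ⟨hne, h⟩
    refine ⟨hne, ?_⟩
    rintro O₁ O₂ h₁ h₂ ⟨x, hx, hxO⟩ ⟨y, hy, hyO⟩
    obtain ⟨f, hf, hfx, hfO⟩ := exists_ne_zero_subset_of_isOpen h₁ hxO
    obtain ⟨g, hg, hgy, hgO⟩ := exists_ne_zero_subset_of_isOpen h₂ hyO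
    obtain ⟨z, hz, h1, h2⟩ := h f hf g hg ⟨x, hx, hfx⟩ ⟨y, hy, hgy⟩
    exact ⟨z, hz, hfO z h1, hgO z h2⟩

/-- A set is irreducible if any two of its points lie on a polynomial curve whose generic points
are in the set. -/
theorem isIrreducible_of_curves {S : Set V} (hne : S.Nonempty)
    (h : ∀ x ∈ S, ∀ y ∈ S, ∃ c : ℂ → V, IsPolyMap c ∧ (∃ t, c t = x) ∧ (∃ t, c t = y) ∧
      ∃ f ∈ polynomialFunctions ℂ, (∃ t, f t ≠ 0) ∧ ∀ t, f t ≠ 0 → c t ∈ S) :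
    @IsIrreducible V (zariskiTopology V) S := by
  refine isIrreducible_zariski_iff.mpr ⟨hne, ?_⟩
  rintro f hf g hg ⟨x, hx, hfx⟩ ⟨y, hy, hgy⟩
  obtain ⟨c, hc, ⟨t₁, rfl⟩, ⟨t₂, rfl⟩, p, hp, hp0, hpS⟩ := h x hx y hy
  obtain ⟨t₃, h3, h3'⟩ := exists_ne_zero_mul hp (hc.comp_mem hf) hp0 ⟨t₁, hfx⟩
  obtain ⟨t, h1, h2⟩ := exists_ne_zero_mul (mul_mem hp (hc.comp_mem hf)) (hc.comp_mem hg)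
    ⟨t₃, mul_ne_zero h3 h3'⟩ ⟨t₂, hgy⟩
  exact ⟨c t, hpS t (left_ne_zero_of_mul h1), right_ne_zero_of_mul h1, h2⟩

end Zariski

open MvPolynomial in
-- The partial derivative at the origin depends only on the restriction `G` to the coordinate axis,
-- and that restriction is affine by hypothesis.
theorem eval_zero_pderiv_of_line {σ : Type*} [Fintype σ] [DecidableEq σ] (F : MvPolynomial σ ℂ) (i : σ)
    (c₀ c₁ : ℂ) (h : ∀ s, eval (Pi.single i s) F = c₀ + s * c₁) :
    eval 0 (pderiv i F) = c₁ := by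
  let G : MvPolynomial σ ℂ →ₐ[ℂ] Polynomial ℂ := aeval (Pi.single i Polynomial.X)
  have hG : ∀ (p : MvPolynomial σ ℂ) (s : ℂ), (G p).eval s = eval (Pi.single i s) p := by
    intro p s
    induction p using MvPolynomial.induction_on with
    | C a => simp [G]
    | add p q hp hq => simp [hp, hq]
    | mul_X p j hp =>
      rw [map_mul, map_mul, Polynomial.eval_mul, hp, eval_X]
      congr 1
      by_cases hj : j = i
      · subst hj; simp [G]
      · simp [G, hj]
  have hD : ∀ p : MvPolynomial σ ℂ, (Polynomial.derivative (G p)).eval 0 = eval 0 (pderiv i p) := by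
    intro p
    induction p using MvPolynomial.induction_on with
    | C a => simp [G]
    | add p q hp hq => simp [hp, hq]
    | mul_X p j hp =>
      rw [map_mul, Polynomial.derivative_mul, Derivation.leibniz]
      simp only [Polynomial.eval_add, Polynomial.eval_mul, smul_eq_mul, map_add, map_mul, hp, hG,
        eval_X, Pi.single_zero]
      by_cases hj : j = i
      · subst hj; simp [G]
      · simp [G, hj]
  have hGF : G F = Polynomial.C c₀ + Polynomial.X * Polynomial.C c₁ := by
    refine Polynomial.funext fun s => ?_
    rw [hG, h]
    simp only [Polynomial.eval_add, Polynomial.eval_mul, Polynomial.eval_C, Polynomial.eval_X]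
  rw [← hD, hGF]
  simp

/-- A polynomial map that is affine on the lines spanned by the elements of a basis, with invertible
linear part, is open at zero. -/
theorem exists_open_subset_image [FiniteDimensional ℂ W] {σ : Type*} [Fintype σ]
    (b : Module.Basis σ ℂ W) {Φ : W → V} (hΦ : IsPolyMap Φ) (L : W ≃ₗ[ℂ] V)
    (hL : ∀ i (s : ℂ), Φ (s • b i) = Φ 0 + s • L (b i))
    {p : W → ℂ} (hp : p ∈ polynomialFunctions W) (hp0 : p 0 ≠ 0) :
    ∃ q ∈ polynomialFunctions V, q (Φ 0) ≠ 0 ∧ ∀ y, q y ≠ 0 → ∃ w, p w ≠ 0 ∧ Φ w = y := by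
  classical
  let c := b.map L
  have hb : IsPolyMap fun x : σ → ℂ => b.equivFun.symm x :=
    isPolyMap_linear b.equivFun.symm.toLinearMap
  have hF : ∀ i, ∃ F : MvPolynomial σ ℂ, ∀ x : σ → ℂ,
      c.coord i (Φ (b.equivFun.symm x)) = MvPolynomial.eval x F := fun i =>
    exists_mvPolynomial_of_mem (hb.comp_mem (hΦ (c.coord i)))
  choose F hF using hF
  obtain ⟨P, hP⟩ := exists_mvPolynomial_of_mem (hb.comp_mem hp)
  have hsingle : ∀ i (s : ℂ), b.equivFun.symm (Pi.single i s) = s • b i := by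
    intro i s
    rw [Module.Basis.equivFun_symm_apply, Finset.sum_eq_single i]
    · simp
    · intro j _ hj
      simp [hj]
    · simp
  -- Partial derivatives are read off on the axes, so in the bases `b` and `L b` the Jacobian matrix
  -- at the origin is the identity.
  have hJ : (Matrix.of fun i j => MvPolynomial.eval (0 : σ → ℂ) (MvPolynomial.pderiv i (F j))) = 1 := by
    ext i j
    rw [Matrix.of_apply, eval_zero_pderiv_of_line (F j) i (c.coord j (Φ 0))
      (c.coord j (L (b i)))]
    · have : L (b i) = c i := by simp [c]
      rw [this, Module.Basis.coord_apply, Module.Basis.repr_self, Finsupp.single_apply,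
        Matrix.one_apply]
    · intro s
      rw [← hF, hsingle, hL]
      simp
  obtain ⟨q, hq, hqy⟩ := exists_open_subset_image_of_jacobian F P 0 (by rw [hJ]; simp)
    (by rw [← hP]; simpa using hp0)
  refine ⟨fun v => MvPolynomial.eval (c.equivFun v) q,
    (isPolyMap_linear c.equivFun.toLinearMap).comp_mem (eval_mem_polynomialFunctions q), ?_, ?_⟩
  · convert! hq using 3
    ext i
    rw [← hF]
    simp
  · intro y hy
    obtain ⟨x, hx, hxy⟩ := hqy _ hy
    refine ⟨b.equivFun.symm x, by rwa [hP], ?_⟩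
    apply c.equivFun.injective
    ext i
    rw [← hxy i, ← hF]
    simp

end PolynomialMaps

end StrataDuality

/-! ### Exponentials of nilpotent inner derivations and the groups they generate -/

namespace StrataDuality

open LieAlgebra

variable {g : Type*} [LieRing g] [LieAlgebra ℂ g]

section Exponential

/-- The exponential of a nilpotent derivation is a Lie algebra automorphism. The general
construction is over `ℚ`, hence the restriction of scalars. -/
theorem exists_exp_ad {x : g} {n : ℕ} (hn : (ad ℂ g x) ^ n = 0) :
    ∃ a : g ≃ₗ⁅ℂ⁆ g, ∀ y,
      a y = ∑ k ∈ Finset.range n, ((k.factorial : ℂ)⁻¹) • ((ad ℂ g x) ^ k) y := by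
  let _ : Module ℚ g := Module.compHom g (algebraMap ℚ ℂ)
  let _ : LieAlgebra ℚ g := { lie_smul := fun q x y => lie_smul (algebraMap ℚ ℂ q) x y }
  have h : (LieDerivation.ad ℂ g x).toLinearMap = ad ℂ g x :=
    LieDerivation.coe_ad_apply_eq_ad_apply x
  refine ⟨(LieDerivation.ad ℂ g x).exp (by rw [h]; exact ⟨n, hn⟩), fun y => ?_⟩
  rw [LieDerivation.exp_map_apply, h, IsNilpotent.exp_eq_sum hn, LinearMap.sum_apply]
  refine Finset.sum_congr rfl fun k _ => ?_
  change (algebraMap ℚ ℂ (k.factorial : ℚ)⁻¹) • ((ad ℂ g x) ^ k) y = _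
  simp

/-- The inner automorphism `exp (ad x)`, for `ad x` nilpotent. -/
noncomputable def expAd (x : g) {n : ℕ} (hn : (ad ℂ g x) ^ n = 0) : g ≃ₗ⁅ℂ⁆ g :=
  (exists_exp_ad hn).choose

theorem expAd_apply {x : g} {n : ℕ} (hn : (ad ℂ g x) ^ n = 0) (y : g) :
    expAd x hn y = ∑ k ∈ Finset.range n, ((k.factorial : ℂ)⁻¹) • ((ad ℂ g x) ^ k) y :=
  (exists_exp_ad hn).choose_spec y

theorem ad_smul_pow_eq_zero {x : g} {n : ℕ} (hn : (ad ℂ g x) ^ n = 0) (t : ℂ) :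
    (ad ℂ g (t • x)) ^ n = 0 := by
  rw [map_smul, smul_pow, hn, smul_zero]

theorem expAd_smul_apply {x : g} {n : ℕ} (hn : (ad ℂ g x) ^ n = 0) (t : ℂ) (y : g) :
    expAd (t • x) (ad_smul_pow_eq_zero hn t) y =
      ∑ k ∈ Finset.range n, t ^ k • ((k.factorial : ℂ)⁻¹) • ((ad ℂ g x) ^ k) y := by
  rw [expAd_apply]
  refine Finset.sum_congr rfl fun k _ => ?_
  rw [map_smul, smul_pow, LinearMap.smul_apply, smul_comm]

theorem expAd_zero_smul {x : g} {n : ℕ} (hn : (ad ℂ g x) ^ n = 0) (y : g) :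
    expAd ((0 : ℂ) • x) (ad_smul_pow_eq_zero hn 0) y = y := by
  -- For `n = 0` the sum is empty, but then the hypothesis says that the identity of `g` is zero, so
  -- `g` is trivial.
  rcases n with _ | n
  · have h : ∀ z : g, z = 0 := fun z => by simpa using LinearMap.congr_fun hn z
    rw [h y, map_zero]
  · rw [expAd_smul_apply hn, Finset.sum_range_succ']
    simp

theorem expAd_apply_of_lie_lie_lie_eq_zero {x : g} {n : ℕ} (hn : (ad ℂ g x) ^ n = 0) {y : g}
    (h : ⁅x, ⁅x, ⁅x, y⁆⁆⁆ = 0) :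
    expAd x hn y = y + ⁅x, y⁆ + (2⁻¹ : ℂ) • ⁅x, ⁅x, y⁆⁆ := by
  have h' : ∀ k, ((ad ℂ g x) ^ (k + 3)) y = 0 := fun k => by
    rw [pow_add, Module.End.mul_apply]
    exact (congrArg _ h).trans (map_zero _)
  -- Padding the sum to `n + 3` terms lets its first three terms be split off whatever `n` is.
  have h0 : expAd x hn y = ∑ k ∈ Finset.range (n + 3),
      ((k.factorial : ℂ)⁻¹) • ((ad ℂ g x) ^ k) y := by
    rw [expAd_apply, Finset.sum_range_succ _ (n + 2), Finset.sum_range_succ _ (n + 1),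
      Finset.sum_range_succ _ n, pow_add _ n 2, pow_add _ n 1, hn]
    simp
  rw [h0, Finset.sum_range_succ', Finset.sum_range_succ', Finset.sum_range_succ',
    Finset.sum_eq_zero fun k _ => by rw [h' k, smul_zero]]
  have h2 : ((ad ℂ g x) ^ 2) y = ⁅x, ⁅x, y⁆⁆ := by
    rw [pow_two, Module.End.mul_apply, ad_apply, ad_apply]
  simp only [zero_add, pow_one, pow_zero, ad_apply, h2]
  simp
  abel

theorem expAd_smul_apply_of_lie_lie_eq_zero {x : g} {n : ℕ} (hn : (ad ℂ g x) ^ n = 0) {y : g}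
    (h : ⁅x, ⁅x, y⁆⁆ = 0) (t : ℂ) :
    expAd (t • x) (ad_smul_pow_eq_zero hn t) y = y + t • ⁅x, y⁆ := by
  have hn' : (ad ℂ g x) ^ (n + 2) = 0 := by rw [pow_add, hn, zero_mul]
  have h0 : expAd (t • x) (ad_smul_pow_eq_zero hn t) y =
      expAd (t • x) (ad_smul_pow_eq_zero hn' t) y := by
    rw [expAd_smul_apply hn, expAd_smul_apply hn', Finset.sum_range_succ _ (n + 1),
      Finset.sum_range_succ _ n, pow_succ (ad ℂ g x), hn]
    simp
  rw [h0, expAd_smul_apply hn', Finset.sum_range_succ', Finset.sum_range_succ', Finset.sum_eq_zero]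
  · simp [add_comm]
  · intro k _
    rw [pow_succ (ad ℂ g x), pow_succ (ad ℂ g x), Module.End.mul_apply, Module.End.mul_apply,
      ad_apply, ad_apply, h]
    simp

theorem expAd_neg_apply {x : g} {n : ℕ} (hn : (ad ℂ g x) ^ n = 0) (y : g) :
    expAd ((-1 : ℂ) • x) (ad_smul_pow_eq_zero hn _) (expAd x hn y) = y := by
  let _ : Module ℚ g := Module.compHom g (algebraMap ℚ ℂ)
  have key : ∀ {z : g} (hz : (ad ℂ g z) ^ n = 0) (y : g),
      expAd z hz y = IsNilpotent.exp (ad ℂ g z) y := by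
    intro z hz y
    rw [IsNilpotent.exp_eq_sum hz, LinearMap.sum_apply, expAd_apply]
    refine Finset.sum_congr rfl fun k _ => ?_
    change _ = (algebraMap ℚ ℂ (k.factorial : ℚ)⁻¹) • ((ad ℂ g z) ^ k) y
    simp
  rw [key, key, map_smul, neg_one_smul, ← Module.End.mul_apply,
    IsNilpotent.exp_neg_mul_exp_self ⟨n, hn⟩, Module.End.one_apply]

theorem isPolyMap_expAd {W : Type*} [AddCommGroup W] [Module ℂ W] {x : g} {n : ℕ}
    (hn : (ad ℂ g x) ^ n = 0) {f : W → ℂ} {z : W → g} (hf : f ∈ polynomialFunctions W)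
    (hz : IsPolyMap z) :
    IsPolyMap fun w => expAd (f w • x) (ad_smul_pow_eq_zero hn _) (z w) := by
  have : (fun w => expAd (f w • x) (ad_smul_pow_eq_zero hn _) (z w)) =
      fun w => ∑ k ∈ Finset.range n, (f w) ^ k • ((k.factorial : ℂ)⁻¹) •
        ((ad ℂ g x) ^ k) (z w) := by
    ext w
    exact expAd_smul_apply hn _ _
  rw [this]
  exact IsPolyMap.sum _ fun k _ => IsPolyMap.smul (pow_mem_polynomialFunctions hf k)
    (hz.linear_comp (((k.factorial : ℂ)⁻¹) • ((ad ℂ g x) ^ k)))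

variable (g) in
/-- The group generated by the `exp (ad x)` with `x` in a given set and `ad x` nilpotent. -/
noncomputable def expGroup (E : Set g) : Subgroup (g ≃ₗ[ℂ] g) :=
  Subgroup.closure {a | ∃ x ∈ E, ∃ (n : ℕ) (hn : (ad ℂ g x) ^ n = 0),
    a = (expAd x hn).toLinearEquiv}

theorem innerGroup_eq_expGroup : innerGroup g = expGroup g Set.univ := by
  unfold innerGroup expGroup
  congr 1
  ext a
  constructor
  · rintro ⟨x, n, hn, h⟩
    refine ⟨x, trivial, n, hn, LinearEquiv.ext fun y => ?_⟩
    rw [h]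
    exact (expAd_apply hn y).symm
  · rintro ⟨x, -, n, hn, rfl⟩
    exact ⟨x, n, hn, expAd_apply hn⟩

theorem expGroup_mono {E F : Set g} (h : E ⊆ F) : expGroup g E ≤ expGroup g F :=
  Subgroup.closure_mono fun _ ⟨x, hx, r⟩ => ⟨x, h hx, r⟩

theorem expGroup_le_innerGroup (E : Set g) : expGroup g E ≤ innerGroup g :=
  innerGroup_eq_expGroup (g := g) ▸ expGroup_mono (Set.subset_univ E)

theorem expAd_mem_expGroup {E : Set g} {x : g} (hx : x ∈ E) {n : ℕ} (hn : (ad ℂ g x) ^ n = 0) :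
    (expAd x hn).toLinearEquiv ∈ expGroup g E :=
  Subgroup.subset_closure ⟨x, hx, n, hn, rfl⟩

theorem expGroup_map_lie {E : Set g} {a : g ≃ₗ[ℂ] g} (ha : a ∈ expGroup g E) (x y : g) :
    a ⁅x, y⁆ = ⁅a x, a y⁆ := by
  induction ha using Subgroup.closure_induction generalizing x y with
  | mem a ha =>
    obtain ⟨z, -, n, hn, rfl⟩ := ha
    exact LieHom.map_lie (expAd z hn : g →ₗ⁅ℂ⁆ g) x y
  | one => rfl
  | mul a b _ _ ha hb => simp only [LinearEquiv.mul_apply, ha, hb]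
  | inv a _ ha =>
    apply a.injective
    rw [ha, ← LinearEquiv.mul_apply, ← LinearEquiv.mul_apply, ← LinearEquiv.mul_apply,
      mul_inv_cancel]
    rfl

theorem innerGroup_map_lie {a : g ≃ₗ[ℂ] g} (ha : a ∈ innerGroup g) (x y : g) :
    a ⁅x, y⁆ = ⁅a x, a y⁆ :=
  expGroup_map_lie (innerGroup_eq_expGroup (g := g) ▸ ha) x y

/-- Every element of the group lies on a polynomial curve through the identity. -/
theorem exists_curve_of_mem_expGroup {E : Set g} (hE : ∀ x ∈ E, ∀ t : ℂ, t • x ∈ E)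
    {a : g ≃ₗ[ℂ] g} (ha : a ∈ expGroup g E) :
    ∃ A : ℂ → g ≃ₗ[ℂ] g, A 0 = 1 ∧ A 1 = a ∧ (∀ t, A t ∈ expGroup g E) ∧
      ∀ (f : ℂ → ℂ) (z : ℂ → g),
        f ∈ polynomialFunctions ℂ → IsPolyMap z → IsPolyMap fun t => A (f t) (z t) := by
  have key : ∀ (x : g) (_ : x ∈ E) (n : ℕ) (hn : (ad ℂ g x) ^ n = 0) (s : ℂ),
      ∃ A : ℂ → g ≃ₗ[ℂ] g, A 0 = 1 ∧ A 1 = (expAd (s • x) (ad_smul_pow_eq_zero hn s)).toLinearEquiv ∧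
      (∀ t, A t ∈ expGroup g E) ∧
      ∀ (f : ℂ → ℂ) (z : ℂ → g),
        f ∈ polynomialFunctions ℂ → IsPolyMap z → IsPolyMap fun t => A (f t) (z t) := by
    intro x hx n hn s
    refine ⟨fun t => (expAd ((t * s) • x) (ad_smul_pow_eq_zero hn _)).toLinearEquiv, ?_, ?_, ?_, ?_⟩
    · ext y
      simp only [zero_mul]
      exact expAd_zero_smul hn y
    · simp only [one_mul]
    · exact fun t => expAd_mem_expGroup (hE x hx _) _
    · exact fun f z hf hz => isPolyMap_expAd hn (mul_mem hf (const_mem_polynomialFunctions s)) hz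
  rw [expGroup] at ha
  induction ha using Subgroup.closure_induction'' with
  | mem a ha =>
    obtain ⟨x, hx, n, hn, rfl⟩ := ha
    simpa using key x hx n hn 1
  | inv_mem a ha =>
    obtain ⟨x, hx, n, hn, rfl⟩ := ha
    have h1 : ((expAd x hn).toLinearEquiv)⁻¹ =
        (expAd ((-1 : ℂ) • x) (ad_smul_pow_eq_zero hn _)).toLinearEquiv := by
      ext y
      obtain ⟨y, rfl⟩ := (expAd x hn).surjective y
      have : (expAd x hn).toLinearEquiv⁻¹ (expAd x hn y) = y :=
        (expAd x hn).toLinearEquiv.symm_apply_apply y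
      exact this.trans (expAd_neg_apply hn y).symm
    rw [h1]
    exact key x hx n hn (-1)
  | one => exact ⟨fun _ => 1, rfl, rfl, fun _ => one_mem _, fun f z _ hz => hz⟩
  | mul a b _ _ ha hb =>
    obtain ⟨A, hA0, hA1, hAE, hA⟩ := ha
    obtain ⟨B, hB0, hB1, hBE, hB⟩ := hb
    -- The claim allows a varying vector `z` precisely so that the values of the curve `B` can be
    -- fed into the curve `A`.
    refine ⟨fun t => A t * B t, by simp [hA0, hB0], by simp [hA1, hB1],
      fun t => mul_mem (hAE t) (hBE t), fun f z hf hz => ?_⟩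
    exact hA f _ hf (hB f z hf hz)

end Exponential

end StrataDuality

/-! ### Invariance under inner automorphisms, and slices at semisimple elements -/

namespace StrataDuality

open LieAlgebra

variable {g : Type*} [LieRing g] [LieAlgebra ℂ g]

section Invariance

theorem ad_inner_apply {a : g ≃ₗ[ℂ] g} (ha : a ∈ innerGroup g) (x : g) :
    ad ℂ g (a x) = a.conj (ad ℂ g x) := by
  ext y
  rw [LinearEquiv.conj_apply_apply, ad_apply, ad_apply, innerGroup_map_lie ha,
    LinearEquiv.apply_symm_apply]

theorem isSemisimpleElt_inner_iff {a : g ≃ₗ[ℂ] g} (ha : a ∈ innerGroup g) {x : g} :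
    IsSemisimpleElt (a x) ↔ IsSemisimpleElt x := by
  unfold IsSemisimpleElt
  rw [ad_inner_apply ha]
  symm
  refine LinearEquiv.isSemisimple_iff _ _ a (LinearMap.ext fun y => ?_)
  simp

theorem mem_centralizer {x y : g} : y ∈ centralizer x ↔ ⁅x, y⁆ = 0 := Iff.rfl

theorem mem_centralizer_inner_iff {a : g ≃ₗ[ℂ] g} (ha : a ∈ innerGroup g) {x y : g} :
    a y ∈ centralizer (a x) ↔ y ∈ centralizer x := by
  rw [mem_centralizer, mem_centralizer, ← innerGroup_map_lie ha, LinearEquiv.map_eq_zero_iff]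

theorem map_centralizer {a : g ≃ₗ[ℂ] g} (ha : a ∈ innerGroup g) (x : g) :
    (centralizer x).toSubmodule.map (a : g →ₗ[ℂ] g) = (centralizer (a x)).toSubmodule := by
  ext y
  obtain ⟨y, rfl⟩ := a.surjective y
  rw [LieSubalgebra.mem_toSubmodule, mem_centralizer_inner_iff ha]
  exact (Submodule.mem_map_equiv (e := a) (centralizer x).toSubmodule).trans (by simp)

end Invariance

section Slice

theorem exists_eigenbasis {V : Type*} [AddCommGroup V] [Module ℂ V] [FiniteDimensional ℂ V]
    {T : Module.End ℂ V} (hT : T.IsSemisimple) :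
    ∃ (n : ℕ) (b : Module.Basis (Fin n) ℂ V) (μ : Fin n → ℂ), ∀ i, T (b i) = μ i • b i := by
  have hspan : ⊤ ≤ Submodule.span ℂ {v | ∃ μ : ℂ, T v = μ • v} := by
    rw [← hT.iSup_eigenspace_eq_top, iSup_le_iff]
    intro μ v hv
    exact Submodule.subset_span ⟨μ, Module.End.mem_eigenspace_iff.mp hv⟩
  let b := Module.Basis.ofSpan hspan
  have hb : ∀ i, ∃ μ : ℂ, T (b i) = μ • b i :=
    fun i => Module.Basis.ofSpan_subset hspan ⟨i, rfl⟩
  let _ := FiniteDimensional.fintypeBasisIndex b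
  choose μ hμ using hb
  exact ⟨_, b.reindex (Fintype.equivFin _), μ ∘ (Fintype.equivFin _).symm, fun i => by simp [hμ]⟩

theorem expGroup_apply_mem_iff {M : LieSubalgebra ℂ g} {a : g ≃ₗ[ℂ] g}
    (ha : a ∈ expGroup g (M : Set g)) {y : g} : a y ∈ M ↔ y ∈ M := by
  have key : ∀ x ∈ M, ∀ (n : ℕ) (hn : (ad ℂ g x) ^ n = 0), ∀ y ∈ M, expAd x hn y ∈ M := by
    intro x hx n hn y hy
    rw [expAd_apply]
    have hk : ∀ k : ℕ, ((ad ℂ g x) ^ k) y ∈ M := by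
      intro k
      induction k with
      | zero => exact hy
      | succ k ih =>
        rw [pow_succ', Module.End.mul_apply]
        exact M.lie_mem hx ih
    exact sum_mem fun k _ => M.smul_mem _ (hk k)
  induction ha using Subgroup.closure_induction generalizing y with
  | mem a ha =>
    obtain ⟨x, hx, n, hn, rfl⟩ := ha
    refine ⟨fun h => ?_, key x hx n hn y⟩
    have := key _ (M.smul_mem (-1) hx) n (ad_smul_pow_eq_zero hn _) _ h
    rwa [show (expAd x hn).toLinearEquiv y = expAd x hn y from rfl, expAd_neg_apply] at this
  | one => rfl
  | mul a b _ _ ha hb => exact ha.trans hb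
  | inv a _ ha =>
    refine ha.symm.trans ?_
    rw [← LinearEquiv.mul_apply, mul_inv_cancel]
    rfl

theorem IsPolyMap.codRestrict {V W : Type*} [AddCommGroup V] [Module ℂ V] [AddCommGroup W]
    [Module ℂ W] {M : Submodule ℂ V} {Φ : W → V} (hΦ : IsPolyMap Φ) (h : ∀ w, Φ w ∈ M) :
    IsPolyMap fun w => (⟨Φ w, h w⟩ : M) := by
  intro φ
  obtain ⟨ψ, hψ⟩ := φ.exists_extend
  have : (fun w => φ ⟨Φ w, h w⟩) = fun w => ψ (Φ w) := by
    ext w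
    rw [← hψ]
    rfl
  rw [this]
  exact hΦ ψ

/-- `ad e` shifts the eigenvalues of `ad x` by `μ`; if no power of it killed an eigenvector, `ad x`
would have infinitely many eigenvalues. -/
theorem isNilpotent_ad_of_eigenvector [FiniteDimensional ℂ g] {x e : g} (hx : IsSemisimpleElt x)
    {μ : ℂ} (hμ : μ ≠ 0) (he : ⁅x, e⁆ = μ • e) : IsNilpotent (ad ℂ g e) := by
  refine Module.End.isNilpotent_iff_of_finite.mpr fun v => ?_
  have hv : v ∈ ⨆ ν, (ad ℂ g x).eigenspace ν := by
    rw [Module.End.IsSemisimple.iSup_eigenspace_eq_top hx]; trivial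
  induction hv using Submodule.iSup_induction' with
  | mem ν v hv =>
    have key : ∀ n : ℕ, ((ad ℂ g e) ^ n) v ∈ (ad ℂ g x).eigenspace (ν + n * μ) := by
      intro n
      induction n with
      | zero => simpa using hv
      | succ n ih =>
        rw [Module.End.mem_eigenspace_iff, ad_apply] at ih ⊢
        rw [pow_succ', Module.End.mul_apply, ad_apply, leibniz_lie, he, ih, smul_lie, lie_smul,
          ← add_smul]
        congr 1
        push_cast
        ring
    by_contra! h
    have hinj : Function.Injective fun n : ℕ => ν + n * μ := by
      intro m n hmn
      have : (m : ℂ) * μ = n * μ := add_left_cancel hmn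
      exact_mod_cast mul_right_cancel₀ hμ this
    refine Set.infinite_of_injective_forall_mem hinj (s := {ν | (ad ℂ g x).HasEigenvalue ν}) ?_
      (ad ℂ g x).finite_hasEigenvalue
    exact fun n => Module.End.hasEigenvalue_of_hasEigenvector ⟨key n, h n⟩
  | zero => exact ⟨0, by simp⟩
  | add v w _ _ hv hw =>
    obtain ⟨m, hm⟩ := hv
    obtain ⟨n, hn⟩ := hw
    refine ⟨m + n, ?_⟩
    rw [map_add, pow_add, Module.End.mul_apply, Module.End.mul_apply, hn, map_zero, add_zero,
      ← Module.End.mul_apply, ← pow_add, add_comm m n, pow_add, Module.End.mul_apply, hm, map_zero]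

/-- A subalgebra `M` is, near a semisimple element `x`, swept out by the centralizer of `x`. -/
theorem exists_slice [FiniteDimensional ℂ g] (M : LieSubalgebra ℂ g) {x : g} (hxM : x ∈ M)
    (hx : IsSemisimpleElt x) {p : g → ℂ} (hp : p ∈ polynomialFunctions g) (hpx : p x ≠ 0) :
    ∃ q ∈ polynomialFunctions M, q ⟨x, hxM⟩ ≠ 0 ∧ ∀ y : M, q y ≠ 0 →
      ∃ a ∈ expGroup g (M : Set g), ∃ n ∈ M, ⁅x, n⁆ = 0 ∧ p n ≠ 0 ∧ (y : g) = a n := by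
  have hinv : M.toSubmodule ∈ (ad ℂ g x).invtSubmodule := fun y hy => M.lie_mem hxM hy
  obtain ⟨n, b, μ, hb⟩ := exists_eigenbasis (hx.restrict hinv)
  replace hb : ∀ i, ⁅x, (b i : g)⁆ = μ i • (b i : g) := fun i => congrArg Subtype.val (hb i)
  -- If `μ i ≠ 0`, then `b i` is ad-nilpotent and its exponentials move `x` in the direction of `b
  -- i`. If `μ i = 0`, then `b i` commutes with `x`; the curve is constant and this direction is
  -- left to the projection `N` onto the centralizer of `x` in `M`.
  have hA : ∀ i, ∃ A : ℂ → g ≃ₗ[ℂ] g, A 0 = 1 ∧ (∀ t, A t ∈ expGroup g (M : Set g)) ∧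
      (∀ (f : M → ℂ) (z : M → g), f ∈ polynomialFunctions M → IsPolyMap z →
        IsPolyMap fun w => A (f w) (z w)) ∧
      (∀ t, A t x = x - (t * μ i) • (b i : g)) ∧ (μ i = 0 → ∀ t, A t = 1) := by
    intro i
    by_cases hi : μ i = 0
    · exact ⟨fun _ => 1, rfl, fun _ => one_mem _, fun f z _ hz => hz, fun t => by simp [hi],
        fun _ _ => rfl⟩
    · obtain ⟨k, hk⟩ := isNilpotent_ad_of_eigenvector hx hi (hb i)
      refine ⟨fun t => (expAd (t • (b i : g)) (ad_smul_pow_eq_zero hk t)).toLinearEquiv, ?_,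
        fun t => expAd_mem_expGroup (M.smul_mem t (b i).2) _,
        fun f z hf hz => isPolyMap_expAd hk hf hz, fun t => ?_, fun h => absurd h hi⟩
      · ext y
        exact expAd_zero_smul hk y
      · have h1 : ⁅(b i : g), x⁆ = -(μ i • (b i : g)) := by rw [← lie_skew, hb]
        refine (expAd_smul_apply_of_lie_lie_eq_zero hk (y := x) (by simp [h1]) t).trans ?_
        rw [h1, smul_neg, smul_smul, sub_eq_add_neg]
  choose A hA0 hAM hApoly hAx hA1 using hA
  let N : M →ₗ[ℂ] M := b.constr ℂ fun i => if μ i = 0 then b i else 0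
  have hN : ∀ w, ⁅x, (N w : g)⁆ = 0 := by
    intro w
    have : (ad ℂ g x) ∘ₗ M.toSubmodule.subtype ∘ₗ N = 0 := by
      refine b.ext fun i => ?_
      simp only [LinearMap.comp_apply, N, Module.Basis.constr_basis, Submodule.subtype_apply,
        ad_apply, LinearMap.zero_apply]
      split_ifs with h
      · exact (hb i).trans (by rw [h, zero_smul])
      · simp
    exact LinearMap.congr_fun this w
  let G : M → List (Fin n) → g ≃ₗ[ℂ] g := fun w l => (l.map fun i => A i (b.repr w i)).prod
  have hGM : ∀ w l, G w l ∈ expGroup g (M : Set g) := by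
    intro w l
    refine Subgroup.list_prod_mem _ fun a ha => ?_
    obtain ⟨i, -, rfl⟩ := List.mem_map.mp ha
    exact hAM i _
  have hGpoly : ∀ l (z : M → g), IsPolyMap z → IsPolyMap fun w => G w l (z w) := by
    intro l
    induction l with
    | nil => exact fun z hz => hz
    | cons i l ih =>
      intro z hz
      exact hApoly i _ _ (dual_mem_polynomialFunctions (b.coord i)) (ih z hz)
  have hGline : ∀ i (s : ℂ) (l : List (Fin n)), l.Nodup →
      G (s • b i) l x = if i ∈ l then x - (s * μ i) • (b i : g) else x := by
    intro i s l hl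
    induction l with
    | nil => simp [G]
    | cons j l ih =>
      have h1 : G (s • b i) (j :: l) x = A j (b.repr (s • b i) j) (G (s • b i) l x) := rfl
      rw [List.nodup_cons] at hl
      rw [h1, ih hl.2]
      by_cases hij : i = j
      · subst hij
        rw [if_neg hl.1, if_pos List.mem_cons_self, hAx]
        simp
      · have : b.repr (s • b i) j = 0 := by simp [hij]
        rw [this, hA0]
        simp [hij]
  have hGline' : ∀ i (s : ℂ) (l : List (Fin n)), μ i = 0 → G (s • b i) l = 1 := by
    intro i s l hi
    refine List.prod_eq_one fun a ha => ?_
    obtain ⟨j, -, rfl⟩ := List.mem_map.mp ha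
    by_cases hij : i = j
    · subst hij
      exact hA1 i hi _
    · have : b.repr (s • b i) j = 0 := by simp [hij]
      rw [this, hA0]
  let l := List.finRange n
  have hxN : IsPolyMap fun w : M => x + (N w : g) :=
    (isPolyMap_const x).add (isPolyMap_linear (M.toSubmodule.subtype ∘ₗ N))
  have hxNM : ∀ w, G w l (x + (N w : g)) ∈ M := fun w =>
    (expGroup_apply_mem_iff (hGM w l)).mpr (M.add_mem hxM (N w).2)
  -- On the axis of `b i` this is `x + s • b i` if `μ i = 0` and `x - (s * μ i) • b i` otherwise.
  -- Its linear part is thus diagonal with entries `1` and `-μ i`, all units.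
  let Φ : M → M := fun w => ⟨G w l (x + (N w : g)), hxNM w⟩
  have hΦ : IsPolyMap Φ := (hGpoly l _ hxN).codRestrict (M := M.toSubmodule) hxNM
  let u : Fin n → ℂˣ := fun i => if h : μ i = 0 then 1 else Units.mk0 (-μ i) (neg_ne_zero.mpr h)
  let L : M ≃ₗ[ℂ] M := b.equiv (b.unitsSMul u) (Equiv.refl _)
  have hΦ0 : Φ 0 = ⟨x, hxM⟩ := by
    apply Subtype.ext
    have : G 0 l = 1 := by
      refine List.prod_eq_one fun a ha => ?_
      obtain ⟨j, -, rfl⟩ := List.mem_map.mp ha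
      simp [hA0]
    simp [Φ, this]
  have hL : ∀ i (s : ℂ), Φ (s • b i) = Φ 0 + s • L (b i) := by
    intro i s
    rw [hΦ0]
    apply Subtype.ext
    have hLi : L (b i) = (u i : ℂ) • b i := by
      simp [L, Module.Basis.unitsSMul_apply, Units.smul_def]
    have hNi : N (s • b i) = s • if μ i = 0 then b i else 0 := by
      rw [map_smul, Module.Basis.constr_basis]
    change G (s • b i) l (x + (N (s • b i) : g)) = x + s • (L (b i) : g)
    rw [hLi, hNi]
    by_cases hi : μ i = 0
    · rw [hGline' i s l hi]
      simp [hi, u]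
    · rw [if_neg hi, smul_zero, ZeroMemClass.coe_zero, add_zero,
        hGline i s l (List.nodup_finRange n), if_pos (List.mem_finRange i)]
      simp [u, hi, smul_smul, sub_eq_add_neg]
  obtain ⟨q, hq, hq0, hqy⟩ := exists_open_subset_image b hΦ L hL (hxN.comp_mem hp)
    (by simpa using hpx)
  refine ⟨q, hq, by rwa [hΦ0] at hq0, fun y hy => ?_⟩
  obtain ⟨w, hw, rfl⟩ := hqy y hy
  exact ⟨G w l, hGM w l, x + (N w : g), M.add_mem hxM (N w).2, by simp [hN], hw, rfl⟩

end Slice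

end StrataDuality

/-! ### Centralizers, Cartan subalgebras and their conjugacy -/

namespace StrataDuality

open LieAlgebra

variable {g : Type*} [LieRing g] [LieAlgebra ℂ g] [FiniteDimensional ℂ g]

section SemisimpleLocus

/-- If the kernel of `ad y` is its generalized kernel, then `y` is in a Cartan subalgebra. -/
theorem exists_isCartanSubalgebra_mem {y : g}
    (hy : ∀ z, z ∈ LieSubalgebra.engel ℂ y → ⁅y, z⁆ = 0) :
    ∃ C : LieSubalgebra ℂ g, C.IsCartanSubalgebra ∧ y ∈ C := by
  let N := LieSubalgebra.engel ℂ y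
  have hyN : y ∈ N := LieSubalgebra.self_mem_engel ℂ y
  obtain ⟨z, hz⟩ := exists_isCartanSubalgebra_engel ℂ (L := N)
  let C₀ := LieSubalgebra.engel ℂ z
  have hyC : (⟨y, hyN⟩ : N) ∈ C₀ := by
    rw [LieSubalgebra.mem_engel_iff]
    refine ⟨1, ?_⟩
    rw [pow_one, ad_apply]
    apply Subtype.ext
    rw [LieSubalgebra.coe_bracket, ← lie_skew, hy _ z.2, neg_zero]
    rfl
  have hmem : ∀ {w : g}, w ∈ C₀.map N.incl ↔ ∃ hw : w ∈ N, (⟨w, hw⟩ : N) ∈ C₀ := by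
    intro w
    rw [LieSubalgebra.mem_map]
    constructor
    · rintro ⟨v, hv, rfl⟩
      exact ⟨v.2, hv⟩
    · rintro ⟨hw, h⟩
      exact ⟨_, h, rfl⟩
  refine ⟨C₀.map N.incl, ⟨?_, ?_⟩, hmem.mpr ⟨hyN, hyC⟩⟩
  · exact (LieSubalgebra.equivMapOfInjective C₀ (f := N.incl)
      Subtype.coe_injective).nilpotent_iff_equiv_nilpotent.mp hz.nilpotent
  · refine le_antisymm (fun w hw => ?_) (LieSubalgebra.le_normalizer _)
    rw [LieSubalgebra.mem_normalizer_iff'] at hw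
    -- As `w` normalizes, its bracket with `y` lies in `N` and so commutes with `y`; hence the
    -- square of `ad y` kills `w`.
    have hwN : w ∈ N := by
      obtain ⟨h1, -⟩ := hmem.mp (hw y (hmem.mpr ⟨hyN, hyC⟩))
      rw [LieSubalgebra.mem_engel_iff]
      exact ⟨2, by rw [pow_two, Module.End.mul_apply, ad_apply, ad_apply, hy _ h1]⟩
    refine hmem.mpr ⟨hwN, ?_⟩
    change _ ∈ LieSubalgebra.engel ℂ z
    rw [← hz.self_normalizing, LieSubalgebra.mem_normalizer_iff']
    intro v hv
    obtain ⟨h1, h2⟩ := hmem.mp (hw v (hmem.mpr ⟨v.2, hv⟩))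
    exact h2

omit [FiniteDimensional ℂ g] in
theorem IsSemisimpleElt.lie_eq_zero_of_mem_engel {y : g} (hy : IsSemisimpleElt y) {z : g}
    (hz : z ∈ LieSubalgebra.engel ℂ y) : ⁅y, z⁆ = 0 := by
  have h : z ∈ (ad ℂ g y).maxGenEigenspace 0 := hz
  rw [(Module.End.IsSemisimple.isFinitelySemisimple hy).maxGenEigenspace_eq_eigenspace,
    Module.End.mem_eigenspace_iff, zero_smul] at h
  exact h

omit [FiniteDimensional ℂ g] in
theorem centralizer_le_engel (y : g) :
    (centralizer y).toSubmodule ≤ (LieSubalgebra.engel ℂ y).toSubmodule := fun z hz =>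
  (LieSubalgebra.mem_engel_iff ℂ y z).mpr ⟨1, by rw [pow_one]; exact hz⟩

theorem finrank_engel_le_of_coeff_ne_zero {y : g} {k : ℕ} (h : (ad ℂ g y).charpoly.coeff k ≠ 0) :
    Module.finrank ℂ (LieSubalgebra.engel ℂ y) ≤ k := by
  rw [finrank_engel]
  exact Polynomial.natTrailingDegree_le_of_ne_zero h

theorem coeff_finrank_engel_ne_zero (y : g) :
    (ad ℂ g y).charpoly.coeff (Module.finrank ℂ (LieSubalgebra.engel ℂ y)) ≠ 0 := by
  rw [finrank_engel]
  exact Polynomial.trailingCoeff_nonzero_iff_nonzero.mpr (LinearMap.charpoly_monic _).ne_zero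

theorem IsSemisimpleElt.coeff_finrank_centralizer_ne_zero {y : g} (hy : IsSemisimpleElt y) :
    (ad ℂ g y).charpoly.coeff (Module.finrank ℂ (centralizer y)) ≠ 0 := by
  have : (centralizer y).toSubmodule = (LieSubalgebra.engel ℂ y).toSubmodule :=
    le_antisymm (centralizer_le_engel y) fun z hz => hy.lie_eq_zero_of_mem_engel hz
  have h := coeff_finrank_engel_ne_zero y
  change (ad ℂ g y).charpoly.coeff (Module.finrank ℂ (centralizer y).toSubmodule) ≠ 0
  rw [this]
  exact h

/-- The generalized kernel has as dimension the order of vanishing of the characteristic polynomial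
at zero, so a nonzero coefficient collapses the chain from `m` through the centralizer to the
generalized kernel. Among the elements centralizing `m`, having centralizer exactly `m` thus follows
from a Zariski-open condition. -/
theorem engel_eq_of_coeff_ne_zero {y : g} {m : Submodule ℂ g} (hm : m ≤ (centralizer y).toSubmodule)
    (h : (ad ℂ g y).charpoly.coeff (Module.finrank ℂ m) ≠ 0) :
    m = (centralizer y).toSubmodule ∧ m = (LieSubalgebra.engel ℂ y).toSubmodule := by
  have h1 : m = (LieSubalgebra.engel ℂ y).toSubmodule :=
    Submodule.eq_of_le_of_finrank_le (hm.trans (centralizer_le_engel y))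
      (finrank_engel_le_of_coeff_ne_zero h)
  exact ⟨le_antisymm hm (h1 ▸ centralizer_le_engel y), h1⟩

theorem finrank_centralizer_add (y : g) :
    Module.finrank ℂ (LinearMap.range (ad ℂ g y)) + Module.finrank ℂ (centralizer y) =
      Module.finrank ℂ g :=
  LinearMap.finrank_range_add_finrank_ker _

theorem finrank_centralizer_of_mem_orbitDimLocus {d : ℕ} {y : g} (hy : y ∈ orbitDimLocus g d) :
    Module.finrank ℂ (centralizer y) = Module.finrank ℂ g - d := by
  have := finrank_centralizer_add y
  have hd : Module.finrank ℂ (LinearMap.range (ad ℂ g y)) = d := hy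
  omega

theorem mem_orbitDimLocus_of_finrank_eq {d : ℕ} {x y : g} (hx : x ∈ orbitDimLocus g d)
    (h : Module.finrank ℂ (centralizer y) = Module.finrank ℂ (centralizer x)) :
    y ∈ orbitDimLocus g d := by
  have h1 := finrank_centralizer_add y
  have h2 := finrank_centralizer_add x
  have hd : Module.finrank ℂ (LinearMap.range (ad ℂ g x)) = d := hx
  change Module.finrank ℂ (LinearMap.range (ad ℂ g y)) = d
  omega

theorem charpoly_coeff_ad_mem (k : ℕ) :
    (fun y : g => (ad ℂ g y).charpoly.coeff k) ∈ polynomialFunctions g :=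
  (isPolyMap_linear (ad ℂ g : g →ₗ[ℂ] Module.End ℂ g)).charpoly_coeff_mem k

end SemisimpleLocus

section Cartan

variable [IsKilling ℂ g] (H : LieSubalgebra ℂ g) [H.IsCartanSubalgebra]

theorem isSemisimpleElt_of_mem_cartan {x : g} (hx : x ∈ H) : IsSemisimpleElt x :=
  IsKilling.isSemisimple_ad_of_mem_isCartanSubalgebra hx

theorem cartan_lie_eq_zero {x y : g} (hx : x ∈ H) (hy : y ∈ H) : ⁅x, y⁆ = 0 :=
  congrArg Subtype.val (trivial_lie_zero H H ⟨x, hx⟩ ⟨y, hy⟩)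

omit [FiniteDimensional ℂ g] [IsKilling ℂ g] in
theorem mem_cartan_of_lie_eq_zero {x : g} (h : ∀ y ∈ H, ⁅y, x⁆ = 0) : x ∈ H := by
  rw [← LieSubalgebra.IsCartanSubalgebra.self_normalizing (H := H),
    LieSubalgebra.mem_normalizer_iff']
  intro y hy
  rw [h y hy]
  exact H.zero_mem

omit [IsKilling ℂ g] in
theorem exists_weight_basis :
    ∃ (n : ℕ) (b : Module.Basis (Fin n) ℂ g) (χ : Fin n → LieModule.Weight ℂ H g),
      ∀ i, b i ∈ rootSpace H (χ i) := by
  have hspan : ⊤ ≤ Submodule.span ℂ {v | ∃ χ : LieModule.Weight ℂ H g, v ∈ rootSpace H χ} := by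
    have h := LieModule.iSup_genWeightSpace_eq_top' ℂ H g
    rw [← LieSubmodule.toSubmodule_inj, LieSubmodule.iSup_toSubmodule,
      LieSubmodule.top_toSubmodule] at h
    rw [← h, iSup_le_iff]
    exact fun χ v hv => Submodule.subset_span ⟨χ, hv⟩
  let b := Module.Basis.ofSpan hspan
  have hb : ∀ i, ∃ χ : LieModule.Weight ℂ H g, b i ∈ rootSpace H χ :=
    fun i => Module.Basis.ofSpan_subset hspan ⟨i, rfl⟩
  let _ := FiniteDimensional.fintypeBasisIndex b
  choose χ hχ using hb
  exact ⟨_, b.reindex (Fintype.equivFin _), χ ∘ (Fintype.equivFin _).symm, fun i => by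
    simpa using hχ _⟩

variable {H}

theorem lie_weight_vector {χ : H → ℂ} {v : g} (hv : v ∈ rootSpace H χ) {x : g} (hx : x ∈ H) :
    ⁅x, v⁆ = χ ⟨x, hx⟩ • v :=
  IsKilling.lie_eq_smul_of_mem_rootSpace hv ⟨x, hx⟩

omit [IsKilling ℂ g] in
theorem mem_cartan_of_isZero {χ : LieModule.Weight ℂ H g} (hχ : χ.IsZero) {v : g}
    (hv : v ∈ rootSpace H χ) : v ∈ H := by
  rw [hχ.eq, rootSpace_zero_eq] at hv
  exact hv

theorem mem_leviRoots_centralizer {x : g} (hx : x ∈ H) (α : H.root) :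
    α ∈ leviRoots H (centralizer x) ↔ α.1 ⟨x, hx⟩ = 0 := by
  constructor
  · intro h
    obtain ⟨v, hv, hv0⟩ := α.1.exists_ne_zero
    have h1 : ⁅x, v⁆ = 0 := h hv
    rw [lie_weight_vector hv hx] at h1
    exact (smul_eq_zero.mp h1).resolve_right hv0
  · intro h v hv
    change ⁅x, v⁆ = 0
    rw [lie_weight_vector hv hx, h, zero_smul]

theorem le_centralizer {x : g} (hx : x ∈ H) : H ≤ centralizer x :=
  fun _ hy => cartan_lie_eq_zero H hx hy

/-- In a weight basis, an element commuting with `x` has components only in weights that vanish at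
`x`; these lie in `H` or in root spaces of the centralizer. -/
theorem centralizer_le_of_leviRoots_subset {x : g} (hx : x ∈ H) {m : LieSubalgebra ℂ g} (hm : H ≤ m)
    (h : leviRoots H (centralizer x) ⊆ leviRoots H m) : centralizer x ≤ m := by
  obtain ⟨n, b, χ, hb⟩ := exists_weight_basis H
  intro y hy
  have hy0 : ∀ i, b.repr y i * χ i ⟨x, hx⟩ = 0 := by
    have h1 : ⁅x, y⁆ = 0 := hy
    rw [← b.sum_repr y, lie_sum] at h1
    simp only [lie_smul, lie_weight_vector (hb _) hx, smul_smul] at h1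
    exact fun i => Fintype.linearIndependent_iff.mp b.linearIndependent _ h1 i
  rw [← b.sum_repr y]
  refine sum_mem fun i _ => ?_
  rcases mul_eq_zero.mp (hy0 i) with h0 | h0
  · rw [h0, zero_smul]
    exact m.zero_mem
  · refine m.smul_mem _ ?_
    by_cases hi : (χ i).IsZero
    · exact hm (mem_cartan_of_isZero hi (hb i))
    · let α : H.root := ⟨χ i, by simpa [LieSubalgebra.root] using hi⟩
      exact h ((mem_leviRoots_centralizer hx α).mpr h0) (hb i)

omit [FiniteDimensional ℂ g] [IsKilling ℂ g] in
theorem mem_cartan_of_le_centralizer {x : g} (h : H ≤ centralizer x) : x ∈ H :=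
  mem_cartan_of_lie_eq_zero H fun y hy => by
    rw [← lie_skew, show ⁅x, y⁆ = 0 from h hy, neg_zero]

theorem centralizer_eq_cartan {x : g} (hx : x ∈ H) (h : ∀ α : H.root, α.1 ⟨x, hx⟩ ≠ 0) :
    centralizer x = H :=
  le_antisymm (centralizer_le_of_leviRoots_subset hx le_rfl fun α hα =>
    absurd ((mem_leviRoots_centralizer hx α).mp hα) (h α)) (le_centralizer hx)

omit [IsKilling ℂ g] in
theorem leviRoots_mono {m₁ m₂ : LieSubalgebra ℂ g} (h : m₁ ≤ m₂) :
    leviRoots H m₁ ⊆ leviRoots H m₂ := fun _ hα _ hv => h (hα hv)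

/-- Levi subalgebras containing `H` are compared by their roots. -/
theorem levi_le_iff {m₁ m₂ : LieSubalgebra ℂ g} (h₁ : IsLevi m₁) (hm₁ : H ≤ m₁) (hm₂ : H ≤ m₂) :
    m₁ ≤ m₂ ↔ leviRoots H m₁ ⊆ leviRoots H m₂ := by
  refine ⟨leviRoots_mono, fun h => ?_⟩
  obtain ⟨x, -, rfl⟩ := h₁
  exact centralizer_le_of_leviRoots_subset (mem_cartan_of_le_centralizer hm₁) hm₂ h

theorem exists_of_simple_root_values (b : (IsKilling.rootSystem H).Base) (c : H.root → ℂ) :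
    ∃ x : H, ∀ i ∈ b.support, i.1 x = c i := by
  let φ : Module.Dual ℂ (Module.Dual ℂ H) := b.toWeightBasis.constr ℂ fun i => c i
  refine ⟨(Module.evalEquiv ℂ H).symm φ, fun i hi => ?_⟩
  have h1 : φ ((IsKilling.rootSystem H).root i) = c i := by
    have := b.toWeightBasis.constr_basis ℂ (fun i => c i) ⟨i, hi⟩
    rwa [b.toWeightBasis_apply] at this
  rw [← h1]
  obtain ⟨x, hx⟩ := (Module.evalEquiv ℂ H).surjective φ
  rw [← hx, LinearEquiv.symm_apply_apply]
  rfl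

/-- The element of `H` on which each root takes its height as a value. -/
theorem exists_height_element (b : (IsKilling.rootSystem H).Base) :
    ∃ ρ : H, ∀ α : H.root, α.1 ρ = b.height α := by
  obtain ⟨ρ, hρ⟩ := exists_of_simple_root_values b fun _ => 1
  refine ⟨ρ, fun α => ?_⟩
  obtain ⟨f, -, -, hf⟩ := b.exists_root_eq_sum_int α
  rw [b.height_eq_sum hf]
  have h1 := LinearMap.congr_fun hf ρ
  rw [LinearMap.sum_apply] at h1
  refine Eq.trans h1 ?_
  push_cast
  refine Finset.sum_congr rfl fun i hi => ?_
  have : (f i • (IsKilling.rootSystem H).root i) ρ = (f i : ℂ) * i.1 ρ := by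
    rw [LinearMap.smul_apply, zsmul_eq_mul]
    rfl
  rw [this, hρ i hi, mul_one]

variable (H) in
-- Heights of roots are never zero, so no root vanishes at the height element.
theorem exists_regular : ∃ x : H, centralizer (x : g) = H := by
  obtain ⟨b⟩ : Nonempty (IsKilling.rootSystem H).Base := RootPairing.nonempty_base _
  obtain ⟨ρ, hρ⟩ := exists_height_element b
  refine ⟨ρ, centralizer_eq_cartan ρ.2 fun α => ?_⟩
  rw [Subtype.coe_eta, hρ]
  exact_mod_cast b.height_ne_zero α

end Cartan

section Conjugacy

variable [IsKilling ℂ g] (H : LieSubalgebra ℂ g) [H.IsCartanSubalgebra]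

theorem centralizer_eq_of_coeff_ne_zero {n : g} (hn : n ∈ H)
    (h : (ad ℂ g n).charpoly.coeff (Module.finrank ℂ H) ≠ 0) : centralizer n = H :=
  LieSubalgebra.toSubmodule_injective
    (engel_eq_of_coeff_ne_zero (m := H.toSubmodule) (le_centralizer hn) h).1.symm

/-- Every semisimple element is conjugate to an element of a given Cartan subalgebra. -/
theorem exists_inner_mem_cartan {x : g} (hx : IsSemisimpleElt x) :
    ∃ a ∈ innerGroup g, a x ∈ H := by
  obtain ⟨x₀, hx₀⟩ := exists_regular H
  have hr := (isSemisimpleElt_of_mem_cartan H x₀.2).coeff_finrank_centralizer_ne_zero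
  rw [hx₀] at hr
  -- A generic element is conjugate both to some `n₁` commuting with `x` and to some `n₂` in `H`
  -- with centralizer `H`. The automorphism taking `n₁` to `n₂` takes `x` to an element commuting
  -- with `n₂`, hence into `H`.
  obtain ⟨q₁, hq₁, hq₁0, h₁⟩ := exists_slice ⊤ (LieSubalgebra.mem_top x) hx
    (const_mem_polynomialFunctions 1) one_ne_zero
  obtain ⟨q₂, hq₂, hq₂0, h₂⟩ := exists_slice ⊤ (LieSubalgebra.mem_top (x₀ : g))
    (isSemisimpleElt_of_mem_cartan H x₀.2) (charpoly_coeff_ad_mem _) hr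
  obtain ⟨z, hz₁, hz₂⟩ := exists_ne_zero_and_ne_zero hq₁ hq₂ hq₁0 hq₂0
  obtain ⟨a, ha, n₁, -, hn₁, -, hz₁⟩ := h₁ z hz₁
  obtain ⟨b, hb, n₂, -, hn₂, hp, hz₂⟩ := h₂ z hz₂
  have ha' := expGroup_le_innerGroup _ ha
  have hb' := expGroup_le_innerGroup _ hb
  have hn₂H : n₂ ∈ H := by
    rw [← hx₀]
    exact hn₂
  refine ⟨b⁻¹ * a, mul_mem (inv_mem hb') ha', ?_⟩
  rw [← centralizer_eq_of_coeff_ne_zero H hn₂H hp]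
  have h3 : n₂ = (b⁻¹ * a) n₁ := by
    apply b.injective
    rw [← hz₂, hz₁, ← LinearEquiv.mul_apply, mul_inv_cancel_left]
  rw [h3, mem_centralizer_inner_iff (mul_mem (inv_mem hb') ha'), mem_centralizer, ← lie_skew, hn₁,
    neg_zero]

/-- Cartan subalgebras conjugate to `H` are conjugate to `H` inside each subalgebra containing
both. -/
theorem exists_expGroup_map_cartan {m : LieSubalgebra ℂ g} (hm : H ≤ m) {a : g ≃ₗ[ℂ] g}
    (ha : a ∈ innerGroup g) (ham : ∀ h ∈ H, a h ∈ m) :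
    ∃ c ∈ expGroup g (m : Set g), ∀ h, c (a h) ∈ H ↔ h ∈ H := by
  obtain ⟨x₀, hx₀⟩ := exists_regular H
  have hs := isSemisimpleElt_of_mem_cartan H x₀.2
  have hr := hs.coeff_finrank_centralizer_ne_zero
  rw [hx₀] at hr
  have hchar : ∀ (c : g ≃ₗ[ℂ] g), c ∈ innerGroup g → ∀ x,
      (ad ℂ g (c x)).charpoly = (ad ℂ g x).charpoly := by
    intro c hc x
    rw [ad_inner_apply hc, LinearEquiv.charpoly_conj]
  -- The two slices, at `x₀` and at `a x₀`, are taken inside `m`, which keeps the conjugating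
  -- elements in the group generated from `m`.
  obtain ⟨q₁, hq₁, hq₁0, h₁⟩ := exists_slice m (hm x₀.2) hs (charpoly_coeff_ad_mem _) hr
  obtain ⟨q₂, hq₂, hq₂0, h₂⟩ := exists_slice m (ham _ x₀.2)
    ((isSemisimpleElt_inner_iff ha).mpr hs) (charpoly_coeff_ad_mem _)
    (by rw [hchar a ha]; exact hr)
  obtain ⟨z, hz₁, hz₂⟩ := exists_ne_zero_and_ne_zero hq₁ hq₂ hq₁0 hq₂0
  obtain ⟨b₁, hb₁, n₁, -, hn₁, hp₁, hz₁⟩ := h₁ z hz₁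
  obtain ⟨b₂, hb₂, n₂, -, hn₂, hp₂, hz₂⟩ := h₂ z hz₂
  have hb₁' := expGroup_le_innerGroup _ hb₁
  have hb₂' := expGroup_le_innerGroup _ hb₂
  obtain ⟨n₂, rfl⟩ := a.surjective n₂
  rw [hchar a ha] at hp₂
  replace hn₁ : n₁ ∈ H := by
    rw [← hx₀]
    exact hn₁
  replace hn₂ : n₂ ∈ H := by
    rw [← hx₀]
    exact (mem_centralizer_inner_iff ha).mp hn₂
  have hc := mul_mem (inv_mem hb₁') hb₂'
  refine ⟨b₁⁻¹ * b₂, mul_mem (inv_mem hb₁) hb₂, fun h => ?_⟩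
  have h3 : n₁ = (b₁⁻¹ * b₂ * a) n₂ := by
    apply b₁.injective
    rw [← hz₁, hz₂, ← LinearEquiv.mul_apply b₁, mul_assoc, mul_inv_cancel_left]
    rfl
  conv_lhs => rw [← centralizer_eq_of_coeff_ne_zero H hn₁ hp₁, h3]
  conv_rhs => rw [← centralizer_eq_of_coeff_ne_zero H hn₂ hp₂]
  exact mem_centralizer_inner_iff (mul_mem hc ha)

end Conjugacy

end StrataDuality

/-! ### Centralizer classes, sheets and strata -/

namespace StrataDuality

open LieAlgebra

variable {g : Type*} [LieRing g] [LieAlgebra ℂ g] [FiniteDimensional ℂ g]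

section CentralizerClass

/-- The elements whose centralizer is conjugate to `m`. -/
def centralizerClass (m : LieSubalgebra ℂ g) : Set g :=
  {y | ∃ a ∈ innerGroup g, centralizer (a y) = m}

omit [FiniteDimensional ℂ g] in
theorem mem_centralizerClass_self (x : g) : x ∈ centralizerClass (centralizer x) :=
  ⟨1, one_mem _, rfl⟩

omit [FiniteDimensional ℂ g] in
theorem inner_mem_centralizerClass {m : LieSubalgebra ℂ g} {a : g ≃ₗ[ℂ] g} (ha : a ∈ innerGroup g)
    {x : g} (hx : x ∈ centralizerClass m) : a x ∈ centralizerClass m := by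
  obtain ⟨b, hb, h⟩ := hx
  refine ⟨b * a⁻¹, mul_mem hb (inv_mem ha), ?_⟩
  rw [← h, ← LinearEquiv.mul_apply, inv_mul_cancel_right]

omit [FiniteDimensional ℂ g] in
theorem isInnerConj_centralizer {a : g ≃ₗ[ℂ] g} (ha : a ∈ innerGroup g) (x : g) :
    IsInnerConj (centralizer x) (centralizer (a x)) :=
  ⟨a, ha, map_centralizer ha x⟩

omit [FiniteDimensional ℂ g] in
theorem IsInnerConj.symm {m₁ m₂ : LieSubalgebra ℂ g} (h : IsInnerConj m₁ m₂) :
    IsInnerConj m₂ m₁ := by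
  obtain ⟨a, ha, h⟩ := h
  refine ⟨a⁻¹, inv_mem ha, ?_⟩
  rw [← h, ← Submodule.map_comp]
  convert Submodule.map_id _
  ext x
  exact a.symm_apply_apply x

omit [FiniteDimensional ℂ g] in
theorem IsInnerConj.trans {m₁ m₂ m₃ : LieSubalgebra ℂ g} (h : IsInnerConj m₁ m₂)
    (h' : IsInnerConj m₂ m₃) : IsInnerConj m₁ m₃ := by
  obtain ⟨a, ha, h⟩ := h
  obtain ⟨b, hb, h'⟩ := h'
  refine ⟨b * a, mul_mem hb ha, ?_⟩
  rw [← h', ← h, ← Submodule.map_comp]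
  rfl

omit [FiniteDimensional ℂ g] in
theorem IsInnerConj.finrank_eq {m₁ m₂ : LieSubalgebra ℂ g} (h : IsInnerConj m₁ m₂) :
    Module.finrank ℂ m₁ = Module.finrank ℂ m₂ := by
  obtain ⟨a, -, h⟩ := h
  change Module.finrank ℂ m₁.toSubmodule = Module.finrank ℂ m₂.toSubmodule
  rw [← h]
  exact (LinearEquiv.finrank_map_eq a m₁.toSubmodule).symm

omit [FiniteDimensional ℂ g] in
theorem isInnerConj_of_mem_centralizerClass {m : LieSubalgebra ℂ g} {x : g}
    (hx : x ∈ centralizerClass m) : IsInnerConj (centralizer x) m := by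
  obtain ⟨a, ha, rfl⟩ := hx
  exact isInnerConj_centralizer ha x

omit [FiniteDimensional ℂ g] in
theorem mem_centralizerClass_iff {m : LieSubalgebra ℂ g} {x : g} :
    x ∈ centralizerClass m ↔ IsInnerConj (centralizer x) m := by
  refine ⟨isInnerConj_of_mem_centralizerClass, ?_⟩
  rintro ⟨a, ha, h⟩
  refine ⟨a, ha, LieSubalgebra.toSubmodule_injective ?_⟩
  rw [← h, map_centralizer ha]

omit [FiniteDimensional ℂ g] in
theorem IsInnerConj.centralizerClass_eq {m₁ m₂ : LieSubalgebra ℂ g} (h : IsInnerConj m₁ m₂) :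
    centralizerClass m₁ = centralizerClass m₂ := by
  ext x
  rw [mem_centralizerClass_iff, mem_centralizerClass_iff]
  exact ⟨fun h' => h'.trans h, fun h' => h'.trans h.symm⟩

/-- Near a semisimple element `x`, the elements with orbits of the same dimension have centralizers
conjugate to the one of `x`. -/
theorem IsSemisimpleElt.exists_open_centralizerClass {x : g} (hx : IsSemisimpleElt x) :
    ∃ q ∈ polynomialFunctions g, q x ≠ 0 ∧ ∀ y,
      Module.finrank ℂ (centralizer y) = Module.finrank ℂ (centralizer x) → q y ≠ 0 →
        y ∈ centralizerClass (centralizer x) := by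
  -- This coefficient is nonzero at `n = x`, since the centralizer of `x` is the generalized kernel
  -- of the square of `ad x`. Where it is nonzero and `n` commutes with `x`, the generalized kernel
  -- of `ad n * ad x` is still the centralizer of `x`; as the two operators commute, it contains the
  -- centralizer of `n`.
  have hp : (fun n : g => (ad ℂ g n * ad ℂ g x).charpoly.coeff (Module.finrank ℂ (centralizer x))) ∈
      polynomialFunctions g :=
    (isPolyMap_linear ((LinearMap.mulRight ℂ (ad ℂ g x)) ∘ₗ
      (ad ℂ g : g →ₗ[ℂ] Module.End ℂ g))).charpoly_coeff_mem _
  have hpx : (ad ℂ g x * ad ℂ g x).charpoly.coeff (Module.finrank ℂ (centralizer x)) ≠ 0 := by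
    have h1 : (ad ℂ g x * ad ℂ g x).maxGenEigenspace 0 = (centralizer x).toSubmodule := by
      refine le_antisymm (fun z hz => ?_) (fun z hz => ?_)
      · rw [Module.End.mem_maxGenEigenspace] at hz
        obtain ⟨k, hk⟩ := hz
        refine hx.lie_eq_zero_of_mem_engel ((LieSubalgebra.mem_engel_iff ℂ x z).mpr ⟨2 * k, ?_⟩)
        rw [zero_smul, sub_zero, ← pow_two, ← pow_mul] at hk
        exact hk
      · rw [Module.End.mem_maxGenEigenspace]
        refine ⟨1, ?_⟩
        rw [zero_smul, sub_zero, pow_one, Module.End.mul_apply, show ad ℂ g x z = 0 from hz,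
          map_zero]
    change Polynomial.coeff _ (Module.finrank ℂ (centralizer x).toSubmodule) ≠ 0
    rw [← h1, LinearMap.finrank_maxGenEigenspace_zero_eq]
    exact Polynomial.trailingCoeff_nonzero_iff_nonzero.mpr (LinearMap.charpoly_monic _).ne_zero
  obtain ⟨q, hq, hq0, h⟩ := exists_slice ⊤ (LieSubalgebra.mem_top x) hx hp hpx
  let ι : g →ₗ[ℂ] (⊤ : LieSubalgebra ℂ g) :=
    LinearMap.codRestrict (⊤ : LieSubalgebra ℂ g).toSubmodule LinearMap.id fun _ => trivial
  refine ⟨fun y => q (ι y), (isPolyMap_linear ι).comp_mem hq, hq0, fun y hy hqy => ?_⟩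
  obtain ⟨a, ha, n, -, hn, hpn, hya⟩ := h (ι y) hqy
  replace hya : y = a n := hya
  have ha' := expGroup_le_innerGroup _ ha
  have hle : (centralizer n).toSubmodule ≤ (centralizer x).toSubmodule := by
    have h1 : (centralizer x).toSubmodule = (ad ℂ g n * ad ℂ g x).maxGenEigenspace 0 := by
      refine Submodule.eq_of_le_of_finrank_le (fun z hz => ?_) ?_
      · rw [Module.End.mem_maxGenEigenspace]
        refine ⟨1, ?_⟩
        rw [zero_smul, sub_zero, pow_one, Module.End.mul_apply, show ad ℂ g x z = 0 from hz,
          map_zero]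
      · rw [LinearMap.finrank_maxGenEigenspace_zero_eq]
        exact Polynomial.natTrailingDegree_le_of_ne_zero hpn
    intro z hz
    rw [h1, Module.End.mem_maxGenEigenspace]
    refine ⟨1, ?_⟩
    rw [zero_smul, sub_zero, pow_one, Module.End.mul_apply, ad_apply, ad_apply, leibniz_lie,
      ← lie_skew n x, hn, neg_zero, zero_lie, show ⁅n, z⁆ = 0 from hz, lie_zero, add_zero]
  rw [hya] at hy ⊢
  refine inner_mem_centralizerClass ha' ⟨1, one_mem _, LieSubalgebra.toSubmodule_injective ?_⟩
  refine Submodule.eq_of_le_of_finrank_le hle ?_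
  change Module.finrank ℂ (centralizer x) ≤ Module.finrank ℂ (centralizer n)
  rw [← hy, ← (isInnerConj_centralizer ha' n).finrank_eq]

variable [IsKilling ℂ g]

/-- `m`, as the centralizer of a semisimple `x`, contains a Cartan subalgebra through `x`. An
element `y` with centralizer `m` commutes with that Cartan subalgebra and so belongs to it. -/
theorem IsLevi.isSemisimpleElt {m : LieSubalgebra ℂ g} (hm : IsLevi m) {y : g}
    (hy : centralizer y = m) : IsSemisimpleElt y := by
  obtain ⟨x, hx, rfl⟩ := hm
  obtain ⟨C, hC, hxC⟩ := exists_isCartanSubalgebra_mem fun z hz => hx.lie_eq_zero_of_mem_engel hz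
  refine isSemisimpleElt_of_mem_cartan C (mem_cartan_of_le_centralizer ?_)
  rw [hy]
  exact le_centralizer hxC

/-- Conjugates of two given members have centralizer `m`, and a generic point of the segment between
these still has centralizer `m`. Twisting the segment by a polynomial curve in the inner group joins
the given members themselves. -/
theorem IsLevi.isIrreducible_centralizerClass {m : LieSubalgebra ℂ g} (hm : IsLevi m) :
    @IsIrreducible g (zariskiTopology g) (centralizerClass m) := by
  refine isIrreducible_of_curves ?_ ?_
  · obtain ⟨x, -, rfl⟩ := hm
    exact ⟨x, mem_centralizerClass_self x⟩
  rintro y₁ ⟨a₁, ha₁, h₁⟩ y₂ ⟨a₂, ha₂, h₂⟩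
  have ha : a₁ * a₂⁻¹ ∈ expGroup g Set.univ := by
    rw [← innerGroup_eq_expGroup]
    exact mul_mem ha₁ (inv_mem ha₂)
  obtain ⟨A, hA0, hA1, hA, hApoly⟩ := exists_curve_of_mem_expGroup (fun _ _ _ => Set.mem_univ _) ha
  have hz : IsPolyMap fun t : ℂ => a₁ y₁ + t • (a₂ y₂ - a₁ y₁) :=
    (isPolyMap_const _).add (IsPolyMap.smul id_mem_polynomialFunctions (isPolyMap_const _))
  refine ⟨fun t => a₁.symm (A t (a₁ y₁ + t • (a₂ y₂ - a₁ y₁))),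
    (hApoly _ _ id_mem_polynomialFunctions hz).linear_comp (a₁.symm : g →ₗ[ℂ] g),
    ⟨0, ?_⟩, ⟨1, ?_⟩, _, hz.comp_mem (charpoly_coeff_ad_mem (Module.finrank ℂ m)), ⟨0, ?_⟩, ?_⟩
  · simp only [hA0, zero_smul, add_zero]
    exact a₁.symm_apply_apply y₁
  · simp only [hA1, one_smul, add_sub_cancel]
    change a₁.symm (a₁ (a₂.symm (a₂ y₂))) = y₂
    rw [LinearEquiv.symm_apply_apply, LinearEquiv.symm_apply_apply]
  · simp only [zero_smul, add_zero]
    have := (hm.isSemisimpleElt h₁).coeff_finrank_centralizer_ne_zero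
    rwa [h₁] at this
  · intro t ht
    refine inner_mem_centralizerClass (inv_mem ha₁) (inner_mem_centralizerClass
      (expGroup_le_innerGroup _ (hA t)) ⟨1, one_mem _, LieSubalgebra.toSubmodule_injective ?_⟩)
    refine (engel_eq_of_coeff_ne_zero (m := m.toSubmodule) (fun z hz => ?_) ht).1.symm
    have e₁ : ⁅a₁ y₁, z⁆ = 0 := by
      rw [← h₁] at hz
      exact hz
    have e₂ : ⁅a₂ y₂, z⁆ = 0 := by
      rw [← h₂] at hz
      exact hz
    change ⁅_, z⁆ = 0
    rw [add_lie, smul_lie, sub_lie, e₁, e₂, sub_zero, smul_zero, add_zero]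

omit [IsKilling ℂ g] in
-- The open neighbourhoods of `x` and `y` on which the centralizer class is constant meet inside the
-- irreducible set `T`.
theorem isInnerConj_of_isIrreducible {T : Set g} (hT : @IsIrreducible g (zariskiTopology g) T)
    {d : ℕ} (hTd : T ⊆ orbitDimLocus g d) {x y : g} (hx : x ∈ T) (hy : y ∈ T)
    (hxs : IsSemisimpleElt x) (hys : IsSemisimpleElt y) :
    IsInnerConj (centralizer x) (centralizer y) := by
  obtain ⟨q₁, hq₁, hq₁x, h₁⟩ := hxs.exists_open_centralizerClass
  obtain ⟨q₂, hq₂, hq₂y, h₂⟩ := hys.exists_open_centralizerClass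
  obtain ⟨z, hz, hz₁, hz₂⟩ := (isIrreducible_zariski_iff.mp hT).2 q₁ hq₁ q₂ hq₂ ⟨x, hx, hq₁x⟩
    ⟨y, hy, hq₂y⟩
  have hf : ∀ w ∈ T, Module.finrank ℂ (centralizer w) = Module.finrank ℂ g - d := fun w hw =>
    finrank_centralizer_of_mem_orbitDimLocus (hTd hw)
  exact (mem_centralizerClass_iff.mp (h₁ z ((hf z hz).trans (hf x hx).symm) hz₁)).symm.trans
    (mem_centralizerClass_iff.mp (h₂ z ((hf z hz).trans (hf y hy).symm) hz₂))

end CentralizerClass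

section Sheets

/-- The closure of `centralizerClass m` in its orbit dimension locus. -/
def sheetOf (m : LieSubalgebra ℂ g) : Set g :=
  {y | Module.finrank ℂ (centralizer y) = Module.finrank ℂ m ∧
    ∀ f ∈ polynomialFunctions g, f y ≠ 0 → ∃ z ∈ centralizerClass m, f z ≠ 0}

omit [FiniteDimensional ℂ g] in
theorem centralizerClass_subset_sheetOf (m : LieSubalgebra ℂ g) :
    centralizerClass m ⊆ sheetOf m := fun y hy =>
  ⟨(mem_centralizerClass_iff.mp hy).finrank_eq, fun _ _ hf => ⟨y, hy, hf⟩⟩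

omit [FiniteDimensional ℂ g] in
theorem IsInnerConj.sheetOf_eq {m₁ m₂ : LieSubalgebra ℂ g} (h : IsInnerConj m₁ m₂) :
    sheetOf m₁ = sheetOf m₂ := by
  unfold sheetOf
  rw [h.finrank_eq, h.centralizerClass_eq]

/-- Near `x`, the set `T` consists of members of the class of `x`, and a nonempty open subset of an
irreducible set is dense. This forces every sheet through `x` to be `sheetOf (centralizer x)`. -/
theorem subset_sheetOf {T : Set g} (hT : @IsIrreducible g (zariskiTopology g) T)
    {d : ℕ} (hTd : T ⊆ orbitDimLocus g d) {x : g} (hx : x ∈ T) (hxs : IsSemisimpleElt x) :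
    T ⊆ sheetOf (centralizer x) := by
  obtain ⟨q, hq, hqx, h⟩ := hxs.exists_open_centralizerClass
  have hf : ∀ w ∈ T, Module.finrank ℂ (centralizer w) = Module.finrank ℂ (centralizer x) :=
    fun w hw => (finrank_centralizer_of_mem_orbitDimLocus (hTd hw)).trans
      (finrank_centralizer_of_mem_orbitDimLocus (hTd hx)).symm
  refine fun y hy => ⟨hf y hy, fun f hfm hfy => ?_⟩
  obtain ⟨z, hz, hz₁, hz₂⟩ := (isIrreducible_zariski_iff.mp hT).2 q hq f hfm ⟨x, hx, hqx⟩
    ⟨y, hy, hfy⟩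
  exact ⟨z, h z (hf z hz) hz₁, hz₂⟩

variable [IsKilling ℂ g]

theorem IsLevi.isIrreducible_sheetOf {m : LieSubalgebra ℂ g} (hm : IsLevi m) :
    @IsIrreducible g (zariskiTopology g) (sheetOf m) := by
  have h := isIrreducible_zariski_iff.mp hm.isIrreducible_centralizerClass
  refine isIrreducible_zariski_iff.mpr ⟨h.1.mono (centralizerClass_subset_sheetOf m), ?_⟩
  rintro f₁ hf₁ f₂ hf₂ ⟨x, hx, hfx⟩ ⟨y, hy, hfy⟩
  obtain ⟨z, hz, h'⟩ := h.2 f₁ hf₁ f₂ hf₂ (hx.2 f₁ hf₁ hfx) (hy.2 f₂ hf₂ hfy)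
  exact ⟨z, centralizerClass_subset_sheetOf m hz, h'⟩

omit [IsKilling ℂ g] in
theorem sheetOf_subset_orbitDimLocus {d : ℕ} {x : g} (hx : x ∈ orbitDimLocus g d) :
    sheetOf (centralizer x) ⊆ orbitDimLocus g d := fun _ hy =>
  mem_orbitDimLocus_of_finrank_eq hx hy.1

omit [FiniteDimensional ℂ g] in
omit [IsKilling ℂ g] in
theorem mem_sheetOf_centralizer (x : g) : x ∈ sheetOf (centralizer x) :=
  centralizerClass_subset_sheetOf _ (mem_centralizerClass_self x)

theorem IsLevi.isDixmierSheet_sheetOf {m : LieSubalgebra ℂ g} (hm : IsLevi m) :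
    IsDixmierSheet (sheetOf m) := by
  have hirr := hm.isIrreducible_sheetOf
  obtain ⟨x, hx, rfl⟩ := hm
  refine ⟨⟨_, ⟨hirr, sheetOf_subset_orbitDimLocus (x := x) rfl⟩, ?_⟩,
    x, mem_sheetOf_centralizer x, hx⟩
  rintro T ⟨hT, hTd⟩ hle
  exact subset_sheetOf hT hTd (hle (mem_sheetOf_centralizer x)) hx

theorem IsSheet.eq_sheetOf {S : Set g} (hS : IsSheet S) {x : g} (hx : x ∈ S)
    (hxs : IsSemisimpleElt x) : S = sheetOf (centralizer x) := by
  obtain ⟨d, ⟨hirr, hSd⟩, hmax⟩ := hS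
  have hle := subset_sheetOf hirr hSd hx hxs
  exact Set.Subset.antisymm hle (hmax ⟨IsLevi.isIrreducible_sheetOf ⟨x, hxs, rfl⟩,
    sheetOf_subset_orbitDimLocus (hSd hx)⟩ hle)

omit [IsKilling ℂ g] in
theorem IsSheet.isInnerConj {S : Set g} (hS : IsSheet S) {x y : g} (hx : x ∈ S) (hy : y ∈ S)
    (hxs : IsSemisimpleElt x) (hys : IsSemisimpleElt y) :
    IsInnerConj (centralizer x) (centralizer y) := by
  obtain ⟨d, ⟨hirr, hSd⟩, -⟩ := hS
  exact isInnerConj_of_isIrreducible hirr hSd hx hy hxs hys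

end Sheets

section Strata

omit [FiniteDimensional ℂ g] in
theorem mem_adjointOrbit_self (x : g) : x ∈ adjointOrbit x := ⟨1, one_mem _, rfl⟩

omit [FiniteDimensional ℂ g] in
theorem isInnerConj_of_mem_adjointOrbit {O : SemisimpleOrbit g} {x y : g} (hx : x ∈ O.1)
    (hy : y ∈ O.1) : IsInnerConj (centralizer x) (centralizer y) := by
  obtain ⟨O, z, _, rfl⟩ := O
  obtain ⟨a, ha, rfl⟩ := hx
  obtain ⟨b, hb, rfl⟩ := hy
  exact (isInnerConj_centralizer ha z).symm.trans (isInnerConj_centralizer hb z)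

omit [FiniteDimensional ℂ g] in
theorem SemisimpleOrbit.exists_mem (O : SemisimpleOrbit g) : ∃ x ∈ O.1, IsSemisimpleElt x := by
  obtain ⟨O, z, hz, rfl⟩ := O
  exact ⟨z, mem_adjointOrbit_self z, hz⟩

omit [FiniteDimensional ℂ g] in
theorem SemisimpleOrbit.inner_mem (O : SemisimpleOrbit g) {x : g} (hx : x ∈ O.1) {a : g ≃ₗ[ℂ] g}
    (ha : a ∈ innerGroup g) : a x ∈ O.1 := by
  obtain ⟨O, z, hz, rfl⟩ := O
  obtain ⟨b, hb, rfl⟩ := hx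
  exact ⟨a * b, mul_mem ha hb, rfl⟩

omit [FiniteDimensional ℂ g] in
theorem SemisimpleOrbit.subset_centralizerClass (O : SemisimpleOrbit g) {m : LieSubalgebra ℂ g}
    (h : ∃ x ∈ O.1, centralizer x = m) : O.1 ⊆ centralizerClass m := by
  obtain ⟨x, hx, rfl⟩ := h
  exact fun y hy => mem_centralizerClass_iff.mpr (isInnerConj_of_mem_adjointOrbit hy hx)

variable [IsKilling ℂ g]

/-- A sheet may contain elements that are not semisimple, but its semisimple elements all have
conjugate centralizers; conversely `sheetOf m` contains the whole class of `m`. -/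
theorem IsLevi.vacuaInSheet_sheetOf {m : LieSubalgebra ℂ g} (hm : IsLevi m) :
    vacuaInSheet (sheetOf m) = vacuaWithUnbroken m := by
  ext v
  refine ⟨fun hv i => ?_, fun hv i =>
    ((v.1 i).subset_centralizerClass (hv i)).trans (centralizerClass_subset_sheetOf m)⟩
  obtain ⟨x, hx, hxs⟩ := (v.1 i).exists_mem
  have hS := hm.isDixmierSheet_sheetOf.1
  obtain ⟨y, hy, rfl⟩ := hm
  obtain ⟨a, ha, h⟩ := mem_centralizerClass_iff.mpr
    (hS.isInnerConj (hv i hx) (mem_sheetOf_centralizer y) hxs hy)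
  exact ⟨a x, (v.1 i).inner_mem hx ha, h⟩

theorem IsDixmierSheet.exists_eq_sheetOf {S : Set g} (hS : IsDixmierSheet S) :
    ∃ m, IsLevi m ∧ S = sheetOf m := by
  obtain ⟨hS, x, hx, hxs⟩ := hS
  exact ⟨_, ⟨x, hxs, rfl⟩, hS.eq_sheetOf hx hxs⟩

theorem IsLevi.vacuaWithUnbroken_nonempty {m : LieSubalgebra ℂ g} (hm : IsLevi m) :
    (vacuaWithUnbroken m).Nonempty := by
  have hS := hm.isDixmierSheet_sheetOf.1
  obtain ⟨x, hx, rfl⟩ := hm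
  let O : SemisimpleOrbit g := ⟨adjointOrbit x, x, hx, rfl⟩
  have hO : ∃ y ∈ O.1, centralizer y = centralizer x := ⟨x, mem_adjointOrbit_self x, rfl⟩
  exact ⟨⟨fun _ => O, _, hS, fun _ =>
    (O.subset_centralizerClass hO).trans (centralizerClass_subset_sheetOf _)⟩, fun _ => hO⟩

omit [FiniteDimensional ℂ g] in
omit [IsKilling ℂ g] in
theorem isInnerConj_of_mem_vacuaWithUnbroken {m₁ m₂ : LieSubalgebra ℂ g} {v : AlignedVacuum g}
    (h₁ : v ∈ vacuaWithUnbroken m₁) (h₂ : v ∈ vacuaWithUnbroken m₂) : IsInnerConj m₁ m₂ := by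
  obtain ⟨x, hx, rfl⟩ := h₁ 0
  obtain ⟨y, hy, rfl⟩ := h₂ 0
  exact isInnerConj_of_mem_adjointOrbit hx hy

theorem vacuaWithUnbroken_eq_iff {m₁ m₂ : LieSubalgebra ℂ g} (hm₁ : IsLevi m₁) (hm₂ : IsLevi m₂) :
    vacuaWithUnbroken m₁ = vacuaWithUnbroken m₂ ↔ IsInnerConj m₁ m₂ := by
  refine ⟨fun h => ?_, fun h => ?_⟩
  · obtain ⟨v, hv⟩ := hm₁.vacuaWithUnbroken_nonempty
    exact isInnerConj_of_mem_vacuaWithUnbroken hv (h ▸ hv)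
  · rw [← hm₁.vacuaInSheet_sheetOf, ← hm₂.vacuaInSheet_sheetOf, h.sheetOf_eq]

theorem stratum_eq_iff (m₁ m₂ : Levi g) : stratum m₁ = stratum m₂ ↔ IsInnerConj m₁.1 m₂.1 :=
  Subtype.ext_iff.trans (vacuaWithUnbroken_eq_iff m₁.2 m₂.2)

theorem isPartition_strata : Setoid.IsPartition (strata g) := by
  refine ⟨?_, fun v => ?_⟩
  · rintro ⟨m, hm, h⟩
    exact hm.vacuaWithUnbroken_nonempty.ne_empty h.symm
  · obtain ⟨S, hS, hv⟩ := v.2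
    obtain ⟨x, hx, hxs⟩ := (v.1 0).exists_mem
    have hm : IsLevi (centralizer x) := ⟨x, hxs, rfl⟩
    have hv' : v ∈ vacuaWithUnbroken (centralizer x) := by
      rw [← hm.vacuaInSheet_sheetOf, ← hS.eq_sheetOf (hv 0 hx) hxs]
      exact hv
    refine ⟨vacuaWithUnbroken (centralizer x), ⟨⟨_, hm, rfl⟩, hv'⟩, ?_⟩
    rintro _ ⟨⟨m', hm', rfl⟩, hv''⟩
    exact (vacuaWithUnbroken_eq_iff hm' hm).mpr (isInnerConj_of_mem_vacuaWithUnbroken hv'' hv')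

theorem bijOn_vacuaInSheet :
    Set.BijOn vacuaInSheet {S : Set g | IsDixmierSheet S} (strata g) := by
  refine ⟨fun S hS => ?_, fun S₁ hS₁ S₂ hS₂ h => ?_, ?_⟩
  · obtain ⟨m, hm, rfl⟩ := IsDixmierSheet.exists_eq_sheetOf hS
    exact ⟨m, hm, hm.vacuaInSheet_sheetOf⟩
  · obtain ⟨m₁, hm₁, rfl⟩ := IsDixmierSheet.exists_eq_sheetOf hS₁
    obtain ⟨m₂, hm₂, rfl⟩ := IsDixmierSheet.exists_eq_sheetOf hS₂
    rw [hm₁.vacuaInSheet_sheetOf, hm₂.vacuaInSheet_sheetOf, vacuaWithUnbroken_eq_iff hm₁ hm₂] at h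
    exact h.sheetOf_eq
  · rintro _ ⟨m, hm, rfl⟩
    exact ⟨sheetOf m, hm.isDixmierSheet_sheetOf, hm.vacuaInSheet_sheetOf⟩

theorem IsDixmierSheet.vacuaInSheet_eq_iff {S : Set g} (hS : IsDixmierSheet S) (m : Levi g) :
    vacuaInSheet S = (stratum m).1 ↔ ∃ x ∈ S, IsSemisimpleElt x ∧ centralizer x = m.1 := by
  refine ⟨fun h => ?_, ?_⟩
  · obtain ⟨m₀, hm₀, rfl⟩ := hS.exists_eq_sheetOf
    obtain ⟨m, hm⟩ := m
    rw [hm₀.vacuaInSheet_sheetOf] at h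
    have hconj : IsInnerConj m₀ m := (vacuaWithUnbroken_eq_iff hm₀ hm).mp h
    obtain ⟨x, hx, rfl⟩ := hm
    refine ⟨x, ?_, hx, rfl⟩
    rw [hconj.sheetOf_eq]
    exact mem_sheetOf_centralizer x
  · rintro ⟨x, hx, hxs, h⟩
    obtain ⟨m, hm⟩ := m
    change centralizer x = m at h
    subst h
    rw [hS.1.eq_sheetOf hx hxs, IsLevi.vacuaInSheet_sheetOf hm]
    rfl

end Strata

end StrataDuality

/-! ### The Weyl group as permutations of roots, and its lifts to inner automorphisms -/

namespace StrataDuality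

open LieAlgebra

section WeylPerm

variable {ι R M N : Type*} [CommRing R] [AddCommGroup M] [Module R M] [AddCommGroup N] [Module R N]

/-- The Weyl group, as a group of permutations of the roots. -/
def weylPerm (P : RootPairing ι R M N) : Subgroup (Equiv.Perm ι) :=
  Subgroup.closure (Set.range P.reflectionPerm)

theorem reflectionPerm_mem_weylPerm (P : RootPairing ι R M N) (i : ι) :
    P.reflectionPerm i ∈ weylPerm P :=
  Subgroup.subset_closure ⟨i, rfl⟩

theorem exists_linearEquiv_of_mem_weylPerm {P : RootPairing ι R M N} {w : Equiv.Perm ι}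
    (hw : w ∈ weylPerm P) : ∃ T : M ≃ₗ[R] M, ∀ i, P.root (w i) = T (P.root i) := by
  induction hw using Subgroup.closure_induction with
  | mem w hw =>
    obtain ⟨j, rfl⟩ := hw
    exact ⟨P.reflection j, fun i => P.root_reflectionPerm j i⟩
  | one => exact ⟨LinearEquiv.refl R M, fun i => rfl⟩
  | mul w w' _ _ h h' =>
    obtain ⟨T, hT⟩ := h
    obtain ⟨T', hT'⟩ := h'
    exact ⟨T'.trans T, fun i => by
      rw [Equiv.Perm.mul_apply, hT, hT', LinearEquiv.trans_apply]⟩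
  | inv w _ h =>
    obtain ⟨T, hT⟩ := h
    refine ⟨T.symm, fun i => ?_⟩
    exact (LinearEquiv.eq_symm_apply T).mpr ((hT _).symm.trans (congrArg _ (w.apply_symm_apply i)))

/-- Every functional is moved into the dominant chamber by the Weyl group. -/
theorem exists_mem_weylPerm_forall_nonneg [Finite ι] [IsDomain R] [CharZero R]
    {P : RootPairing ι R M N} [P.IsCrystallographic] [P.IsReduced] (b : P.Base)
    {S : Type*} [AddCommGroup S] [LinearOrder S] [IsOrderedAddMonoid S] (f : M →+ S) :
    ∃ w ∈ weylPerm P, ∀ i ∈ b.support, 0 ≤ f (P.root (w i)) := by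
  classical
  let _ := Fintype.ofFinite ι
  let pos : Finset ι := Finset.univ.filter b.IsPos
  -- At a maximum `w` of this sum, replacing `w` by `w * P.reflectionPerm i` cannot increase it. A
  -- simple reflection permutes the positive roots other than its own, so only the term of `i`
  -- changes, by its sign; hence that term is nonnegative.
  let F : Equiv.Perm ι → S := fun w => ∑ j ∈ pos, f (P.root (w j))
  obtain ⟨⟨w, hw⟩, hmax⟩ := Finite.exists_max fun w : weylPerm P => F w
  refine ⟨w, hw, fun i hi => ?_⟩
  have hipos : i ∈ pos := Finset.mem_filter.mpr ⟨Finset.mem_univ _, b.isPos_of_mem_support hi⟩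
  obtain ⟨T, hT⟩ := exists_linearEquiv_of_mem_weylPerm hw
  have h1 : f (P.root (w (P.reflectionPerm i i))) = -f (P.root (w i)) := by
    rw [hT, hT, P.root_reflectionPerm, P.reflection_apply_self, map_neg, map_neg]
  have hmem : ∀ j ∈ pos.erase i, P.reflectionPerm i j ∈ pos.erase i := by
    intro j hj
    obtain ⟨hji, hj⟩ := Finset.mem_erase.mp hj
    have hj' : b.IsPos j := (Finset.mem_filter.mp hj).2
    refine Finset.mem_erase.mpr ⟨fun h => ?_,
      Finset.mem_filter.mpr ⟨Finset.mem_univ _, hj'.reflectionPerm hi hji⟩⟩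
    have h2 : j = P.reflectionPerm i i := by
      exact (P.reflectionPerm_self i j).symm.trans (congrArg _ h)
    have h3 := RootPairing.Base.height_reflectionPerm_self b i
    have h4 : b.height j = -b.height i := by
      rw [h2]
      exact h3
    have h5 : 0 < b.height i := b.isPos_of_mem_support hi
    have h6 : 0 < b.height j := hj'
    omega
  have h2 : ∑ j ∈ pos.erase i, f (P.root (w (P.reflectionPerm i j))) =
      ∑ j ∈ pos.erase i, f (P.root (w j)) :=
    Finset.sum_bij' (fun j _ => P.reflectionPerm i j) (fun j _ => P.reflectionPerm i j)
      hmem hmem (fun j _ => P.reflectionPerm_self i j) (fun j _ => P.reflectionPerm_self i j)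
      fun _ _ => rfl
  have h3 := hmax ⟨w * P.reflectionPerm i, mul_mem hw (reflectionPerm_mem_weylPerm P i)⟩
  change ∑ j ∈ pos, f (P.root (w (P.reflectionPerm i j))) ≤ ∑ j ∈ pos, f (P.root (w j)) at h3
  rw [← Finset.add_sum_erase _ _ hipos, ← Finset.add_sum_erase _ _ hipos, h1, h2,
    add_le_add_iff_right] at h3
  exact neg_le_self_iff.mp h3

end WeylPerm

variable {g : Type*} [LieRing g] [LieAlgebra ℂ g] [FiniteDimensional ℂ g] [IsKilling ℂ g]
  {H : LieSubalgebra ℂ g} [H.IsCartanSubalgebra]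

section Lift

omit [FiniteDimensional ℂ g] [IsKilling ℂ g] in
theorem mem_rootSpace_of_lie {χ : H → ℂ} {v : g} (h : ∀ x : H, ⁅(x : g), v⁆ = χ x • v) :
    v ∈ rootSpace H χ :=
  LieModule.weightSpace_le_genWeightSpace g χ ((LieModule.mem_weightSpace χ v).mpr h)

/-- Reflections are induced by inner automorphisms. -/
theorem exists_reflection (α : H.root) :
    ∃ a ∈ expGroup g ((rootSpace H (α.1 : H → ℂ) : Set g) ∪ (rootSpace H (-(α.1 : H → ℂ)) : Set g)),
      ∀ x : H, a x = ((x - α.1 x • IsKilling.coroot α.1 : H) : g) := by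
  have hα : α.1.IsNonZero := H.isNonZero_coe_root α
  obtain ⟨h, e, f, ht, he, hf⟩ := IsKilling.exists_isSl2Triple_of_weight_isNonZero hα
  have hh := ht.h_eq_coroot hα he hf
  have hhs : IsSemisimpleElt h := by
    rw [hh]
    exact isSemisimpleElt_of_mem_cartan H (IsKilling.coroot α.1).2
  have hhe : ⁅h, e⁆ = (2 : ℂ) • e := ht.lie_h_e_smul ℂ
  have hhf : ⁅h, f⁆ = -((2 : ℂ) • f) := ht.lie_lie_smul_f ℂ
  obtain ⟨n, hn⟩ := isNilpotent_ad_of_eigenvector hhs two_ne_zero hhe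
  obtain ⟨m, hm⟩ := isNilpotent_ad_of_eigenvector (e := -f) hhs (neg_ne_zero.mpr two_ne_zero)
    (by rw [lie_neg, hhf, neg_smul, smul_neg])
  have hE := expAd_mem_expGroup (E := (rootSpace H (α.1 : H → ℂ) : Set g) ∪
    (rootSpace H (-(α.1 : H → ℂ)) : Set g)) (Or.inl he) hn
  have hF := expAd_mem_expGroup (E := (rootSpace H (α.1 : H → ℂ) : Set g) ∪
    (rootSpace H (-(α.1 : H → ℂ)) : Set g)) (Or.inr (neg_mem hf)) hm
  -- The witness is the standard `exp(e) exp(-f) exp(e)` of an `sl₂`-triple. On `H` and on `e` the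
  -- exponential series needed here stop after the quadratic term.
  refine ⟨_, mul_mem (mul_mem hE hF) hE, fun x => ?_⟩
  have hex : ⁅e, (x : g)⁆ = -(α.1 x • e) := by
    rw [← lie_skew, lie_weight_vector he x.2]
  have hfx : ⁅f, (x : g)⁆ = α.1 x • f := by
    rw [← lie_skew, lie_weight_vector hf x.2, Pi.neg_apply, neg_smul, neg_neg]
  have heh : ⁅e, h⁆ = -((2 : ℂ) • e) := by rw [← lie_skew, hhe]
  have hfh : ⁅f, h⁆ = (2 : ℂ) • f := by rw [← lie_skew, hhf, neg_neg]
  have hfe : ⁅f, e⁆ = -h := by rw [← lie_skew, ht.lie_e_f]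
  have eE : ∀ y : g, ∀ c : ℂ, ⁅e, y⁆ = c • e → expAd e hn y = y + c • e := by
    intro y c hy
    rw [expAd_apply_of_lie_lie_lie_eq_zero hn] <;> simp [hy]
  have eFx : expAd (-f) hm (x : g) = x - α.1 x • f := by
    rw [expAd_apply_of_lie_lie_lie_eq_zero hm] <;> simp [hfx, sub_eq_add_neg]
  have eFe : expAd (-f) hm e = e + h - f := by
    rw [expAd_apply_of_lie_lie_lie_eq_zero hm] <;> simp [hfe, hfh, sub_eq_add_neg]
  change expAd e hn (expAd (-f) hm (expAd e hn x)) = _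
  rw [eE x (-α.1 x) (by rw [hex, neg_smul]), map_add, map_smul, eFx, eFe]
  have h1 : (x : g) - α.1 x • f + -α.1 x • (e + h - f) = x - α.1 x • h - α.1 x • e := by module
  rw [h1, eE _ (α.1 x) ?_]
  · change _ = (x : g) - α.1 x • (IsKilling.coroot α.1 : g)
    rw [← hh]
    module
  · rw [lie_sub, lie_sub, lie_smul, lie_smul, hex, heh, lie_self]
    module

variable (H) in
/-- The automorphism `a` preserves `H` and acts on it as the permutation `w` of the roots. -/
def IsLift (a : g ≃ₗ[ℂ] g) (w : Equiv.Perm H.root) : Prop :=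
  ∀ x : H, ∃ y : H, a x = y ∧ ∀ α : H.root, (w α).1 y = α.1 x

omit [IsKilling ℂ g] in
theorem IsLift.mul {a b : g ≃ₗ[ℂ] g} {w w' : Equiv.Perm H.root} (h : IsLift H a w)
    (h' : IsLift H b w') : IsLift H (a * b) (w * w') := by
  intro x
  obtain ⟨y, hy, hxy⟩ := h' x
  obtain ⟨z, hz, hyz⟩ := h y
  exact ⟨z, by rw [LinearEquiv.mul_apply, hy, hz], fun α => (hyz _).trans (hxy α)⟩

omit [IsKilling ℂ g] in
theorem IsLift.exists_apply_eq {a : g ≃ₗ[ℂ] g} {w : Equiv.Perm H.root} (h : IsLift H a w) (y : H) :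
    ∃ x : H, a x = y := by
  have h1 : H.toSubmodule.map (a : g →ₗ[ℂ] g) = H.toSubmodule := by
    refine Submodule.eq_of_le_of_finrank_eq ?_ (LinearEquiv.finrank_map_eq a _)
    rintro _ ⟨x, hx, rfl⟩
    obtain ⟨y, hy, -⟩ := h ⟨x, hx⟩
    change a x ∈ H
    rw [show a x = y from hy]
    exact y.2
  have h2 : (y : g) ∈ H.toSubmodule.map (a : g →ₗ[ℂ] g) := by
    rw [h1]
    exact y.2
  obtain ⟨x, hx, hxy⟩ := h2
  exact ⟨⟨x, hx⟩, hxy⟩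

omit [IsKilling ℂ g] in
theorem IsLift.inv {a : g ≃ₗ[ℂ] g} {w : Equiv.Perm H.root} (h : IsLift H a w) :
    IsLift H a⁻¹ w⁻¹ := by
  intro y
  obtain ⟨x, hx⟩ := h.exists_apply_eq y
  refine ⟨x, ?_, fun α => ?_⟩
  · rw [← hx]
    exact a.symm_apply_apply _
  · obtain ⟨y', hy', hα⟩ := h x
    obtain rfl : y' = y := Subtype.ext (hy'.symm.trans hx)
    exact (hα _).symm.trans (by rw [show w (w⁻¹ α) = α from w.apply_symm_apply α])

theorem isLift_reflection (α : H.root) {a : g ≃ₗ[ℂ] g}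
    (ha : ∀ x : H, a x = ((x - α.1 x • IsKilling.coroot α.1 : H) : g)) :
    IsLift H a ((IsKilling.rootSystem H).reflectionPerm α) := by
  refine fun x => ⟨_, ha x, fun β => ?_⟩
  have h1 := LinearMap.congr_fun ((IsKilling.rootSystem H).root_reflectionPerm α β)
    (x - α.1 x • IsKilling.coroot α.1)
  refine h1.trans ?_
  rw [RootPairing.reflection_apply, map_sub, map_smul]
  change β.1 x - β.1 (IsKilling.coroot α.1) * α.1 x - α.1 x * (β.1 (IsKilling.coroot α.1) -
    β.1 (IsKilling.coroot α.1) * α.1 (IsKilling.coroot α.1)) = β.1 x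
  rw [IsKilling.root_apply_coroot (H.isNonZero_coe_root α)]
  ring

theorem exists_isLift {w : Equiv.Perm H.root} (hw : w ∈ weylPerm (IsKilling.rootSystem H)) :
    ∃ a ∈ innerGroup g, IsLift H a w := by
  induction hw using Subgroup.closure_induction with
  | mem w hw =>
    obtain ⟨α, rfl⟩ := hw
    obtain ⟨a, ha, h⟩ := exists_reflection α
    exact ⟨a, expGroup_le_innerGroup _ ha, isLift_reflection α h⟩
  | one => exact ⟨1, one_mem _, fun x => ⟨x, rfl, fun _ => rfl⟩⟩
  | mul w w' _ _ h h' =>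
    obtain ⟨a, ha, h⟩ := h
    obtain ⟨b, hb, h'⟩ := h'
    exact ⟨a * b, mul_mem ha hb, h.mul h'⟩
  | inv w _ h =>
    obtain ⟨a, ha, h⟩ := h
    exact ⟨a⁻¹, inv_mem ha, h.inv⟩

theorem IsLift.leviRoots_eq {a : g ≃ₗ[ℂ] g} {w : Equiv.Perm H.root} (h : IsLift H a w) (x : H) :
    leviRoots H (centralizer (a x)) = w '' leviRoots H (centralizer (x : g)) := by
  obtain ⟨y, hy, hα⟩ := h x
  rw [hy]
  ext β
  obtain ⟨β, rfl⟩ := w.surjective β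
  rw [w.injective.mem_set_image, mem_leviRoots_centralizer y.2, mem_leviRoots_centralizer x.2,
    Subtype.coe_eta, Subtype.coe_eta, hα]

theorem IsLift.map_mem_rootSpace {a : g ≃ₗ[ℂ] g} (ha : a ∈ innerGroup g) {w : Equiv.Perm H.root}
    (h : IsLift H a w) {α : H.root} {v : g} :
    (v ∈ rootSpace H (α.1 : H → ℂ) → a v ∈ rootSpace H ((w α).1 : H → ℂ)) ∧
      (v ∈ rootSpace H (-(α.1 : H → ℂ)) → a v ∈ rootSpace H (-((w α).1 : H → ℂ))) := by
  constructor <;>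
  · intro hv
    refine mem_rootSpace_of_lie fun y => ?_
    obtain ⟨x, hx⟩ := h.exists_apply_eq y
    obtain ⟨y', hy', hα⟩ := h x
    obtain rfl : y' = y := Subtype.ext (hy'.symm.trans hx)
    rw [← hx, ← innerGroup_map_lie ha, lie_weight_vector hv x.2, map_smul, Subtype.coe_eta]
    simp only [Pi.neg_apply, hα]

end Lift

end StrataDuality

/-! ### Lexicographic dominance, polynomial linear algebra and standard Levi subalgebras -/

namespace StrataDuality

open LieAlgebra

section Preliminaries

/-- The complex numbers with their lexicographic order. -/
noncomputable def toLexAddHom : ℂ →+ Lex (ℝ × ℝ) where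
  toFun z := toLex (z.re, z.im)
  map_zero' := rfl
  map_add' _ _ := rfl

theorem toLexAddHom_eq_zero_iff {z : ℂ} : toLexAddHom z = 0 ↔ z = 0 := by
  refine ⟨fun h => ?_, fun h => by rw [h, map_zero]⟩
  have h' : (z.re, z.im) = (0, 0) := toLex.injective h
  exact Complex.ext (Prod.ext_iff.mp h').1 (Prod.ext_iff.mp h').2

theorem toLexAddHom_intCast_pos {k : ℤ} (hk : 0 < k) : 0 < toLexAddHom (k : ℂ) := by
  refine Prod.Lex.toLex_lt_toLex.mpr (Or.inl ?_)
  simpa using hk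

theorem Matrix.charpoly_eq_of_blockTriangular {n : Type*} [Fintype n] [DecidableEq n]
    {R : Type*} [CommRing R] {k : n → ℤ} {M N : Matrix n n R}
    (hM : M.BlockTriangular k) (hN : N.BlockTriangular k)
    (h : ∀ i j, k i = k j → M i j = N i j) : M.charpoly = N.charpoly := by
  rw [hM.charpoly, hN.charpoly]
  refine Finset.prod_congr rfl fun a _ => congrArg _ ?_
  ext i j
  exact h _ _ (i.2.trans j.2.symm)

/-- If no `f i` vanished identically, neither would their product. It serves to single out one
eigenvalue that is valid along a whole curve. -/
theorem exists_forall_eq_zero {ι : Type*} [Finite ι] {f : ι → ℂ → ℂ}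
    (hf : ∀ i, f i ∈ polynomialFunctions ℂ) (h : ∀ t, ∃ i, f i t = 0) : ∃ i, ∀ t, f i t = 0 := by
  classical
  let _ := Fintype.ofFinite ι
  by_contra! hne
  have key : ∀ s : Finset ι, ∃ t, ∏ i ∈ s, f i t ≠ 0 := by
    intro s
    induction s using Finset.induction_on with
    | empty => exact ⟨0, by simp⟩
    | insert i s hi ih =>
      have hs : (fun t => ∏ i ∈ s, f i t) ∈ polynomialFunctions ℂ := by
        have : (fun t => ∏ i ∈ s, f i t) = ∏ i ∈ s, f i := by
          ext t
          rw [Finset.prod_apply]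
        rw [this]
        exact prod_mem fun i _ => hf i
      obtain ⟨t, h₁, h₂⟩ := exists_ne_zero_mul (hf i) hs (hne i) ih
      exact ⟨t, by rw [Finset.prod_insert hi]; exact mul_ne_zero h₁ h₂⟩
  obtain ⟨t, ht⟩ := key Finset.univ
  obtain ⟨i, hi⟩ := h t
  exact ht (Finset.prod_eq_zero (Finset.mem_univ i) hi)

/-- Cramer's rule for matrices with polynomial entries. -/
theorem exists_polynomial_mulVec_eq {n : Type*} [Fintype n] [DecidableEq n]
    {K : ℂ → Matrix n n ℂ} (hK : ∀ i j, (fun t => K t i j) ∈ polynomialFunctions ℂ)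
    {v : ℂ → n → ℂ} (hv : ∀ i, (fun t => v t i) ∈ polynomialFunctions ℂ) :
    (fun t => (K t).det) ∈ polynomialFunctions ℂ ∧ ∃ u : ℂ → n → ℂ,
      (∀ i, (fun t => u t i) ∈ polynomialFunctions ℂ) ∧
        ∀ t, (K t).mulVec (u t) = (K t).det • v t := by
  let K' : Matrix n n (polynomialFunctions ℂ) := Matrix.of fun i j => ⟨_, hK i j⟩
  let v' : n → polynomialFunctions ℂ := fun i => ⟨_, hv i⟩
  let ev : ℂ → (polynomialFunctions ℂ →+* ℂ) := fun t =>
    (Pi.evalRingHom (fun _ : ℂ => ℂ) t).comp (polynomialFunctions ℂ).val.toRingHom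
  have hdet : ∀ t, ev t K'.det = (K t).det := fun t => (ev t).map_det K'
  refine ⟨?_, fun t i => (K'.adjugate.mulVec v' i).1 t, fun i => (K'.adjugate.mulVec v' i).2,
    fun t => ?_⟩
  · convert (K'.det).2 using 1
    ext t
    exact (hdet t).symm
  · have h1 : K'.mulVec (K'.adjugate.mulVec v') = K'.det • v' := by
      rw [Matrix.mulVec_mulVec, Matrix.mul_adjugate, Matrix.smul_mulVec, Matrix.one_mulVec]
    ext i
    have h2 := congrArg (ev t) (congrFun h1 i)
    rw [Pi.smul_apply, smul_eq_mul, map_mul, hdet] at h2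
    rw [Matrix.mulVec, dotProduct, map_sum] at h2
    simp only [map_mul] at h2
    exact h2

end Preliminaries

variable {g : Type*} [LieRing g] [LieAlgebra ℂ g] [FiniteDimensional ℂ g] [IsKilling ℂ g]
  {H : LieSubalgebra ℂ g} [H.IsCartanSubalgebra]

section StandardLevi

theorem coe_reflectionPerm_self (α : H.root) :
    (((IsKilling.rootSystem H).reflectionPerm α α).1 : H → ℂ) = -(α.1 : H → ℂ) := by
  ext x
  have h := LinearMap.congr_fun ((IsKilling.rootSystem H).root_reflectionPerm α α) x
  rw [RootPairing.reflection_apply_self] at h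
  exact h

theorem root_apply_nonneg_of_isPos {b : (IsKilling.rootSystem H).Base} {y : H}
    (hy : ∀ i ∈ b.support, 0 ≤ toLexAddHom (i.1 y)) {α : H.root} (hα : b.IsPos α) :
    0 ≤ toLexAddHom (α.1 y) := by
  refine hα.induction_on_add (p := fun α : H.root => 0 ≤ toLexAddHom (α.1 y)) hy ?_
  intro i j k hk hi hj
  have h : k.1 y = i.1 y + j.1 y := LinearMap.congr_fun hk y
  rw [h, map_add]
  exact add_nonneg hi (hy j hj)

omit [IsKilling ℂ g] in
theorem le_standardLevi (J : Set H.root) : H ≤ standardLevi H J := fun _ hx =>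
  LieSubalgebra.subset_lieSpan (Or.inl hx)

omit [IsKilling ℂ g] in
theorem rootSpace_le_standardLevi {J : Set H.root} {α : H.root} (hα : α ∈ J) :
    ((rootSpace H (α.1 : H → ℂ) : Set g) ∪ (rootSpace H (-(α.1 : H → ℂ)) : Set g)) ⊆
      standardLevi H J := fun _ hx =>
  LieSubalgebra.subset_lieSpan (Or.inr (Set.mem_biUnion hα hx))

theorem standardLevi_le_centralizer {J : Set H.root} {y : H} (h : ∀ α ∈ J, α.1 y = 0) :
    standardLevi H J ≤ centralizer (y : g) := by
  refine LieSubalgebra.lieSpan_le.mpr (Set.union_subset (le_centralizer y.2) ?_)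
  refine Set.iUnion₂_subset fun α hα => ?_
  rintro v (hv | hv)
  · change ⁅(y : g), v⁆ = 0
    rw [lie_weight_vector hv y.2, Subtype.coe_eta, h α hα, zero_smul]
  · change ⁅(y : g), v⁆ = 0
    rw [lie_weight_vector hv y.2, Subtype.coe_eta, Pi.neg_apply, h α hα, neg_zero, zero_smul]

/-- The centralizer of a dominant element is generated by `H` and the root spaces of the simple
roots that vanish on it and of their opposites. -/
theorem standardLevi_eq_centralizer (b : (IsKilling.rootSystem H).Base) {y : H}
    (hy : ∀ i ∈ b.support, 0 ≤ toLexAddHom (i.1 y)) :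
    standardLevi H {i | i ∈ b.support ∧ i.1 y = 0} = centralizer (y : g) := by
  set J : Set H.root := {i | i ∈ b.support ∧ i.1 y = 0}
  refine le_antisymm ?_ (centralizer_le_of_leviRoots_subset y.2 (le_standardLevi J) ?_)
  · exact standardLevi_le_centralizer fun α hα => hα.2
  -- Induction on height. Some simple `j` pairs positively with `α`, so its reflection `β` of `α` is
  -- a lower positive root unless `α = j`. At `y` the value of `β` is a negative multiple of that of
  -- `j`, while both are nonnegative by dominance; so both vanish and `j ∈ J`. The automorphism
  -- lifting the reflection then preserves `standardLevi H J` and carries the root spaces of `α` and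
  -- `-α` to those of `β` and `-β`.
  have key : ∀ (n : ℕ) (α : H.root), b.IsPos α → (b.height α).toNat = n → α.1 y = 0 →
      (∀ v ∈ rootSpace H (α.1 : H → ℂ), v ∈ standardLevi H J) ∧
        ∀ v ∈ rootSpace H (-(α.1 : H → ℂ)), v ∈ standardLevi H J := by
    intro n
    induction n using Nat.strong_induction_on with
    | _ n ih =>
    intro α hα hn hαy
    obtain ⟨j, hj, hjα⟩ := hα.exists_mem_support_pos_pairingIn
    rw [RootPairing.zero_lt_pairingIn_iff'] at hjα
    by_cases hne : α = j
    · subst hne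
      have h := rootSpace_le_standardLevi (J := J) (α := α) ⟨hj, hαy⟩
      exact ⟨fun v hv => h (Or.inl hv), fun v hv => h (Or.inr hv)⟩
    set β := (IsKilling.rootSystem H).reflectionPerm j α with hβ
    have hβpos : b.IsPos β := hα.reflectionPerm hj hne
    set c := (IsKilling.rootSystem H).pairingIn ℤ α j
    have hroot : (IsKilling.rootSystem H).root β =
        (IsKilling.rootSystem H).root α + (-c) • (IsKilling.rootSystem H).root j := by
      rw [hβ, RootPairing.root_reflectionPerm, neg_smul, RootPairing.reflection_apply_root' ℤ,
        sub_eq_add_neg]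
    have hheight : b.height β = b.height α - c := by
      rw [b.height_add_zsmul hroot, RootPairing.Base.height_one_of_mem_support hj]
      simp [sub_eq_add_neg]
    have hval : β.1 y = -c • j.1 y := by
      have h := LinearMap.congr_fun hroot y
      rw [LinearMap.add_apply, LinearMap.smul_apply] at h
      refine h.trans ?_
      rw [show (IsKilling.rootSystem H).root α y = 0 from hαy, zero_add]
      rfl
    have h₁ := root_apply_nonneg_of_isPos hy hβpos
    have h₂ := hy j hj
    have hj0 : j.1 y = 0 := by
      rw [hval, neg_smul, map_neg, map_zsmul, neg_nonneg] at h₁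
      refine toLexAddHom_eq_zero_iff.mp (le_antisymm ?_ h₂)
      by_contra! h₃
      exact absurd h₁ (not_le.mpr (zsmul_pos h₃ hjα))
    have hβ0 : β.1 y = 0 := by rw [hval, hj0, smul_zero]
    have hβh : 0 < b.height β := hβpos
    have ih' := ih (b.height β).toNat (by omega) β hβpos rfl hβ0
    obtain ⟨a, ha, hax⟩ := exists_reflection j
    have ha' : a ∈ expGroup g (standardLevi H J : Set g) :=
      expGroup_mono (rootSpace_le_standardLevi (J := J) (α := j) ⟨hj, hj0⟩) ha
    have hmap := fun v => (isLift_reflection j hax).map_mem_rootSpace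
      (expGroup_le_innerGroup _ ha) (α := α) (v := v)
    exact ⟨fun v hv => (expGroup_apply_mem_iff ha').mp (ih'.1 _ ((hmap v).1 hv)),
      fun v hv => (expGroup_apply_mem_iff ha').mp (ih'.2 _ ((hmap v).2 hv))⟩
  intro α hα v hv
  have hαy : α.1 y = 0 := (mem_leviRoots_centralizer y.2 α).mp hα
  rcases RootPairing.Base.IsPos.or_neg b α with h | h
  · exact (key _ α h rfl hαy).1 v hv
  · have hneg := coe_reflectionPerm_self α
    refine (key _ ((IsKilling.rootSystem H).reflectionPerm α α) h rfl ?_).2 v ?_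
    · rw [hneg, Pi.neg_apply, hαy, neg_zero]
    · rw [hneg, neg_neg]
      exact hv

end StandardLevi

end StrataDuality

/-! ### Inner automorphisms that preserve the Cartan subalgebra -/

namespace StrataDuality

open LieAlgebra

section Graded

variable {g : Type*} [LieRing g] [LieAlgebra ℂ g] {n : ℕ} {b : Module.Basis (Fin n) ℂ g}
  {k : Fin n → ℤ}

/-- For a graded basis, the characteristic polynomial of `ad y` with `y` in nonnegative degrees
depends only on the component of degree zero. -/
theorem charpoly_ad_eq (hk : ∀ i l j, b.repr ⁅b l, b j⁆ i ≠ 0 → k i = k l + k j) {y y₀ : g}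
    (hy : ∀ l, k l < 0 → b.repr y l = 0)
    (hy₀ : ∀ l, b.repr y₀ l = if k l = 0 then b.repr y l else 0) [FiniteDimensional ℂ g] :
    (ad ℂ g y).charpoly = (ad ℂ g y₀).charpoly := by
  have hent : ∀ (x : g) (i j : Fin n), LinearMap.toMatrix b b (ad ℂ g x) i j =
      ∑ l, b.repr x l * b.repr ⁅b l, b j⁆ i := by
    intro x i j
    rw [LinearMap.toMatrix_apply, ad_apply]
    conv_lhs => rw [← b.sum_repr x, sum_lie]
    simp
  have hz : ∀ (x : g), (∀ l, k l < 0 → b.repr x l = 0) →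
      ∀ i j, k i < k j → LinearMap.toMatrix b b (ad ℂ g x) i j = 0 := by
    intro x hx i j hij
    rw [hent]
    refine Finset.sum_eq_zero fun l _ => ?_
    by_cases h : b.repr ⁅b l, b j⁆ i = 0
    · rw [h, mul_zero]
    · have := hk i l j h
      rw [hx l (by omega), zero_mul]
  rw [← LinearMap.charpoly_toMatrix _ b, ← LinearMap.charpoly_toMatrix _ b]
  -- An element in nonnegative degrees does not lower degrees; the sign adapts this to the
  -- convention of `BlockTriangular`. The diagonal blocks involve only its component of degree zero.
  refine Matrix.charpoly_eq_of_blockTriangular (k := fun i => -k i) (fun i j hij => ?_)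
    (fun i j hij => ?_) fun i j hij => ?_
  · exact hz y hy i j (by simpa using hij)
  · refine hz y₀ (fun l hl => ?_) i j (by simpa using hij)
    rw [hy₀, if_neg hl.ne]
  · rw [hent, hent]
    refine Finset.sum_congr rfl fun l _ => ?_
    by_cases h : b.repr ⁅b l, b j⁆ i = 0
    · rw [h, mul_zero, mul_zero]
    · have := hk i l j h
      rw [hy₀, if_pos (by omega)]

end Graded

variable {g : Type*} [LieRing g] [LieAlgebra ℂ g] [FiniteDimensional ℂ g] [IsKilling ℂ g]
  {H : LieSubalgebra ℂ g} [H.IsCartanSubalgebra]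

theorem repr_lie_of_mem_cartan {n : ℕ} {b : Module.Basis (Fin n) ℂ g}
    {χ : Fin n → LieModule.Weight ℂ H g} (hb : ∀ i, b i ∈ rootSpace H (χ i)) (x : H) (v : g)
    (i : Fin n) : b.repr ⁅(x : g), v⁆ i = χ i x * b.repr v i := by
  have h : b.coord i ∘ₗ ad ℂ g (x : g) = χ i x • b.coord i := by
    refine b.ext fun j => ?_
    rw [LinearMap.comp_apply, ad_apply, lie_weight_vector (hb j) x.2, map_smul,
      LinearMap.smul_apply, Subtype.coe_eta, b.coord_apply, b.repr_self, smul_eq_mul, smul_eq_mul]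
    by_cases hij : j = i
    · rw [hij]
    · rw [Finsupp.single_eq_of_ne (Ne.symm hij), mul_zero, mul_zero]
  exact LinearMap.congr_fun h v

theorem exists_graded_basis (B : (IsKilling.rootSystem H).Base) :
    ∃ (ρ : H) (n : ℕ) (b : Module.Basis (Fin n) ℂ g) (χ : Fin n → LieModule.Weight ℂ H g)
      (k : Fin n → ℤ), (∀ i, b i ∈ rootSpace H (χ i)) ∧ (∀ i, χ i ρ = k i) ∧
      (∀ i, k i = 0 → (χ i).IsZero) ∧
      (∀ i, (χ i).IsZero ∨ ∃ α : H.root, α.1 = χ i ∧ k i = B.height α) ∧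
      ∀ i l j, b.repr ⁅b l, b j⁆ i ≠ 0 → k i = k l + k j := by
  obtain ⟨ρ, hρ⟩ := exists_height_element B
  obtain ⟨n, b, χ, hb⟩ := exists_weight_basis H
  have hk : ∀ i, ∃ k : ℤ, χ i ρ = k ∧ (k = 0 → (χ i).IsZero) ∧
      ((χ i).IsZero ∨ ∃ α : H.root, α.1 = χ i ∧ k = B.height α) := by
    intro i
    by_cases hi : (χ i).IsZero
    · exact ⟨0, by rw [hi.eq]; simp, fun _ => hi, Or.inl hi⟩
    · let α : H.root := ⟨χ i, by simpa [LieSubalgebra.root] using hi⟩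
      exact ⟨B.height α, hρ α, fun h => absurd h (B.height_ne_zero α), Or.inr ⟨α, rfl, rfl⟩⟩
  choose k hk hk0 hk' using hk
  refine ⟨ρ, n, b, χ, k, hb, hk, hk0, hk', fun i l j hij => ?_⟩
  have h1 := repr_lie_of_mem_cartan hb ρ ⁅b l, b j⁆ i
  rw [leibniz_lie, lie_weight_vector (hb l) ρ.2, lie_weight_vector (hb j) ρ.2, smul_lie, lie_smul,
    Subtype.coe_eta, ← add_smul, map_smul, Finsupp.smul_apply, smul_eq_mul, hk, hk, hk] at h1
  exact_mod_cast (mul_right_cancel₀ hij h1).symm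

/-- An inner automorphism that preserves `H` and maps the height element to a dominant element
acts trivially on `H`. -/
theorem apply_eq_self_of_dominant (B : (IsKilling.rootSystem H).Base) {a : g ≃ₗ[ℂ] g}
    (ha : a ∈ innerGroup g) (haH : ∀ x ∈ H, a x ∈ H) {ρ : H}
    (hρ : ∀ α : H.root, α.1 ρ = B.height α)
    (hdom : ∀ i ∈ B.support, 0 ≤ toLexAddHom (i.1 ⟨a ρ, haH _ ρ.2⟩)) (x : H) : a x = x := by
  obtain ⟨ρ', n, b, χ, k, hb, hk, hk0, hk', hgr⟩ := exists_graded_basis B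
  have hbH : ∀ l, k l = 0 → b l ∈ H := fun l hl => mem_cartan_of_isZero (hk0 l hl) (hb l)
  have hH : ∀ y ∈ H, ∀ l, k l ≠ 0 → b.repr y l = 0 := by
    intro y hy l hl
    have h := repr_lie_of_mem_cartan hb ρ' y l
    rw [cartan_lie_eq_zero H ρ'.2 hy, map_zero, Finsupp.zero_apply, hk] at h
    exact (mul_eq_zero.mp h.symm).resolve_left (by exact_mod_cast hl)
  -- `a (b i)` is an eigenvector of `ad (a ρ)` with the positive eigenvalue `k i`. By dominance,
  -- weights of nonpositive degree take values at most zero on `a ρ`, so they do not occur in it.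
  have hpos : ∀ i, 0 < k i → ∀ j, ¬ 0 < k j → b.repr (a (b i)) j = 0 := by
    intro i hi j hj
    obtain ⟨α, hα, hkα⟩ : ∃ α : H.root, α.1 = χ i ∧ k i = B.height α := by
      refine (hk' i).resolve_left fun h0 => ?_
      have h1 := hk i
      rw [h0.eq] at h1
      rw [Pi.zero_apply] at h1
      have h2 : k i = 0 := by exact_mod_cast h1.symm
      omega
    have h1 := repr_lie_of_mem_cartan hb ⟨a ρ, haH _ ρ.2⟩ (a (b i)) j
    rw [← innerGroup_map_lie ha, lie_weight_vector (hb i) ρ.2, map_smul, map_smul,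
      Finsupp.smul_apply, smul_eq_mul, Subtype.coe_eta, ← hα, hρ, ← hkα] at h1
    by_contra h0
    have h2 := mul_right_cancel₀ h0 h1
    have h3 : 0 < toLexAddHom (k i : ℂ) := toLexAddHom_intCast_pos hi
    rcases hk' j with hz | ⟨β, hβ, hkβ⟩
    · rw [hz.eq, Pi.zero_apply] at h2
      have h4 : k i = 0 := by exact_mod_cast h2
      omega
    · have hneg : B.IsPos ((IsKilling.rootSystem H).reflectionPerm β β) :=
        (RootPairing.Base.IsPos.or_neg B β).resolve_left fun h => hj (hkβ ▸ h)
      have h4 := root_apply_nonneg_of_isPos hdom hneg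
      rw [coe_reflectionPerm_self, Pi.neg_apply, hβ, ← h2, map_neg, neg_nonneg] at h4
      exact absurd h4 (not_le.mpr h3)
  -- Join `a` to the identity by `A t`, and let `K t` be the block of `A t` on positive degrees.
  -- Cramer's rule subtracts from `(K t).det • x` a positive part such that `A t` of the result `y
  -- t` has no positive part. By triangularity at both ends, the `H`-component of `A t (y t)` has
  -- the same characteristic polynomial as `(K t).det • x`, so `α` takes on it one of finitely many
  -- values `(K t).det * χ i x`.
  have hval : ∀ α : H.root, α.1 ⟨a x, haH _ x.2⟩ = α.1 x := by
    intro α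
    obtain ⟨A, hA0, hA1, hA, hApoly⟩ := exists_curve_of_mem_expGroup
      (E := Set.univ) (fun _ _ _ => Set.mem_univ _) (innerGroup_eq_expGroup (g := g) ▸ ha)
    let I := {i : Fin n // 0 < k i}
    let K : ℂ → Matrix I I ℂ := fun t => Matrix.of fun j i => b.repr (A t (b i)) j
    let v : ℂ → I → ℂ := fun t j => b.repr (A t x) j
    have hcurve : ∀ y : g, IsPolyMap fun t => A t y := fun y =>
      hApoly _ _ id_mem_polynomialFunctions (isPolyMap_const y)
    obtain ⟨hD, u, hu, hKu⟩ := exists_polynomial_mulVec_eq (K := K) (v := v)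
      (fun j i => hcurve _ (b.coord j)) (fun j => hcurve _ (b.coord j))
    let y : ℂ → g := fun t => (K t).det • (x : g) - ∑ i : I, u t i • b i
    have hypoly : IsPolyMap y := (IsPolyMap.smul hD (isPolyMap_const _)).sub
      (IsPolyMap.sum _ fun i _ => IsPolyMap.smul (hu i) (isPolyMap_const _))
    have hzpoly : IsPolyMap fun t => A t (y t) := hApoly _ _ id_mem_polynomialFunctions hypoly
    let Pr : g →ₗ[ℂ] H := b.constr ℂ fun l => if h : k l = 0 then ⟨b l, hbH l h⟩ else 0
    have hPr : ∀ (z : g) (l : Fin n), b.repr (Pr z : g) l = if k l = 0 then b.repr z l else 0 := by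
      intro z l
      have h : b.coord l ∘ₗ H.toSubmodule.subtype ∘ₗ Pr = if k l = 0 then b.coord l else 0 := by
        refine b.ext fun j => ?_
        have h1 : Pr (b j) = if h : k j = 0 then ⟨b j, hbH j h⟩ else 0 := b.constr_basis ℂ _ j
        rw [LinearMap.comp_apply, LinearMap.comp_apply, h1]
        by_cases hj : k j = 0
        · rw [dif_pos hj]
          change b.coord l (b j) = _
          by_cases hl : k l = 0
          · rw [if_pos hl]
          · rw [if_neg hl]
            exact hH _ (hbH j hj) l hl
        · rw [dif_neg hj, map_zero, map_zero]
          by_cases hl : k l = 0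
          · rw [if_pos hl, b.coord_apply, b.repr_self, Finsupp.single_eq_of_ne]
            rintro rfl
            exact hj hl
          · rw [if_neg hl]
            rfl
      have h2 := LinearMap.congr_fun h z
      by_cases hl : k l = 0
      · rw [if_pos hl] at h2 ⊢
        exact h2
      · rw [if_neg hl] at h2 ⊢
        exact h2
    have hPrH : ∀ z : H, Pr z = z := by
      intro z
      refine Subtype.ext (b.repr.injective (Finsupp.ext fun l => ?_))
      rw [hPr]
      by_cases hl : k l = 0
      · rw [if_pos hl]
      · rw [if_neg hl, hH z z.2 l hl]
    have hz0 : ∀ t (j : I), b.repr (A t (y t)) j = 0 := by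
      intro t j
      have h1 := congrFun (hKu t) j
      simp only [y, map_sub, map_smul, map_sum, Finsupp.sub_apply, Finsupp.smul_apply,
        Finsupp.finsetSum_apply, smul_eq_mul]
      rw [sub_eq_zero]
      refine h1.symm.trans ?_
      rw [Matrix.mulVec, dotProduct]
      exact Finset.sum_congr rfl fun i _ => mul_comm _ _
    have hyc : ∀ t l, ¬ 0 < k l → b.repr (y t) l = (K t).det * b.repr (x : g) l := by
      intro t l hl
      simp only [y, map_sub, map_smul, map_sum, Finsupp.sub_apply, Finsupp.smul_apply,
        Finsupp.finsetSum_apply, smul_eq_mul]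
      rw [Finset.sum_eq_zero, sub_zero]
      intro i _
      rw [b.repr_self, Finsupp.single_eq_of_ne, mul_zero]
      rintro rfl
      exact hl i.2
    have hchar : ∀ t, (ad ℂ g (Pr (A t (y t)) : g)).charpoly =
        (ad ℂ g ((K t).det • (x : g))).charpoly := by
      intro t
      rw [← charpoly_ad_eq (b := b) (k := fun l => -k l) (y := A t (y t))
        (fun i l j h => by rw [hgr i l j h]; ring)
        (fun l hl => hz0 t ⟨l, by simpa using hl⟩) (fun l => by rw [hPr]; simp),
        ad_inner_apply (expGroup_le_innerGroup _ (hA t)), LinearEquiv.charpoly_conj]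
      refine charpoly_ad_eq (b := b) (k := k) hgr (fun l hl => ?_) fun l => ?_
      · rw [hyc t l hl.not_gt, hH _ x.2 l hl.ne, mul_zero]
      · rw [map_smul, Finsupp.smul_apply, smul_eq_mul]
        by_cases hl : k l = 0
        · rw [if_pos hl, hyc t l (by omega)]
        · rw [if_neg hl, hH _ x.2 l hl, mul_zero]
    have hroot : ∀ t, ∃ i, α.1 (Pr (A t (y t))) - (K t).det * χ i x = 0 := by
      intro t
      obtain ⟨w, hw, hw0⟩ := α.1.exists_ne_zero
      have h1 : (ad ℂ g (Pr (A t (y t)) : g)).HasEigenvalue (α.1 (Pr (A t (y t)))) := by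
        refine Module.End.hasEigenvalue_of_hasEigenvector (x := w) ⟨?_, hw0⟩
        rw [Module.End.mem_eigenspace_iff, ad_apply, lie_weight_vector hw (Subtype.prop _)]
      rw [Module.End.hasEigenvalue_iff_isRoot_charpoly, hchar,
        ← Module.End.hasEigenvalue_iff_isRoot_charpoly] at h1
      obtain ⟨w', hw', hw0'⟩ := h1.exists_hasEigenvector
      rw [Module.End.mem_eigenspace_iff, ad_apply, smul_lie] at hw'
      obtain ⟨i, hi⟩ : ∃ i, b.repr w' i ≠ 0 := by
        by_contra! h
        exact hw0' (b.repr.injective (Finsupp.ext fun i => by rw [h i, map_zero]; rfl))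
      refine ⟨i, ?_⟩
      have h2 := congrArg (fun z => b.repr z i) hw'
      simp only [map_smul, Finsupp.smul_apply, smul_eq_mul, repr_lie_of_mem_cartan hb x] at h2
      rw [← mul_assoc] at h2
      rw [mul_right_cancel₀ hi h2, sub_self]
    -- A single index `i` works for all `t`, and comparing `t = 0` with `t = 1` then gives the
    -- claim.
    obtain ⟨i, hi⟩ := exists_forall_eq_zero
      (f := fun i t => α.1 (Pr (A t (y t))) - (K t).det * χ i x) (fun i => sub_mem
        (hzpoly (α.1.toLinear ∘ₗ Pr)) (mul_mem hD (const_mem_polynomialFunctions _))) hroot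
    have hu0 : ∀ t, (K t).det ≠ 0 → v t = 0 → u t = 0 := by
      intro t ht hvt
      have h1 := hKu t
      rw [hvt, smul_zero] at h1
      exact Matrix.eq_zero_of_mulVec_eq_zero ht h1
    have hat : ∀ t, (K t).det ≠ 0 → (h : A t x ∈ H) → α.1 ⟨A t x, h⟩ = χ i x := by
      intro t ht h
      have h1 := hu0 t ht (funext fun j => hH _ h j j.2.ne')
      have h2 : A t (y t) = (((K t).det • ⟨A t x, h⟩ : H) : g) := by
        simp only [y, h1, Pi.zero_apply, zero_smul, Finset.sum_const_zero, sub_zero, map_smul]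
        rfl
      have h3 := hi t
      rw [h2, hPrH, ← LieModule.Weight.toLinear_apply, map_smul, smul_eq_mul, ← mul_sub] at h3
      exact sub_eq_zero.mp ((mul_eq_zero.mp h3).resolve_left ht)
    have hK0 : K 0 = 1 := by
      ext j l
      change b.repr (A 0 (b l)) j = _
      rw [hA0, Matrix.one_apply]
      change b.repr (b l) j = _
      rw [b.repr_self, Finsupp.single_apply]
      exact if_congr (by rw [Subtype.ext_iff, eq_comm]) rfl rfl
    -- By `hpos`, `a` maps the positive part into itself, and it is injective.
    have hK1 : (K 1).det ≠ 0 := by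
      intro h
      obtain ⟨c, hc, hKc⟩ := Matrix.exists_mulVec_eq_zero_iff.mpr h
      have h1 : a (∑ l : I, c l • b l) = 0 := by
        refine b.repr.injective (Finsupp.ext fun j => ?_)
        simp only [map_sum, map_smul, Finsupp.finsetSum_apply, Finsupp.smul_apply, smul_eq_mul,
          map_zero, Finsupp.zero_apply]
        by_cases hj : 0 < k j
        · refine Eq.trans ?_ (congrFun hKc ⟨j, hj⟩)
          rw [Matrix.mulVec, dotProduct]
          refine Finset.sum_congr rfl fun l _ => ?_
          rw [mul_comm, ← hA1]
          rfl
        · exact Finset.sum_eq_zero fun l _ => by rw [hpos l l.2 j hj, mul_zero]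
      rw [LinearEquiv.map_eq_zero_iff] at h1
      refine hc (funext fun l => ?_)
      have hli : LinearIndependent ℂ fun l : I => b l :=
        b.linearIndependent.comp _ Subtype.val_injective
      exact Fintype.linearIndependent_iff.mp hli c h1 l
    have e0 := hat 0 (by rw [hK0, Matrix.det_one]; exact one_ne_zero)
      (by rw [hA0]; exact x.2)
    have e1 := hat 1 hK1 (by rw [hA1]; exact haH _ x.2)
    simp only [hA0, hA1] at e0 e1
    exact e1.trans e0.symm
  have h1 : (⟨a x, haH _ x.2⟩ : H) = x := by
    rw [← sub_eq_zero, ← Submodule.mem_bot ℂ, ← IsKilling.iInf_ker_weight_eq_bot,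
      Submodule.mem_iInf]
    intro γ
    by_cases hγ : γ.IsZero
    · rw [LinearMap.mem_ker, LieModule.Weight.toLinear_apply, hγ.eq]
      rfl
    · rw [LinearMap.mem_ker, map_sub, sub_eq_zero]
      exact hval ⟨γ, by simpa [LieSubalgebra.root] using hγ⟩
  exact congrArg Subtype.val h1

/-- Inner automorphisms that preserve `H` act on it through the Weyl group. -/
theorem exists_isLift_of_map_cartan {a : g ≃ₗ[ℂ] g} (ha : a ∈ innerGroup g)
    (haH : ∀ x ∈ H, a x ∈ H) : ∃ w ∈ weylPerm (IsKilling.rootSystem H), IsLift H a w := by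
  obtain ⟨B⟩ : Nonempty (IsKilling.rootSystem H).Base := RootPairing.nonempty_base _
  obtain ⟨ρ, hρ⟩ := exists_height_element B
  let f : Module.Dual ℂ H →+ Lex (ℝ × ℝ) :=
    toLexAddHom.comp (LinearMap.applyₗ (⟨a ρ, haH _ ρ.2⟩ : H)).toAddMonoidHom
  -- A lift `c` of `w⁻¹` makes the image of the height element dominant. Then `c * a` fixes `H`
  -- pointwise, so on `H` the automorphism `a` agrees with the lift `c⁻¹` of `w`.
  obtain ⟨w, hw, hdom⟩ := exists_mem_weylPerm_forall_nonneg B f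
  obtain ⟨c, hc, hlift⟩ := exists_isLift (inv_mem hw)
  have hcaH : ∀ x ∈ H, (c * a) x ∈ H := by
    intro x hx
    obtain ⟨y, hy, -⟩ := hlift ⟨a x, haH x hx⟩
    rw [LinearEquiv.mul_apply, hy]
    exact y.2
  have hid := apply_eq_self_of_dominant B (mul_mem hc ha) hcaH hρ (by
    intro i hi
    obtain ⟨y, hy, hα⟩ := hlift ⟨a ρ, haH _ ρ.2⟩
    have h1 : (⟨(c * a) ρ, hcaH _ ρ.2⟩ : H) = y := Subtype.ext hy
    have h2 := hα (w i)
    rw [show w⁻¹ (w i) = i from w.symm_apply_apply i] at h2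
    rw [h1, h2]
    exact hdom i hi)
  refine ⟨w, hw, fun x => ?_⟩
  have h1 := hlift.inv x
  rw [inv_inv] at h1
  obtain ⟨y, hy, hα⟩ := h1
  refine ⟨y, ?_, hα⟩
  rw [← hy]
  apply c.injective
  exact (hid x).trans (c.apply_symm_apply _).symm

end StrataDuality

/-! ### Transport of Weyl groups and bases along equivalences of root pairings -/

namespace StrataDuality

open LieAlgebra

section RootPairingEquiv

variable {ι ι' R M N M' N' : Type*} [CommRing R] [AddCommGroup M] [Module R M] [AddCommGroup N]
  [Module R N] [AddCommGroup M'] [Module R M'] [AddCommGroup N'] [Module R N']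
  {P : RootPairing ι R M N} {Q : RootPairing ι' R M' N'}

/-- The weight and coweight maps of `e` are transposes of each other, so `e` preserves the pairing
numbers in the reflection formula. -/
theorem indexEquiv_reflectionPerm (e : RootPairing.Equiv P Q) (i j : ι) :
    e.indexEquiv (P.reflectionPerm i j) =
      Q.reflectionPerm (e.indexEquiv i) (e.indexEquiv j) := by
  have hpair : Q.toLinearMap (e.weightMap (P.root j)) (Q.coroot (e.indexEquiv i)) =
      P.toLinearMap (P.root j) (P.coroot i) := by
    have h1 := LinearMap.congr_fun (RootPairing.Hom.weight_coweight_transpose_apply P Q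
      (Q.coroot (e.indexEquiv i)) e.toHom) (P.root j)
    rw [RootPairing.Hom.coroot_coweightMap_apply, Equiv.symm_apply_apply] at h1
    exact h1
  apply Q.root.injective
  rw [← RootPairing.Hom.root_weightMap_apply, ← P.reflectionPerm_root, ← Q.reflectionPerm_root,
    map_sub, map_smul, RootPairing.Hom.root_weightMap_apply, RootPairing.Hom.root_weightMap_apply,
    ← hpair, RootPairing.Hom.root_weightMap_apply]

theorem exists_mem_weylPerm_conj (e : RootPairing.Equiv P Q) {w : Equiv.Perm ι}
    (hw : w ∈ weylPerm P) :
    ∃ w' ∈ weylPerm Q, ∀ i, w' (e.indexEquiv i) = e.indexEquiv (w i) := by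
  induction hw using Subgroup.closure_induction with
  | mem w hw =>
    obtain ⟨i, rfl⟩ := hw
    exact ⟨_, reflectionPerm_mem_weylPerm Q (e.indexEquiv i),
      fun j => (indexEquiv_reflectionPerm e i j).symm⟩
  | one => exact ⟨1, one_mem _, fun _ => rfl⟩
  | mul w₁ w₂ _ _ h₁ h₂ =>
    obtain ⟨w₁', hw₁', h₁⟩ := h₁
    obtain ⟨w₂', hw₂', h₂⟩ := h₂
    exact ⟨w₁' * w₂', mul_mem hw₁' hw₂', fun i => by
      rw [Equiv.Perm.mul_apply, Equiv.Perm.mul_apply, h₂, h₁]⟩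
  | inv w _ h =>
    obtain ⟨w', hw', h⟩ := h
    refine ⟨w'⁻¹, inv_mem hw', fun i => w'.symm_apply_eq.mpr ?_⟩
    rw [h, show w (w⁻¹ i) = i from w.apply_symm_apply i]

/-- Weyl conjugacy of sets of roots is invariant under equivalences of root pairings. -/
theorem exists_weylPerm_image_iff (e : RootPairing.Equiv P Q) {A B : Set ι} :
    (∃ w ∈ weylPerm P, w '' A = B) ↔
      ∃ w ∈ weylPerm Q, w '' (e.indexEquiv '' A) = e.indexEquiv '' B := by
  constructor
  · rintro ⟨w, hw, rfl⟩
    obtain ⟨w', hw', h⟩ := exists_mem_weylPerm_conj e hw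
    refine ⟨w', hw', ?_⟩
    rw [Set.image_image, Set.image_image]
    simp only [h]
  · rintro ⟨w, hw, h⟩
    obtain ⟨w', hw', h'⟩ := exists_mem_weylPerm_conj (RootPairing.Equiv.symm P Q e) hw
    refine ⟨w', hw', e.indexEquiv.injective.image_injective ?_⟩
    rw [← h, Set.image_image, Set.image_image]
    refine Set.image_congr fun i _ => ?_
    have h1 : w' i = e.indexEquiv.symm (w (e.indexEquiv i)) := by
      refine Eq.trans ?_ (h' (e.indexEquiv i))
      exact congrArg w' (e.indexEquiv.symm_apply_apply i).symm
    rw [h1, Equiv.apply_symm_apply]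

theorem mem_closure_image_or_neg_mem {A A' : Type*} [AddCommGroup A] [AddCommGroup A']
    (φ : A →+ A') {σ : ι → ι'} {r : ι → A} {r' : ι' → A'} (hr : ∀ i, r' (σ i) = φ (r i))
    {s : Set ι} {i : ι}
    (hi : r i ∈ AddSubmonoid.closure (r '' s) ∨ -r i ∈ AddSubmonoid.closure (r '' s)) :
    r' (σ i) ∈ AddSubmonoid.closure (r' '' (σ '' s)) ∨
      -r' (σ i) ∈ AddSubmonoid.closure (r' '' (σ '' s)) := by
  have h1 : r' '' (σ '' s) = φ '' (r '' s) := by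
    rw [Set.image_image, Set.image_image]
    simp only [hr]
  rw [h1, ← AddMonoidHom.map_mclosure φ, hr, ← map_neg]
  exact hi.imp (fun h => ⟨_, h, rfl⟩) fun h => ⟨_, h, rfl⟩

/-- Bases are transported along equivalences of root pairings. -/
theorem exists_base_of_equiv (e : RootPairing.Equiv P Q) (b : P.Base) :
    ∃ b' : Q.Base, (b'.support : Set ι') = e.indexEquiv '' (b.support : Set ι) := by
  have hroot : ∀ i, Q.root (e.indexEquiv i) = e.weightMap (P.root i) := fun i =>
    (RootPairing.Hom.root_weightMap_apply P Q i e.toHom).symm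
  let f : N →ₗ[R] N' := (RootPairing.Equiv.coweightEquiv P Q e).symm
  have hf : Function.Injective f := (RootPairing.Equiv.coweightEquiv P Q e).symm.injective
  have hcoroot : ∀ i, Q.coroot (e.indexEquiv i) = f (P.coroot i) := fun i => by
    refine ((LinearEquiv.symm_apply_eq _).mpr ?_).symm
    rw [RootPairing.Equiv.coweightEquiv_apply, RootPairing.Hom.coroot_coweightMap_apply,
      Equiv.symm_apply_apply]
  have hcoe : ((b.support.map e.indexEquiv.toEmbedding : Finset ι') : Set ι') =
      e.indexEquiv '' b.support := by
    rw [Finset.coe_map]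
    rfl
  refine ⟨⟨b.support.map e.indexEquiv.toEmbedding, ?_, ?_, fun i => ?_, fun i => ?_⟩, hcoe⟩
  · rw [hcoe]
    refine LinearIndepOn.image_of_comp _ _ ?_
    rw [show (Q.root ∘ e.indexEquiv : ι → M') = e.weightMap ∘ P.root from funext hroot]
    exact b.linearIndepOn_root.map_injOn _ e.bijective_weightMap.injective.injOn
  · rw [hcoe]
    refine LinearIndepOn.image_of_comp _ _ ?_
    rw [show (Q.coroot ∘ e.indexEquiv : ι → N') = f ∘ P.coroot from funext hcoroot]
    exact b.linearIndepOn_coroot.map_injOn _ hf.injOn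
  · obtain ⟨i, rfl⟩ := e.indexEquiv.surjective i
    rw [hcoe]
    exact mem_closure_image_or_neg_mem e.weightMap.toAddMonoidHom hroot (b.root_mem_or_neg_mem i)
  · obtain ⟨i, rfl⟩ := e.indexEquiv.surjective i
    rw [hcoe]
    exact mem_closure_image_or_neg_mem f.toAddMonoidHom hcoroot (b.coroot_mem_or_neg_mem i)

end RootPairingEquiv

/-! ### Conjugacy of Levi subalgebras through the Weyl group -/

section LeviConjugacy

variable {g : Type*} [LieRing g] [LieAlgebra ℂ g] [FiniteDimensional ℂ g] [IsKilling ℂ g]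
  {H : LieSubalgebra ℂ g} [H.IsCartanSubalgebra]

omit [FiniteDimensional ℂ g] [IsKilling ℂ g] in
theorem IsLevi.exists_eq_centralizer {m : LieSubalgebra ℂ g} (hm : IsLevi m) (hH : H ≤ m) :
    ∃ x : H, m = centralizer (x : g) := by
  obtain ⟨x, -, rfl⟩ := hm
  exact ⟨⟨x, mem_cartan_of_le_centralizer hH⟩, rfl⟩

theorem isLevi_centralizer_cartan (x : H) : IsLevi (centralizer (x : g)) :=
  ⟨x, isSemisimpleElt_of_mem_cartan H x.2, rfl⟩

theorem IsLevi.eq_of_leviRoots_eq {m₁ m₂ : LieSubalgebra ℂ g} (h₁ : IsLevi m₁) (h₂ : IsLevi m₂)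
    (hm₁ : H ≤ m₁) (hm₂ : H ≤ m₂) (h : leviRoots H m₁ = leviRoots H m₂) : m₁ = m₂ :=
  le_antisymm ((levi_le_iff h₁ hm₁ hm₂).mpr h.le) ((levi_le_iff h₂ hm₂ hm₁).mpr h.ge)

/-- Levi subalgebras containing `H` are conjugate if and only if the Weyl group conjugates their
sets of roots. -/
theorem isInnerConj_iff_exists_weylPerm {m₁ m₂ : LieSubalgebra ℂ g} (h₁ : IsLevi m₁)
    (h₂ : IsLevi m₂) (hm₁ : H ≤ m₁) (hm₂ : H ≤ m₂) :
    IsInnerConj m₁ m₂ ↔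
      ∃ w ∈ weylPerm (IsKilling.rootSystem H), w '' leviRoots H m₁ = leviRoots H m₂ := by
  obtain ⟨x, rfl⟩ := h₁.exists_eq_centralizer hm₁
  constructor
  · rintro ⟨a, ha, h⟩
    have hax : centralizer (a x) = m₂ :=
      LieSubalgebra.toSubmodule_injective ((map_centralizer ha x).symm.trans h)
    have haH : ∀ y ∈ H, a y ∈ m₂ := fun y hy => by
      rw [← LieSubalgebra.mem_toSubmodule, ← h]
      exact ⟨y, hm₁ hy, rfl⟩
    -- Both `H` and its image under `a` lie in `m₂`. The element `c` returns the image to `H`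
    -- without moving `m₂`, so `c * a` preserves `H` and still maps the first subalgebra to `m₂`.
    obtain ⟨c, hc, hcH⟩ := exists_expGroup_map_cartan H hm₂ ha haH
    have hca := mul_mem (expGroup_le_innerGroup _ hc) ha
    obtain ⟨w, hw, hlift⟩ := exists_isLift_of_map_cartan hca fun y hy => (hcH y).mpr hy
    refine ⟨w, hw, ?_⟩
    rw [← hlift.leviRoots_eq]
    congr 1
    refine LieSubalgebra.toSubmodule_injective ?_
    rw [LinearEquiv.mul_apply, ← map_centralizer (expGroup_le_innerGroup _ hc), hax]
    ext z
    obtain ⟨z, rfl⟩ := c.surjective z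
    rw [LieSubalgebra.mem_toSubmodule, expGroup_apply_mem_iff hc]
    constructor
    · rintro ⟨z', hz', h'⟩
      exact c.injective h' ▸ hz'
    · exact fun hz => ⟨z, hz, rfl⟩
  · rintro ⟨w, hw, h⟩
    obtain ⟨a, ha, hlift⟩ := exists_isLift hw
    obtain ⟨y, hy, -⟩ := hlift x
    have hay : H ≤ centralizer (a x) := by
      rw [hy]
      exact le_centralizer y.2
    refine ⟨a, ha, ?_⟩
    rw [map_centralizer ha]
    congr 1
    refine IsLevi.eq_of_leviRoots_eq (H := H) ?_ h₂ hay hm₂ ?_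
    · rw [hy]
      exact isLevi_centralizer_cartan y
    · rw [hlift.leviRoots_eq, h]

variable (H) in
theorem IsSemisimpleElt.exists_inner_le {x : g} (hx : IsSemisimpleElt x) :
    ∃ a ∈ innerGroup g, H ≤ centralizer (a x) := by
  obtain ⟨a, ha, h⟩ := exists_inner_mem_cartan H hx
  exact ⟨a, ha, le_centralizer h⟩

variable (H) in
theorem exists_stratum_eq (X : strata g) : ∃ m : Levi g, H ≤ m.1 ∧ stratum m = X := by
  obtain ⟨X, m, ⟨x, hx, rfl⟩, rfl⟩ := X
  obtain ⟨a, ha, h⟩ := hx.exists_inner_le H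
  refine ⟨⟨centralizer (a x), a x, (isSemisimpleElt_inner_iff ha).mpr hx, rfl⟩, h, ?_⟩
  exact (stratum_eq_iff _ ⟨centralizer x, x, hx, rfl⟩).mpr (isInnerConj_centralizer ha x).symm

variable (H) in
-- Only the smaller subalgebra has to be moved over `H`: the same automorphism applied to both keeps
-- the inclusion.
theorem HiggsLE.exists_le {X₁ X₂ : strata g} (h : HiggsLE X₁ X₂) :
    ∃ m₁ m₂ : Levi g, H ≤ m₁.1 ∧ m₁.1 ≤ m₂.1 ∧ stratum m₁ = X₁ ∧ stratum m₂ = X₂ := by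
  obtain ⟨⟨_, x₁, hx₁, rfl⟩, ⟨_, x₂, hx₂, rfl⟩, hle, rfl, rfl⟩ := h
  obtain ⟨a, ha, h⟩ := hx₁.exists_inner_le H
  refine ⟨⟨centralizer (a x₁), a x₁, (isSemisimpleElt_inner_iff ha).mpr hx₁, rfl⟩,
    ⟨centralizer (a x₂), a x₂, (isSemisimpleElt_inner_iff ha).mpr hx₂, rfl⟩, h, ?_,
    (stratum_eq_iff _ _).mpr (isInnerConj_centralizer ha x₁).symm,
    (stratum_eq_iff _ _).mpr (isInnerConj_centralizer ha x₂).symm⟩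
  intro y hy
  obtain ⟨y, rfl⟩ := a.surjective y
  exact (mem_centralizer_inner_iff ha).mpr (hle ((mem_centralizer_inner_iff ha).mp hy))

theorem exists_dominant_conj (b : (IsKilling.rootSystem H).Base) {m : LieSubalgebra ℂ g}
    (hm : IsLevi m) : ∃ y : H, (∀ i ∈ b.support, 0 ≤ toLexAddHom (i.1 y)) ∧
      IsInnerConj m (centralizer (y : g)) := by
  obtain ⟨x, hx, rfl⟩ := hm
  obtain ⟨a, ha, h⟩ := exists_inner_mem_cartan H hx
  let f : Module.Dual ℂ H →+ Lex (ℝ × ℝ) :=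
    toLexAddHom.comp (LinearMap.applyₗ (⟨a x, h⟩ : H)).toAddMonoidHom
  obtain ⟨w, hw, hdom⟩ := exists_mem_weylPerm_forall_nonneg b f
  obtain ⟨c, hc, hlift⟩ := exists_isLift (inv_mem hw)
  obtain ⟨y, hy, hα⟩ := hlift ⟨a x, h⟩
  refine ⟨y, fun i hi => ?_, ?_⟩
  · have h2 := hα (w i)
    rw [show w⁻¹ (w i) = i from w.symm_apply_apply i] at h2
    rw [h2]
    exact hdom i hi
  · rw [← hy]
    exact isInnerConj_centralizer (mul_mem hc ha) x

/-- Every Levi subalgebra is conjugate to a standard one. -/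
theorem exists_isInnerConj_standardLevi (b : (IsKilling.rootSystem H).Base)
    {m : LieSubalgebra ℂ g} (hm : IsLevi m) :
    ∃ J : Set H.root, J ⊆ b.support ∧ IsInnerConj m (standardLevi H J) := by
  obtain ⟨y, hy, h⟩ := exists_dominant_conj b hm
  exact ⟨_, fun _ hi => hi.1, standardLevi_eq_centralizer b hy ▸ h⟩

/-- The values `0` on `J` and `1` on the other simple roots define a dominant element at which
exactly the simple roots in `J` vanish. -/
theorem exists_standardLevi_eq_centralizer (b : (IsKilling.rootSystem H).Base) {J : Set H.root}
    (hJ : J ⊆ b.support) : ∃ y : H, standardLevi H J = centralizer (y : g) := by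
  classical
  obtain ⟨y, hy⟩ := exists_of_simple_root_values b fun i => if i ∈ J then 0 else 1
  have hdom : ∀ i ∈ b.support, 0 ≤ toLexAddHom (i.1 y) := by
    intro i hi
    rw [hy i hi]
    split_ifs
    · rw [map_zero]
    · simpa using (toLexAddHom_intCast_pos one_pos).le
  have hset : J = {i | i ∈ b.support ∧ i.1 y = 0} := by
    ext i
    refine ⟨fun hi => ⟨hJ hi, by rw [hy i (hJ hi), if_pos hi]⟩, fun hi => ?_⟩
    by_contra h
    have h1 := hy i hi.1
    rw [hi.2, if_neg h] at h1
    exact zero_ne_one h1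
  refine ⟨y, ?_⟩
  rw [hset]
  exact standardLevi_eq_centralizer b hdom

omit [IsKilling ℂ g] in
theorem subset_leviRoots_standardLevi (J : Set H.root) : J ⊆ leviRoots H (standardLevi H J) :=
  fun _ hα _ hv => rootSpace_le_standardLevi hα (Or.inl hv)

end LeviConjugacy

/-! ### Duality of Levi subalgebras and of strata -/

section Duality

variable {g : Type*} [LieRing g] [LieAlgebra ℂ g] [FiniteDimensional ℂ g] [IsSimple ℂ g]
  {g' : Type*} [LieRing g'] [LieAlgebra ℂ g'] [FiniteDimensional ℂ g'] [IsSimple ℂ g']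
  {H : LieSubalgebra ℂ g} [H.IsCartanSubalgebra]
  {H' : LieSubalgebra ℂ g'} [H'.IsCartanSubalgebra]

/-- Under the Killing form a coroot is a nonzero multiple of its root. This is why the roots of a
Levi subalgebra are also cut out by a linear condition on coroots. -/
theorem cartanEquivDual_coroot_eq_zero_iff (y : H) (α : H.root) :
    IsKilling.cartanEquivDual H y (IsKilling.coroot α.1) = 0 ↔ α.1 y = 0 := by
  change LieModule.traceForm ℂ H g y (IsKilling.coroot α.1) = 0 ↔ _
  rw [LieModule.traceForm_comm, IsKilling.traceForm_coroot, smul_eq_zero, smul_eq_zero, inv_eq_zero]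
  simp [IsKilling.root_apply_cartanEquivDual_symm_ne_zero (H.isNonZero_coe_root α)]

theorem weightMap_coroot_apply (e : LanglandsDuality H H') (α : H.root) (y' : H') :
    e.weightMap (IsKilling.coroot α.1) y' = (e.indexEquiv α).1 y' :=
  LinearMap.congr_fun (RootPairing.Hom.root_weightMap_apply _ _ α e.toHom) y'

/-- The Killing pairing with `y` is a functional on the space of coroots. Carried over by `e`, it
becomes a functional on the dual of `H'`, that is, an element of `H'`. -/
theorem exists_dual_element (e : LanglandsDuality H H') (y : H) :
    ∃ y' : H', ∀ α, (e.indexEquiv α).1 y' = 0 ↔ α.1 y = 0 := by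
  let f := RootPairing.Equiv.weightEquiv _ _ e
  let φ : Module.Dual ℂ (Module.Dual ℂ H') :=
    IsKilling.cartanEquivDual H y ∘ₗ (f.symm : Module.Dual ℂ H' →ₗ[ℂ] H)
  obtain ⟨y', hy'⟩ := (Module.evalEquiv ℂ H').surjective φ
  refine ⟨y', fun α => ?_⟩
  rw [← cartanEquivDual_coroot_eq_zero_iff y α, ← weightMap_coroot_apply]
  have h1 : f (IsKilling.coroot α.1) y' = φ (f (IsKilling.coroot α.1)) := by
    rw [← hy']
    rfl
  have h2 : φ (f (IsKilling.coroot α.1)) =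
      IsKilling.cartanEquivDual H y (IsKilling.coroot α.1) :=
    congrArg (IsKilling.cartanEquivDual H y) (f.symm_apply_apply (IsKilling.coroot α.1))
  rw [← h2, ← h1]
  rfl

theorem exists_predual_element (e : LanglandsDuality H H') (y' : H') :
    ∃ y : H, ∀ α, (e.indexEquiv α).1 y' = 0 ↔ α.1 y = 0 := by
  let φ : Module.Dual ℂ H := LinearMap.applyₗ y' ∘ₗ e.weightMap
  obtain ⟨y, hy⟩ := (IsKilling.cartanEquivDual H).surjective φ
  refine ⟨y, fun α => ?_⟩
  rw [← cartanEquivDual_coroot_eq_zero_iff y α, ← weightMap_coroot_apply, hy]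
  rfl

theorem isDualLevi_centralizer (e : LanglandsDuality H H') {y : H} {y' : H'}
    (h : ∀ α, (e.indexEquiv α).1 y' = 0 ↔ α.1 y = 0) :
    IsDualLevi e ⟨centralizer (y : g), isLevi_centralizer_cartan y⟩
      ⟨centralizer (y' : g'), isLevi_centralizer_cartan y'⟩ := by
  refine ⟨le_centralizer y.2, le_centralizer y'.2, ?_⟩
  ext α
  obtain ⟨α, rfl⟩ := e.indexEquiv.surjective α
  rw [e.indexEquiv.injective.mem_set_image, mem_leviRoots_centralizer y.2,
    mem_leviRoots_centralizer y'.2]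
  exact h α

theorem IsDualLevi.right_unique {e : LanglandsDuality H H'} {m : Levi g} {m₁ m₂ : Levi g'}
    (h₁ : IsDualLevi e m m₁) (h₂ : IsDualLevi e m m₂) : m₁ = m₂ :=
  Subtype.ext (m₁.2.eq_of_leviRoots_eq m₂.2 h₁.2.1 h₂.2.1 (h₁.2.2.trans h₂.2.2.symm))

theorem IsDualLevi.left_unique {e : LanglandsDuality H H'} {m₁ m₂ : Levi g} {m' : Levi g'}
    (h₁ : IsDualLevi e m₁ m') (h₂ : IsDualLevi e m₂ m') : m₁ = m₂ :=
  Subtype.ext (m₁.2.eq_of_leviRoots_eq m₂.2 h₁.1 h₂.1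
    (e.indexEquiv.injective.image_injective (h₁.2.2.symm.trans h₂.2.2)))

theorem existsUnique_isDualLevi (e : LanglandsDuality H H') (m : Levi g) (hm : H ≤ m.1) :
    ∃! m' : Levi g', IsDualLevi e m m' := by
  obtain ⟨m, hL⟩ := m
  obtain ⟨y, rfl⟩ := hL.exists_eq_centralizer hm
  obtain ⟨y', h⟩ := exists_dual_element e y
  exact ⟨_, isDualLevi_centralizer e h, fun _ h' => h'.right_unique (isDualLevi_centralizer e h)⟩

theorem existsUnique_isDualLevi' (e : LanglandsDuality H H') (m' : Levi g') (hm' : H' ≤ m'.1) :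
    ∃! m : Levi g, IsDualLevi e m m' := by
  obtain ⟨m', hL⟩ := m'
  obtain ⟨y', rfl⟩ := hL.exists_eq_centralizer hm'
  obtain ⟨y, h⟩ := exists_predual_element e y'
  exact ⟨_, isDualLevi_centralizer e h, fun _ h' => h'.left_unique (isDualLevi_centralizer e h)⟩

theorem IsDualLevi.isInnerConj_iff {e : LanglandsDuality H H'} {m₁ m₂ : Levi g} {m₁' m₂' : Levi g'}
    (h₁ : IsDualLevi e m₁ m₁') (h₂ : IsDualLevi e m₂ m₂') :
    IsInnerConj m₁.1 m₂.1 ↔ IsInnerConj m₁'.1 m₂'.1 := by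
  rw [isInnerConj_iff_exists_weylPerm m₁.2 m₂.2 h₁.1 h₂.1,
    isInnerConj_iff_exists_weylPerm m₁'.2 m₂'.2 h₁.2.1 h₂.2.1, h₁.2.2, h₂.2.2]
  exact exists_weylPerm_image_iff e

theorem IsDualLevi.le_iff {e : LanglandsDuality H H'} {m₁ m₂ : Levi g} {m₁' m₂' : Levi g'}
    (h₁ : IsDualLevi e m₁ m₁') (h₂ : IsDualLevi e m₂ m₂') : m₁.1 ≤ m₂.1 ↔ m₁'.1 ≤ m₂'.1 := by
  rw [levi_le_iff m₁.2 h₁.1 h₂.1, levi_le_iff m₁'.2 h₁.2.1 h₂.2.1, h₁.2.2, h₂.2.2,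
    Set.image_subset_image_iff e.indexEquiv.injective]

/-- The standard Levi subalgebras for corresponding sets of simple roots are dual. -/
theorem exists_isDualLevi_standardLevi (e : LanglandsDuality H H')
    (b : (IsKilling.rootSystem H).Base) {J : Set H.root} (hJ : J ⊆ b.support) :
    ∃ (m : Levi g) (m' : Levi g'), m.1 = standardLevi H J ∧
      m'.1 = standardLevi H' (e.indexEquiv '' J) ∧ IsDualLevi e m m' := by
  -- `b.flip` consists of the same simple roots, as a base of the dual root system that `e` starts
  -- from.
  obtain ⟨b', hb'⟩ := exists_base_of_equiv e b.flip
  obtain ⟨y, hy⟩ := exists_standardLevi_eq_centralizer b hJ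
  obtain ⟨z', hz'⟩ := exists_standardLevi_eq_centralizer b' (J := e.indexEquiv '' J)
    (hb' ▸ Set.image_mono hJ)
  -- The root sets need not be computed. Checking generators puts each standard Levi subalgebra
  -- inside the dual of the other, and since duality respects inclusions, both inclusions are
  -- equalities.
  obtain ⟨y', h⟩ := exists_dual_element e y
  obtain ⟨z, h'⟩ := exists_predual_element e z'
  have hy0 : ∀ α ∈ J, α.1 y = 0 := fun α hα => by
    rw [← Subtype.coe_eta y y.2, ← mem_leviRoots_centralizer y.2, ← hy]
    exact subset_leviRoots_standardLevi J hα
  have hz0 : ∀ α ∈ J, α.1 z = 0 := fun α hα => by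
    rw [← h', ← Subtype.coe_eta z' z'.2, ← mem_leviRoots_centralizer z'.2, ← hz']
    exact subset_leviRoots_standardLevi _ ⟨α, hα, rfl⟩
  have hd := isDualLevi_centralizer e h
  have hd' := isDualLevi_centralizer e h'
  have h₁ : centralizer (y : g) ≤ centralizer (z : g) := hy ▸ standardLevi_le_centralizer hz0
  have h₂ : centralizer (z' : g') ≤ centralizer (y' : g') := by
    rw [← hz']
    refine standardLevi_le_centralizer ?_
    rintro _ ⟨α, hα, rfl⟩
    exact (h α).mpr (hy0 α hα)
  have h₃ : centralizer (z' : g') = centralizer (y' : g') :=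
    le_antisymm h₂ ((hd.le_iff hd').mp h₁)
  exact ⟨_, _, hy.symm, (hz'.trans h₃).symm, hd⟩

/-- The duality of strata. -/
theorem exists_strata_equiv (e : LanglandsDuality H H') :
    ∃ D : strata g ≃ strata g',
      ∀ (m : Levi g) (m' : Levi g'), IsDualLevi e m m' → D (stratum m) = stratum m' := by
  -- `r` picks a representative containing `H` and `d` its dual. The choice does not matter, because
  -- duals of conjugate Levi subalgebras are conjugate; the converse gives injectivity.
  choose r hr hrX using exists_stratum_eq (g := g) H
  choose d hd using fun X => (existsUnique_isDualLevi e (r X) (hr X)).exists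
  have hD : ∀ (m : Levi g) (m' : Levi g'), IsDualLevi e m m' →
      stratum (d (stratum m)) = stratum m' := by
    intro m m' h
    rw [stratum_eq_iff, ← (hd (stratum m)).isInnerConj_iff h, ← stratum_eq_iff, hrX]
  refine ⟨Equiv.ofBijective (fun X => stratum (d X)) ⟨fun X Y h => ?_, fun X' => ?_⟩, hD⟩
  · have h' : stratum (d X) = stratum (d Y) := h
    rwa [stratum_eq_iff, ← (hd X).isInnerConj_iff (hd Y), ← stratum_eq_iff, hrX, hrX] at h'
  · obtain ⟨m', hm', rfl⟩ := exists_stratum_eq H' X'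
    obtain ⟨m, hm, -⟩ := existsUnique_isDualLevi' e m' hm'
    exact ⟨stratum m, hD m m' hm⟩

theorem higgsLE_iff (e : LanglandsDuality H H') (D : strata g ≃ strata g')
    (hD : ∀ (m : Levi g) (m' : Levi g'), IsDualLevi e m m' → D (stratum m) = stratum m')
    (X₁ X₂ : strata g) : HiggsLE X₁ X₂ ↔ HiggsLE (D X₁) (D X₂) := by
  constructor
  · intro h
    obtain ⟨m₁, m₂, hm₁, hle, rfl, rfl⟩ := h.exists_le H
    obtain ⟨m₁', h₁, -⟩ := existsUnique_isDualLevi e m₁ hm₁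
    obtain ⟨m₂', h₂, -⟩ := existsUnique_isDualLevi e m₂ (hm₁.trans hle)
    exact ⟨m₁', m₂', (h₁.le_iff h₂).mp hle, (hD _ _ h₁).symm, (hD _ _ h₂).symm⟩
  · intro h
    obtain ⟨m₁', m₂', hm₁', hle, h₁', h₂'⟩ := h.exists_le H'
    obtain ⟨m₁, h₁, -⟩ := existsUnique_isDualLevi' e m₁' hm₁'
    obtain ⟨m₂, h₂, -⟩ := existsUnique_isDualLevi' e m₂' (hm₁'.trans hle)
    exact ⟨m₁, m₂, (h₁.le_iff h₂).mpr hle, D.injective ((hD _ _ h₁).trans h₁'),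
      D.injective ((hD _ _ h₂).trans h₂')⟩

theorem strata_equiv_unique (e : LanglandsDuality H H') (D D' : strata g ≃ strata g')
    (hD : ∀ (m : Levi g) (m' : Levi g'), IsDualLevi e m m' → D (stratum m) = stratum m')
    (hD' : ∀ (m : Levi g) (m' : Levi g'), IsDualLevi e m m' → D' (stratum m) = stratum m') :
    D' = D := by
  ext1 X
  obtain ⟨m, hm, rfl⟩ := exists_stratum_eq H X
  obtain ⟨m', h, -⟩ := existsUnique_isDualLevi e m hm
  rw [hD' _ _ h, hD _ _ h]

end Duality

end StrataDuality

open StrataDuality LieAlgebra in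
theorem mainTheorem1
    {g : Type*} [LieRing g] [LieAlgebra ℂ g] [FiniteDimensional ℂ g] [IsSimple ℂ g]
    {g' : Type*} [LieRing g'] [LieAlgebra ℂ g'] [FiniteDimensional ℂ g'] [IsSimple ℂ g']
    (H : LieSubalgebra ℂ g) [H.IsCartanSubalgebra]
    (H' : LieSubalgebra ℂ g') [H'.IsCartanSubalgebra]
    (e : LanglandsDuality H H') :
    -- the strata of the space of aligned vacua, labelled by Levi classes and by Dixmier sheets
    (Setoid.IsPartition (strata g) ∧
      (∀ m₁ m₂ : Levi g, stratum m₁ = stratum m₂ ↔ IsInnerConj m₁.1 m₂.1) ∧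
      Set.BijOn vacuaInSheet {S : Set g | IsDixmierSheet S} (strata g) ∧
      (∀ (S : Set g) (m : Levi g), IsDixmierSheet S →
        (vacuaInSheet S = (stratum m).1 ↔
          ∃ x ∈ S, IsSemisimpleElt x ∧ centralizer x = m.1))) ∧
    -- every Levi subalgebra containing `H` has a dual, and conversely
    (∀ m : Levi g, H ≤ m.1 → ∃! m' : Levi g', IsDualLevi e m m') ∧
    (∀ m' : Levi g', H' ≤ m'.1 → ∃! m : Levi g, IsDualLevi e m m') ∧
    -- in terms of simple roots
    (∀ b : (IsKilling.rootSystem H).Base,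
      (∃ b' : (IsKilling.rootSystem H').Base,
        (b'.support : Set H'.root) = e.indexEquiv '' (b.support : Set H.root)) ∧
      (∀ J : Set H.root, J ⊆ b.support → ∃ (m : Levi g) (m' : Levi g'),
        m.1 = standardLevi H J ∧ m'.1 = standardLevi H' (e.indexEquiv '' J) ∧
        IsDualLevi e m m') ∧
      (∀ m : Levi g, ∃ J : Set H.root, J ⊆ b.support ∧ IsInnerConj m.1 (standardLevi H J))) ∧
    -- the duality of strata, compatible with symmetry breaking
    (∃ D : strata g ≃ strata g',
      (∀ (m : Levi g) (m' : Levi g'), IsDualLevi e m m' → D (stratum m) = stratum m') ∧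
      (∀ X₁ X₂ : strata g, HiggsLE X₁ X₂ ↔ HiggsLE (D X₁) (D X₂)) ∧
      (∀ D' : strata g ≃ strata g',
        (∀ (m : Levi g) (m' : Levi g'), IsDualLevi e m m' → D' (stratum m) = stratum m') →
        D' = D)) := by
  obtain ⟨D, hD⟩ := exists_strata_equiv e
  exact ⟨⟨isPartition_strata, stratum_eq_iff, bijOn_vacuaInSheet,
      fun S m hS => hS.vacuaInSheet_eq_iff m⟩,
    existsUnique_isDualLevi e, existsUnique_isDualLevi' e,
    fun b => ⟨exists_base_of_equiv e b.flip, fun J hJ => exists_isDualLevi_standardLevi e b hJ,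
      fun m => exists_isInnerConj_standardLevi b m.2⟩,
    D, hD, higgsLE_iff e D hD, fun D' hD' => strata_equiv_unique e D D' hD hD'⟩
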